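/- Let $0<a,b<1$, $\max\{a+b,1\}\le c\le 1+\min\{a,b\}$, $r\in(0,1)$, $r'=\sqrt{1-r^2}$, let $B$ be the Beta function, $F(\alpha,\beta;\gamma;x)$ the Gaussian hypergeometric function and $H=\{z\in\mathbb C:\operatorname{Im} z\ge 0\}$. For $z\in H$ put $$f(z)=\frac{1}{B(b,c-b)}\int_0^z t^{b-1}(1-t)^{c-b-1}(1-r^2t)^{-a}\,dt ,$$ where the integral is taken along the segment $[0,z]$ and the integrand is the branch that is analytic in the interior of $H$, continuous on $H\setminus\{0,1,1/r^2\}$ and positive on $(0,1)$; that is, for $t\in H$ one takes $\arg t\in[0,\pi]$, $\arg(1-t)\in[-\pi,0]$ and $\arg(1-r^2t)\in[-\pi,0]$. Then the integral converges absolutely for every $z\in H$, and $f$ is conformal in the interior of $H$: it is holomorphic there, with derivative equal to $1/B(b,c-b)$ times the integrand, and $f'\neq 0$. Moreover $$f(0)=0,\qquad f(1)=F(a,b;c;r^2),$$ $$f(1/r^2)=f(1)+\frac{B(c-b,1-a)}{B(b,c-b)}\,e^{(b+1-c)i\pi}\,{r'}^{2(c-a-b)}\,F(c-a,c-b;c+1-a-b;{r'}^2).$$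 If $c<1+a$, then $f$, extended to the point $\infty$ by the value $$f(\infty)=f(1/r^2)+\frac{B(1-a,a+1-c)}{B(b,c-b)}\,e^{(a+b+1-c)i\pi}\,r^{2(1-c)}\,{r'}^{2(c-a-b)}\,F(1-b,1-a;2-c;r^2),$$ is a homeomorphism of $H\cup\{\infty\}$ (the one-point compactification of $H$) onto the closed convex quadrilateral with consecutive vertices $f(0),f(1),f(1/r^2),f(\infty)$, whose interior angles at these vertices are $b\pi$, $(c-b)\pi$, $(1-a)\pi$ and $(a+1-c)\pi$, respectively. (The angle at $f(1)$ is straight when $c=1+b$.) If $c=1+a$, the same holds with $f(\infty)=\infty$: $f(z)\to\infty$ as $z\to\infty$ in $H$, and $f$ is a homeomorphism of $H$ onto an unbounded closed convex quadrilateral with consecutive vertices $f(0),f(1),f(1/r^2),\infty$, whose two sides meeting at $\infty$ are parallel rays issuing from $f(0)$ and $f(1/r^2)$ in a common direction $u$ (so the angle at $\infty$ is $(a+1-c)\pi=0$), and which is the set of all points $p+su$ with $p$ in the triangle (possibly degenerate) spanned by $f(0),f(1),f(1/r^2)$ and $s\ge0$; the interior angles at $f(0),f(1),f(1/r^2)$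 are $b\pi$, $(c-b)\pi$ and $(1-a)\pi$. -/

import Mathlib

noncomputable section

/-- The closed upper half-plane `{z : ℂ | 0 ≤ Im z}`. -/
def closedUpperHalfPlane : Set ℂ := {z | 0 ≤ z.im}

/-- The power `w ^ p = |w| ^ p * exp (i p arg w)` for `w ≠ 0` in the closed lower half-plane, with
the argument taken in `[-π, 0]`: it is `0` on the positive and `-π` on the negative real axis.
(Here `-w` is in the closed upper half-plane, where the principal argument lies in `[0, π]` and
equals `arg w + π`.) -/
def lowerCpow (w p : ℂ) : ℂ :=
  Complex.exp (-(Real.pi * Complex.I * p)) * (-w) ^ p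

/-- The integrand `t ^ (b - 1) * (1 - t) ^ (c - b - 1) * (1 - r ^ 2 * t) ^ (-a)`
on the closed upper half-plane: the branch that is continuous there away from `0`, `1`,
`1 / r ^ 2`, analytic in the interior, and positive on the interval `(0, 1)`. For `t` in the closed
upper half-plane `1 - t` and `1 - r ^ 2 * t` are in the closed lower half-plane. -/
def scIntegrand (a b c r : ℝ) (t : ℂ) : ℂ :=
  t ^ ((b : ℂ) - 1) * lowerCpow (1 - t) ((c : ℂ) - b - 1) *
    lowerCpow (1 - (r : ℂ) ^ 2 * t) (-(a : ℂ))

/-- The constant `C = 1 / B(b, c - b)`. -/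
def scConst (b c : ℝ) : ℂ := 1 / Complex.betaIntegral b ((c : ℂ) - b)

/-- `f z = C * ∫_0^z g(t) dt`, the integral being taken along the segment from `0` to `z`,
parametrized by `t = s z` with `s ∈ [0, 1]`. -/
def scMap (a b c r : ℝ) (z : ℂ) : ℂ :=
  scConst b c * ∫ s in (0 : ℝ)..1, scIntegrand a b c r ((s : ℂ) * z) * z

/-- `Q` is the (closed, nondegenerate, convex) quadrilateral with consecutive vertices
`v 0, v 1, v 2, v 3` (indices modulo 4): it is their convex hull, it has interior points, and its
boundary is the union of the four sides `[v k, v (k + 1)]`. A vertex at which the interior angle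
is straight is allowed. -/
structure IsConvexQuadrilateral (Q : Set ℂ) (v : Fin 4 → ℂ) : Prop where
  injective : Function.Injective v
  eq_convexHull : Q = convexHull ℝ (Set.range v)
  interior_nonempty : (interior Q).Nonempty
  frontier_eq : frontier Q = ⋃ k : Fin 4, segment ℝ (v k) (v (k + 1))

/-- The closed ray from `p` in the direction `u`. -/
def closedRay (p u : ℂ) : Set ℂ := {z | ∃ s : ℝ, 0 ≤ s ∧ z = p + (s : ℂ) * u}

/-- `Q` is the unbounded convex quadrilateral with consecutive vertices `v 0, v 1, v 2, ∞` and
angle zero at `∞`: the two sides that meet at `∞` are parallel rays in the direction `u`. -/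
structure IsConvexQuadrilateralAtInfinity (Q : Set ℂ) (v : Fin 3 → ℂ) (u : ℂ) : Prop where
  injective : Function.Injective v
  direction_ne_zero : u ≠ 0
  eq_hull : Q = {z | ∃ p ∈ convexHull ℝ (Set.range v), z ∈ closedRay p u}
  interior_nonempty : (interior Q).Nonempty
  frontier_eq : frontier Q =
    closedRay (v 0) u ∪ segment ℝ (v 0) (v 1) ∪ segment ℝ (v 1) (v 2) ∪ closedRay (v 2) u

end

/-!
# The Schwarz–Christoffel map onto a convex quadrilateral

On each of the intervals into which `0`, `1` and `1 / r ^ 2` divide the real axis the argument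
`scArg` of the integrand is constant, so that `f = scMap a b c r` maps the interval bijectively
onto a line segment or a ray (`side_neg`, `side_zero_one`, `side_one_inv`, `side_inv`). The
directions of the four sides give the angles. The conditions on the parameters say that the closed
polygon turns to the left at every vertex (or goes straight on at `f 1`), and such a quadrilateral
is convex (`isConvexQuadrilateral_of_planeCross`,
`isConvexQuadrilateralAtInfinity_of_planeCross`).

At infinity the integrand is of order `|t| ^ (c - a - 2)`. For `c < 1 + a` this is integrable, and
`f` has a limit (`tendsto_scMap_cocompact`). For `c = 1 + a`, along every ray from `0` the map `f`
moves in directions between `0` and `b * π`, at a speed of order `1 / |t|`; hence it grows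
logarithmically and its image lies in an angle (`log_norm_le_norm_scMap`,
`re_unitDir_mul_scMap_nonneg`).

That `f` is a homeomorphism onto the quadrilateral `Q` follows from the behaviour on the boundary
by topology alone (`BoundaryMap`). The image of `f` is closed, and since `f` is open in the
interior, the frontier of the image lies on the frontier of `Q`. An image with this property that
contains no line lies in the convex set `Q`, and then it is all of `Q` by connectedness. For
injectivity, the set of the points of the open half-plane whose value is taken twice is open and
relatively closed, and it is not the whole half-plane because `f` is injective on the boundary and
near the boundary point `1 / 2` (`BoundaryMap.injOn_interior`).

The lengths of the sides are Euler integrals: the intervals `(1, 1 / r ^ 2)` and `(1 / r ^ 2, ∞)`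
are carried to `(0, 1)` by the Möbius transformations in `integral_density_one_inv` and
`integral_density_inv_infty`, and Euler's integral is evaluated by integrating the binomial series
(`euler_integral`).
-/

open Filter Topology

/-! ### Euler's integral for the hypergeometric function -/

/-- `B(u + n, v) = B(u, v) (u)_n / (u + v)_n`. -/
theorem betaIntegral_add_nat {u v : ℂ} (hu : 0 < u.re) (hv : 0 < v.re) (n : ℕ) :
    Complex.betaIntegral (u + n) v = Complex.betaIntegral u v *
      ((ascPochhammer ℂ n).eval u * ((ascPochhammer ℂ n).eval (u + v))⁻¹) := by
  have key : ∀ {z : ℂ}, 0 < z.re → ∀ k : ℕ, z ≠ -k := by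
    rintro z hz k rfl
    have h0 : (0 : ℝ) ≤ k := k.cast_nonneg
    simp only [Complex.neg_re, Complex.natCast_re] at hz
    linarith
  have huv : 0 < (u + v).re := by simpa using add_pos hu hv
  have hun : 0 < (u + n).re := by
    have h0 : (0 : ℝ) ≤ n := n.cast_nonneg
    simp only [Complex.add_re, Complex.natCast_re]; linarith
  have huvn : 0 < (u + v + n).re := by
    have h0 : (0 : ℝ) ≤ n := n.cast_nonneg
    simp only [Complex.add_re, Complex.natCast_re] at huv ⊢; linarith
  rw [Complex.betaIntegral_eq_Gamma_mul_div _ _ hun hv,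
    Complex.betaIntegral_eq_Gamma_mul_div _ _ hu hv,
    ← Complex.Gamma_add_nat_div_Gamma_eq u (key hu),
    ← Complex.Gamma_add_nat_div_Gamma_eq _ (key huv), show u + n + v = u + v + n by ring]
  have h1 := Complex.Gamma_ne_zero_of_re_pos hu
  have h2 := Complex.Gamma_ne_zero_of_re_pos huv
  have h3 := Complex.Gamma_ne_zero_of_re_pos huvn
  field_simp

theorem choose_add_sub_one_eq_ascPochhammer (A : ℂ) (n : ℕ) :
    Ring.choose (A + n - 1) n = (n.factorial : ℂ)⁻¹ * (ascPochhammer ℂ n).eval A := by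
  have h := Ring.factorial_nsmul_multichoose_eq_ascPochhammer A n
  rw [Ring.multichoose_eq, Polynomial.ascPochhammer_smeval_eq_eval, nsmul_eq_mul] at h
  have hn : (n.factorial : ℂ) ≠ 0 := by exact_mod_cast n.factorial_ne_zero
  rw [← h]; field_simp

/-- The binomial series of `(1 - z) ^ (-A)`. -/
theorem hasSum_one_sub_cpow_neg (A : ℂ) {z : ℂ} (hz : ‖z‖ < 1) :
    HasSum (fun n : ℕ => (n.factorial : ℂ)⁻¹ * (ascPochhammer ℂ n).eval A * z ^ n)
      ((1 - z) ^ (-A)) := by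
  have h := (Complex.one_div_one_sub_cpow_hasFPowerSeriesOnBall_zero A).hasSum (y := z)
    (by simpa [enorm_eq_nnnorm, ← NNReal.coe_lt_coe] using hz)
  simp only [zero_add, one_div, ← Complex.cpow_neg,
    FormalMultilinearSeries.ofScalars_apply_eq, choose_add_sub_one_eq_ascPochhammer,
    smul_eq_mul] at h
  exact h

theorem summable_norm_binomial (A : ℂ) {x : ℝ} (hx : 0 ≤ x) (hx1 : x < 1) :
    Summable fun n : ℕ => ‖(n.factorial : ℂ)⁻¹ * (ascPochhammer ℂ n).eval A‖ * x ^ n := by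
  have h := (hasSum_one_sub_cpow_neg A (z := x)
    (by simpa [abs_of_nonneg hx] using hx1)).summable.norm
  refine h.congr fun n => ?_
  rw [norm_mul, norm_pow, Complex.norm_real, Real.norm_of_nonneg hx]

/-- Euler's integral representation of the hypergeometric function, obtained by integrating the
binomial series of `(1 - x t) ^ (-A)` term by term. -/
theorem euler_integral {A B D : ℂ} (hB : 0 < B.re) (hD : 0 < D.re) {x : ℝ} (hx : 0 ≤ x)
    (hx1 : x < 1) :
    ∫ t in (0 : ℝ)..1, (t : ℂ) ^ (B - 1) * (1 - (t : ℂ)) ^ (D - 1) * (1 - (x : ℂ) * t) ^ (-A) =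
      Complex.betaIntegral B D * ₂F₁ A B (B + D) (x : ℂ) := by
  set k : ℝ → ℂ := fun t => (t : ℂ) ^ (B - 1) * (1 - (t : ℂ)) ^ (D - 1) with hk
  have hki : IntervalIntegrable k MeasureTheory.volume 0 1 :=
    Complex.betaIntegral_convergent hB hD
  set α : ℕ → ℂ := fun n => (n.factorial : ℂ)⁻¹ * (ascPochhammer ℂ n).eval A with hα
  have hsum := summable_norm_binomial A hx hx1
  have hS : HasSum (fun n => ∫ t in (0 : ℝ)..1, k t * (α n * ((x : ℂ) * t) ^ n))
      (∫ t in (0 : ℝ)..1, k t * (1 - (x : ℂ) * t) ^ (-A)) := by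
    refine intervalIntegral.hasSum_integral_of_dominated_convergence
      (fun n t => ‖k t‖ * (‖α n‖ * x ^ n)) ?_ ?_ ?_ ?_ ?_
    · intro n
      refine AEMeasurable.aestronglyMeasurable (AEMeasurable.mul ?_ ?_)
      · have := hki.aestronglyMeasurable
        rw [← Set.uIoc_of_le zero_le_one] at this
        exact this.aemeasurable
      · fun_prop
    · refine fun n => Filter.Eventually.of_forall fun t ht => ?_
      rw [Set.uIoc_of_le zero_le_one] at ht
      rw [norm_mul (k t), norm_mul (α n), norm_pow, norm_mul (x : ℂ), Complex.norm_real,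
        Complex.norm_real, Real.norm_of_nonneg hx, Real.norm_of_nonneg ht.1.le]
      have hxt : x * t ≤ x := by nlinarith [ht.1, ht.2]
      have hxt0 : 0 ≤ x * t := mul_nonneg hx ht.1.le
      gcongr
    · exact Filter.Eventually.of_forall fun t _ => hsum.mul_left _
    · simp_rw [tsum_mul_left]
      exact hki.norm.mul_const _
    · refine Filter.Eventually.of_forall fun t ht => ?_
      rw [Set.uIoc_of_le zero_le_one] at ht
      refine (hasSum_one_sub_cpow_neg A ?_).mul_left _
      rw [norm_mul, Complex.norm_real, Complex.norm_real,
        Real.norm_of_nonneg hx, Real.norm_of_nonneg ht.1.le]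
      nlinarith [ht.1, ht.2]
  rw [← hS.tsum_eq, ordinaryHypergeometric_eq_tsum, ← tsum_mul_left]
  refine tsum_congr fun n => ?_
  have hterm : ∫ t in (0 : ℝ)..1, k t * (α n * ((x : ℂ) * t) ^ n) =
      (α n * (x : ℂ) ^ n) * Complex.betaIntegral (B + n) D := by
    rw [Complex.betaIntegral, ← intervalIntegral.integral_const_mul]
    refine intervalIntegral.integral_congr_ae (Filter.Eventually.of_forall fun t ht => ?_)
    rw [Set.uIoc_of_le zero_le_one] at ht
    have ht0 : (t : ℂ) ≠ 0 := by exact_mod_cast ht.1.ne'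
    simp only [hk]
    rw [show B + n - 1 = (B - 1) + n by ring, Complex.cpow_add _ _ ht0, Complex.cpow_natCast,
      mul_pow]
    ring
  rw [hterm, betaIntegral_add_nat hB hD, hα, smul_eq_mul]
  ring

/-! ### The integrand -/

/-- The standing assumptions on the parameters. The maximum and the minimum in
`max (a + b) 1 ≤ c ≤ 1 + min a b` are resolved into two inequalities each. -/
structure SCParams (a b c r : ℝ) : Prop where
  ha : 0 < a
  ha1 : a < 1
  hb : 0 < b
  hb1 : b < 1
  hab : a + b ≤ c
  hc1 : 1 ≤ c
  hca : c ≤ 1 + a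
  hcb : c ≤ 1 + b
  hr : 0 < r
  hr1 : r < 1

theorem SCParams.one_lt {a b c r : ℝ} (h : SCParams a b c r) : 1 < 1 / r ^ 2 := by
  have := h.hr; have := h.hr1
  rw [lt_div_iff₀ (by positivity)]; nlinarith

/-- The absolute value of the integrand. -/
noncomputable def scDensity (a b c r : ℝ) (t : ℂ) : ℝ :=
  ‖t‖ ^ (b - 1) * ‖1 - t‖ ^ (c - b - 1) * ‖1 - (r : ℂ) ^ 2 * t‖ ^ (-a)

/-- The continuous branch of the argument of the integrand on the closed upper half-plane. There
the argument of `1 - t` in `[-π, 0]` is `arg (t - 1) - π`, and likewise for `1 - r ^ 2 * t`; so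
the three summands, the contributions of the three factors, are nonpositive, nonnegative and
nonnegative. -/
noncomputable def scArg (a b c r : ℝ) (t : ℂ) : ℝ :=
  (b - 1) * t.arg + (b + 1 - c) * (Real.pi - (t - 1).arg) +
    a * (Real.pi - ((r : ℂ) ^ 2 * t - 1).arg)

theorem cpow_ofReal_eq_exp (w : ℂ) (q : ℝ) :
    w ^ (q : ℂ) = ((‖w‖ ^ q : ℝ) : ℂ) * Complex.exp ((q * w.arg : ℝ) * Complex.I) := by
  rw [Complex.cpow_ofReal, Complex.exp_mul_I]
  push_cast
  rw [mul_comm (w.arg : ℂ)]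

/-- Polar form of `lowerCpow`: the argument of `w` in `[-π, 0]` is `arg (-w) - π`. -/
theorem lowerCpow_ofReal_eq_exp (w : ℂ) (q : ℝ) :
    lowerCpow w q = ((‖w‖ ^ q : ℝ) : ℂ) *
      Complex.exp ((q * ((-w).arg - Real.pi) : ℝ) * Complex.I) := by
  rw [lowerCpow, cpow_ofReal_eq_exp, norm_neg, mul_left_comm, ← Complex.exp_add]
  congr 2
  push_cast
  ring

theorem scIntegrand_eq (a b c r : ℝ) (t : ℂ) :
    scIntegrand a b c r t =
      (scDensity a b c r t : ℂ) * Complex.exp (scArg a b c r t * Complex.I) := by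
  have e1 : (b : ℂ) - 1 = ((b - 1 : ℝ) : ℂ) := by push_cast; ring
  have e2 : (c : ℂ) - b - 1 = ((c - b - 1 : ℝ) : ℂ) := by push_cast; ring
  have e3 : -(a : ℂ) = ((-a : ℝ) : ℂ) := by push_cast; ring
  rw [scIntegrand, e1, e2, e3, cpow_ofReal_eq_exp, lowerCpow_ofReal_eq_exp, lowerCpow_ofReal_eq_exp,
    neg_sub, neg_sub]
  have : Complex.exp (scArg a b c r t * Complex.I) =
      Complex.exp (((b - 1) * t.arg : ℝ) * Complex.I) *
      Complex.exp (((c - b - 1) * ((t - 1).arg - Real.pi) : ℝ) * Complex.I) *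
      Complex.exp ((-a * (((r : ℂ) ^ 2 * t - 1).arg - Real.pi) : ℝ) * Complex.I) := by
    rw [← Complex.exp_add, ← Complex.exp_add, scArg]
    congr 1
    push_cast
    ring
  rw [this, scDensity]
  push_cast
  ring

theorem scDensity_nonneg (a b c r : ℝ) (t : ℂ) : 0 ≤ scDensity a b c r t := by
  unfold scDensity; positivity

theorem norm_scIntegrand (a b c r : ℝ) (t : ℂ) :
    ‖scIntegrand a b c r t‖ = scDensity a b c r t := by
  rw [scIntegrand_eq, norm_mul, Complex.norm_exp_ofReal_mul_I, mul_one, Complex.norm_real,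
    Real.norm_of_nonneg (scDensity_nonneg ..)]

theorem measurable_scIntegrand (a b c r : ℝ) : Measurable (scIntegrand a b c r) := by
  unfold scIntegrand lowerCpow
  fun_prop

theorem one_sub_sq_mul_ne_zero {r : ℝ} (hr : 0 < r) {t : ℂ} (ht : t ≠ 1 / (r : ℂ) ^ 2) :
    1 - (r : ℂ) ^ 2 * t ≠ 0 := by
  have hr' : (r : ℂ) ^ 2 ≠ 0 := by exact_mod_cast (pow_pos hr 2).ne'
  intro h
  exact ht ((eq_div_iff hr').2 (by linear_combination -h))

theorem scDensity_pos {a b c r : ℝ} (hr : 0 < r) {t : ℂ} (h0 : t ≠ 0) (h1 : t ≠ 1)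
    (h2 : t ≠ 1 / (r : ℂ) ^ 2) : 0 < scDensity a b c r t := by
  have := norm_pos_iff.2 h0
  have := norm_pos_iff.2 (sub_ne_zero.2 h1.symm)
  have := norm_pos_iff.2 (one_sub_sq_mul_ne_zero hr h2)
  unfold scDensity; positivity

theorem ne_singular_of_im_pos {r : ℝ} {t : ℂ} (ht : 0 < t.im) :
    t ≠ 0 ∧ t ≠ 1 ∧ t ≠ 1 / (r : ℂ) ^ 2 := by
  refine ⟨?_, ?_, ?_⟩ <;> rintro rfl
  · simp at ht
  · simp at ht
  · rw [show 1 / (r : ℂ) ^ 2 = ((1 / r ^ 2 : ℝ) : ℂ) by push_cast; ring, Complex.ofReal_im] at ht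
    exact ht.false

/-- The principal logarithm is continuous on the closed upper half-plane away from `0`. -/
theorem continuousOn_log_upper :
    ContinuousOn Complex.log (closedUpperHalfPlane \ {0}) := by
  rintro z ⟨hz, hz0⟩
  by_cases hs : z ∈ Complex.slitPlane
  · exact (continuousAt_clog hs).continuousWithinAt
  · have h : ¬ (0 < z.re ∨ z.im ≠ 0) := hs
    push Not at h
    have hre : z.re < 0 := lt_of_le_of_ne h.1 fun h0 => hz0 (Complex.ext h0 h.2)
    exact (Complex.continuousWithinAt_log_of_re_neg_of_im_zero hre h.2).mono Set.sdiff_subset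

theorem continuousOn_cpow_upper (q : ℂ) :
    ContinuousOn (fun z : ℂ => z ^ q) (closedUpperHalfPlane \ {0}) := by
  refine ContinuousOn.congr (f := fun z => Complex.exp (Complex.log z * q)) ?_ ?_
  · exact (continuousOn_log_upper.mul continuousOn_const).cexp
  · exact fun z hz => Complex.cpow_def_of_ne_zero hz.2 q

theorem continuousOn_scIntegrand {a b c r : ℝ} (hr : 0 < r) :
    ContinuousOn (scIntegrand a b c r) (closedUpperHalfPlane \ {0, 1, 1 / (r : ℂ) ^ 2}) := by
  have hsub : closedUpperHalfPlane \ {0, 1, 1 / (r : ℂ) ^ 2} ⊆ closedUpperHalfPlane \ {0} :=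
    Set.sdiff_subset_sdiff_right (by simp)
  unfold scIntegrand lowerCpow
  refine (((continuousOn_cpow_upper _).mono hsub).mul (continuousOn_const.mul
    ((continuousOn_cpow_upper _).comp (by fun_prop) ?_))).mul (continuousOn_const.mul
    ((continuousOn_cpow_upper _).comp (by fun_prop) ?_))
  · rintro t ⟨ht, hts⟩
    simp only [Set.mem_insert_iff, Set.mem_singleton_iff, not_or] at hts
    refine ⟨by simpa [closedUpperHalfPlane] using ht, ?_⟩
    simpa [sub_eq_zero] using hts.2.1
  · rintro t ⟨ht, hts⟩
    simp only [Set.mem_insert_iff, Set.mem_singleton_iff, not_or] at hts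
    refine ⟨?_, ?_⟩
    · have : 0 ≤ r ^ 2 * t.im := mul_nonneg (by positivity) ht
      simpa [closedUpperHalfPlane, ← Complex.ofReal_pow] using this
    · exact neg_ne_zero.2 (one_sub_sq_mul_ne_zero hr hts.2.2)

theorem hasDerivAt_cpow_const {w : ℂ} (hw : 0 < w.im) (q : ℂ) :
    HasDerivAt (fun w : ℂ => w ^ q) (w ^ q * (q / w)) w := by
  have hs : w ∈ Complex.slitPlane := Or.inr hw.ne'
  have h0 : w ≠ 0 := Complex.slitPlane_ne_zero hs
  have h := (hasDerivAt_id w).cpow_const (c := q) hs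
  simp only [id] at h
  convert h using 1
  rw [Complex.cpow_sub _ _ h0, Complex.cpow_one]
  ring

/-- The logarithmic derivative of the integrand. -/
noncomputable def scLogDeriv (a b c r : ℝ) (t : ℂ) : ℂ :=
  ((b : ℂ) - 1) / t - ((c : ℂ) - b - 1) / (1 - t) + (r : ℂ) ^ 2 * a / (1 - (r : ℂ) ^ 2 * t)

theorem hasDerivAt_scIntegrand {a b c r : ℝ} (hr : 0 < r) {t : ℂ} (ht : 0 < t.im) :
    HasDerivAt (scIntegrand a b c r) (scIntegrand a b c r t * scLogDeriv a b c r t) t := by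
  obtain ⟨h0, h1, h2⟩ := ne_singular_of_im_pos (r := r) ht
  have h2' := one_sub_sq_mul_ne_zero hr h2
  have h1' : 1 - t ≠ 0 := sub_ne_zero.2 h1.symm
  have him1 : 0 < (-(1 - t)).im := by simpa using ht
  have him2 : 0 < (-(1 - (r : ℂ) ^ 2 * t)).im := by
    have : 0 < r ^ 2 * t.im := by positivity
    simpa [← Complex.ofReal_pow] using this
  have d1 : HasDerivAt (fun t : ℂ => -(1 - t)) 1 t := by
    exact (((hasDerivAt_id t).const_sub 1).neg).congr_deriv (by ring)
  have d2 : HasDerivAt (fun t : ℂ => -(1 - (r : ℂ) ^ 2 * t)) ((r : ℂ) ^ 2) t := by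
    exact ((((hasDerivAt_id t).const_mul ((r : ℂ) ^ 2)).const_sub 1).neg).congr_deriv (by ring)
  have e0 := hasDerivAt_cpow_const ht ((b : ℂ) - 1)
  have e1 := ((hasDerivAt_cpow_const him1 ((c : ℂ) - b - 1)).comp t d1).const_mul
    (Complex.exp (-(Real.pi * Complex.I * ((c : ℂ) - b - 1))))
  have e2 := ((hasDerivAt_cpow_const him2 (-(a : ℂ))).comp t d2).const_mul
    (Complex.exp (-(Real.pi * Complex.I * (-(a : ℂ)))))
  refine ((e0.mul e1).mul e2).congr_deriv ?_
  simp only [scIntegrand, lowerCpow, scLogDeriv, Function.comp, Pi.mul_apply]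
  rw [div_neg, div_neg, neg_div]
  ring

/-! ### Integrability along rays -/

/-- A locally integrable function of the modulus `ρ = |t|` that dominates the integrand up to a
constant, uniformly in the direction of `t`. -/
noncomputable def scMajorant (a b c r ρ : ℝ) : ℝ :=
  |ρ| ^ (b - 1) + |ρ - 1| ^ (c - b - 1) + |ρ - 1 / r ^ 2| ^ (-a)

/-- A product of three negative powers of which at most one base can be small is dominated by the
sum of the powers. -/
theorem mul_rpow_le_sum {δ x y z α β γ : ℝ} (hδ : 0 < δ) (hα : α ≤ 0) (hβ : β ≤ 0) (hγ : γ ≤ 0)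
    (hx : 0 < x) (hy : 0 < y) (hz : 0 < z) (hxy : δ ≤ x ∨ δ ≤ y) (hxz : δ ≤ x ∨ δ ≤ z)
    (hyz : δ ≤ y ∨ δ ≤ z) :
    x ^ α * y ^ β * z ^ γ ≤
      (δ ^ β * δ ^ γ + δ ^ α * δ ^ γ + δ ^ α * δ ^ β) * (x ^ α + y ^ β + z ^ γ) := by
  have pX : 0 < x ^ α := by positivity
  have pY : 0 < y ^ β := by positivity
  have pZ : 0 < z ^ γ := by positivity
  have pα : 0 < δ ^ α := by positivity
  have pβ : 0 < δ ^ β := by positivity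
  have pγ : 0 < δ ^ γ := by positivity
  have bx : δ ≤ x → x ^ α ≤ δ ^ α := fun h => Real.rpow_le_rpow_of_nonpos hδ h hα
  have byy : δ ≤ y → y ^ β ≤ δ ^ β := fun h => Real.rpow_le_rpow_of_nonpos hδ h hβ
  have bz : δ ≤ z → z ^ γ ≤ δ ^ γ := fun h => Real.rpow_le_rpow_of_nonpos hδ h hγ
  generalize x ^ α = X at *
  generalize y ^ β = Y at *
  generalize z ^ γ = Z at *
  generalize δ ^ α = A at *
  generalize δ ^ β = B at *
  generalize δ ^ γ = G at *
  have expand : ∀ T, (T = X * (B * G) ∨ T = Y * (A * G) ∨ T = Z * (A * B)) →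
      T ≤ (B * G + A * G + A * B) * (X + Y + Z) := by
    have q1 := mul_pos pX (mul_pos pα pγ)
    have q2 := mul_pos pX (mul_pos pα pβ)
    have q3 := mul_pos pX (mul_pos pβ pγ)
    have q4 := mul_pos pY (mul_pos pα pγ)
    have q5 := mul_pos pY (mul_pos pα pβ)
    have q6 := mul_pos pY (mul_pos pβ pγ)
    have q7 := mul_pos pZ (mul_pos pα pγ)
    have q8 := mul_pos pZ (mul_pos pα pβ)
    have q9 := mul_pos pZ (mul_pos pβ pγ)
    rintro T (rfl | rfl | rfl) <;> nlinarith
  by_cases h1 : δ ≤ x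
  · rcases hyz with h2 | h2
    · refine le_trans ?_ (expand _ (Or.inr (Or.inr rfl)))
      rw [mul_comm]
      gcongr
      exacts [bx h1, byy h2]
    · refine le_trans ?_ (expand _ (Or.inr (Or.inl rfl)))
      rw [mul_comm X Y, mul_assoc]
      gcongr
      exacts [bx h1, bz h2]
  · refine le_trans ?_ (expand _ (Or.inl rfl))
    rw [mul_assoc]
    gcongr
    exacts [byy (hxy.resolve_left h1), bz (hxz.resolve_left h1)]

/-- By the reverse triangle inequality the distance of `t` from a singularity `x > 0` is at least
`||t| - x|`; and two of the three distances are never small at the same time. -/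
theorem exists_scDensity_le {a b c r : ℝ} (h : SCParams a b c r) :
    ∃ M : ℝ, 0 < M ∧ ∀ t : ℂ, ‖t‖ ≠ 0 → ‖t‖ ≠ 1 → ‖t‖ ≠ 1 / r ^ 2 →
      scDensity a b c r t ≤ M * scMajorant a b c r ‖t‖ := by
  have hp := h.one_lt
  have hr := h.hr
  set p := 1 / r ^ 2 with hpdef
  -- `2 * δ` is the least distance between two of the singularities `0`, `1`, `p`
  set δ := min 1 (p - 1) / 2 with hδdef
  have hδ : 0 < δ := by
    have : 0 < min 1 (p - 1) := lt_min one_pos (by linarith)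
    positivity
  have hδ1 : 2 * δ ≤ 1 := by have := min_le_left 1 (p - 1); linarith
  have hδ2 : 2 * δ ≤ p - 1 := by have := min_le_right 1 (p - 1); linarith
  have pow1 : 0 < δ ^ (b - 1) := by positivity
  have pow2 : 0 < δ ^ (c - b - 1) := by positivity
  have pow3 : 0 < δ ^ (-a) := by positivity
  have pow4 : 0 < (r ^ 2) ^ (-a) := by positivity
  refine ⟨(r ^ 2) ^ (-a) * (δ ^ (c - b - 1) * δ ^ (-a) + δ ^ (b - 1) * δ ^ (-a) +
    δ ^ (b - 1) * δ ^ (c - b - 1)), by positivity, fun t h0 h1 h2 => ?_⟩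
  have e : ‖1 - (r : ℂ) ^ 2 * t‖ = r ^ 2 * ‖(p : ℂ) - t‖ := by
    have : 1 - (r : ℂ) ^ 2 * t = ((r ^ 2 : ℝ) : ℂ) * (p - t) := by
      have hr2 : (r : ℂ) ≠ 0 := by exact_mod_cast hr.ne'
      rw [hpdef]; push_cast; field_simp
    rw [this, norm_mul, Complex.norm_real, Real.norm_of_nonneg (by positivity)]
  have n1 : |‖t‖ - 1| ≤ ‖1 - t‖ := by
    simpa [abs_sub_comm] using abs_norm_sub_norm_le (1 : ℂ) t
  have n2 : |‖t‖ - p| ≤ ‖(p : ℂ) - t‖ := by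
    have := abs_norm_sub_norm_le (p : ℂ) t
    rwa [Complex.norm_real, Real.norm_of_nonneg (by linarith), abs_sub_comm] at this
  have s1 : 0 < |‖t‖ - 1| := abs_pos.2 (sub_ne_zero.2 h1)
  have s2 : 0 < |‖t‖ - p| := abs_pos.2 (sub_ne_zero.2 h2)
  have s0 : 0 < ‖t‖ := (norm_nonneg t).lt_of_ne' h0
  have t1 : 1 ≤ ‖t‖ + ‖1 - t‖ := by simpa using norm_add_le t (1 - t)
  have t2 : p ≤ ‖t‖ + ‖(p : ℂ) - t‖ := by
    have := norm_add_le t ((p : ℂ) - t)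
    rw [add_sub_cancel, Complex.norm_real, Real.norm_of_nonneg (by linarith)] at this
    exact this
  have t3 : p - 1 ≤ ‖1 - t‖ + ‖(p : ℂ) - t‖ := by
    have := norm_sub_le ((p : ℂ) - t) (1 - t)
    rw [sub_sub_sub_cancel_right, ← Complex.ofReal_one, ← Complex.ofReal_sub, Complex.norm_real,
      Real.norm_of_nonneg (by linarith), Complex.ofReal_one] at this
    linarith
  have ea : c - b - 1 ≤ 0 := by linarith [h.hcb]
  have eb : b - 1 ≤ 0 := by linarith [h.hb1]
  have ec : -a ≤ 0 := by linarith [h.ha]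
  have main := mul_rpow_le_sum (x := ‖t‖) (y := ‖1 - t‖) (z := ‖(p : ℂ) - t‖) hδ eb ea ec s0
    (s1.trans_le n1) (s2.trans_le n2) (by by_contra! hh; linarith) (by by_contra! hh; linarith)
    (by by_contra! hh; linarith)
  have maj : ‖t‖ ^ (b - 1) + ‖1 - t‖ ^ (c - b - 1) + ‖(p : ℂ) - t‖ ^ (-a) ≤
      scMajorant a b c r ‖t‖ := by
    rw [scMajorant, abs_of_pos s0]
    exact add_le_add (add_le_add le_rfl (Real.rpow_le_rpow_of_nonpos s1 n1 ea))
      (Real.rpow_le_rpow_of_nonpos s2 n2 ec)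
  calc scDensity a b c r t
      = (r ^ 2) ^ (-a) * (‖t‖ ^ (b - 1) * ‖1 - t‖ ^ (c - b - 1) * ‖(p : ℂ) - t‖ ^ (-a)) := by
        rw [scDensity, e, Real.mul_rpow (by positivity) (norm_nonneg _)]; ring
    _ ≤ (r ^ 2) ^ (-a) * (_ * scMajorant a b c r ‖t‖) :=
        mul_le_mul_of_nonneg_left (main.trans (mul_le_mul_of_nonneg_left maj (by positivity)))
          pow4.le
    _ = _ := by ring

theorem intervalIntegrable_abs_sub_rpow {s : ℝ} (hs : -1 < s) (A x y : ℝ) :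
    IntervalIntegrable (fun t : ℝ => |t - A| ^ s) MeasureTheory.volume x y := by
  have pos : ∀ u : ℝ, 0 ≤ u →
      IntervalIntegrable (fun t : ℝ => |t| ^ s) MeasureTheory.volume 0 u := by
    intro u hu
    refine (intervalIntegral.intervalIntegrable_rpow' (a := 0) (b := u) hs).congr fun t ht => ?_
    rw [Set.uIoc_of_le hu] at ht
    simp only [abs_of_pos ht.1]
  have all : ∀ u : ℝ, IntervalIntegrable (fun t : ℝ => |t| ^ s) MeasureTheory.volume 0 u := by
    intro u
    rcases le_total 0 u with hu | hu
    · exact pos u hu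
    · rw [IntervalIntegrable.iff_comp_neg]
      simpa using pos (-u) (by linarith)
  have h := ((all (x - A)).symm.trans (all (y - A))).comp_sub_right A
  simpa using h

theorem SCParams.intervalIntegrable_majorant {a b c r : ℝ} (h : SCParams a b c r) (x y : ℝ) :
    IntervalIntegrable (scMajorant a b c r) MeasureTheory.volume x y := by
  have := h.ha1; have := h.hb; have := h.hab; have := h.ha
  have h0 := intervalIntegrable_abs_sub_rpow (s := b - 1) (by linarith) 0 x y
  simp only [sub_zero] at h0
  exact (h0.add (intervalIntegrable_abs_sub_rpow (by linarith) 1 x y)).add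
    (intervalIntegrable_abs_sub_rpow (by linarith) (1 / r ^ 2) x y)

/-- Almost every modulus avoids the moduli of the singularities. -/
theorem ae_ne_singular (r : ℝ) : ∀ᵐ τ : ℝ, τ ≠ 0 ∧ τ ≠ 1 ∧ τ ≠ 1 / r ^ 2 := by
  have : ({0, 1, 1 / r ^ 2} : Set ℝ).Countable := (Set.toFinite _).countable
  filter_upwards [this.ae_notMem MeasureTheory.volume] with τ hτ
  simpa [not_or] using hτ

theorem SCParams.exists_norm_ray_le {a b c r : ℝ} (h : SCParams a b c r) :
    ∃ M : ℝ, 0 < M ∧ ∀ τ : ℝ, 0 ≤ τ → τ ≠ 0 ∧ τ ≠ 1 ∧ τ ≠ 1 / r ^ 2 → ∀ ω : ℂ, ‖ω‖ = 1 →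
      ‖scIntegrand a b c r (τ * ω) * ω‖ ≤ M * scMajorant a b c r τ := by
  obtain ⟨M, hM, hle⟩ := exists_scDensity_le h
  refine ⟨M, hM, fun τ h0 hs ω hω => ?_⟩
  have e : ‖(τ : ℂ) * ω‖ = τ := by
    rw [norm_mul, hω, Complex.norm_real, Real.norm_of_nonneg h0, mul_one]
  have := hle (τ * ω) (by rw [e]; exact hs.1) (by rw [e]; exact hs.2.1) (by rw [e]; exact hs.2.2)
  rw [e] at this
  rwa [norm_mul, hω, mul_one, norm_scIntegrand]

theorem SCParams.intervalIntegrable_ray {a b c r : ℝ} (h : SCParams a b c r) {ω : ℂ}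
    (hω : ‖ω‖ = 1) {x y : ℝ} (hx : 0 ≤ x) (hy : 0 ≤ y) :
    IntervalIntegrable (fun τ : ℝ => scIntegrand a b c r (τ * ω) * ω) MeasureTheory.volume x y := by
  obtain ⟨M, hM, hle⟩ := h.exists_norm_ray_le
  refine ((h.intervalIntegrable_majorant x y).const_mul M).mono_fun' ?_ ?_
  · exact (((measurable_scIntegrand a b c r).comp (by fun_prop)).mul_const _).aestronglyMeasurable
  · refine (MeasureTheory.ae_restrict_iff' measurableSet_uIoc).2 ?_
    filter_upwards [ae_ne_singular r] with τ hτ hmem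
    refine hle τ ?_ hτ ω hω
    exact (le_min hx hy).trans hmem.1.le

theorem norm_div_norm {z : ℂ} (hz : z ≠ 0) : ‖z / (‖z‖ : ℂ)‖ = 1 := by
  rw [norm_div, Complex.norm_real, norm_norm, div_self (norm_ne_zero_iff.2 hz)]

theorem SCParams.intervalIntegrable_segment {a b c r : ℝ} (h : SCParams a b c r) (z : ℂ) :
    IntervalIntegrable (fun s : ℝ => scIntegrand a b c r ((s : ℂ) * z) * z)
      MeasureTheory.volume 0 1 := by
  rcases eq_or_ne z 0 with rfl | hz
  · simp
  have hn : ‖z‖ ≠ 0 := norm_ne_zero_iff.2 hz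
  have hn' : (‖z‖ : ℂ) ≠ 0 := by exact_mod_cast hn
  have := ((h.intervalIntegrable_ray (norm_div_norm hz) le_rfl (norm_nonneg z)).comp_mul_right
    (c := ‖z‖)).mul_const (‖z‖ : ℂ)
  rw [zero_div, div_self hn] at this
  refine this.congr fun s _ => ?_
  simp only [Complex.ofReal_mul]
  field_simp

/-- The defining integral of `scMap`, parametrized by the modulus. -/
theorem scMap_eq_radial (a b c r : ℝ) {z : ℂ} (hz : z ≠ 0) :
    scMap a b c r z = scConst b c * ∫ τ in (0 : ℝ)..‖z‖,
      scIntegrand a b c r (τ * (z / (‖z‖ : ℂ))) * (z / (‖z‖ : ℂ)) := by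
  have hn : ‖z‖ ≠ 0 := norm_ne_zero_iff.2 hz
  have hn' : (‖z‖ : ℂ) ≠ 0 := by exact_mod_cast hn
  have := intervalIntegral.smul_integral_comp_mul_right (a := 0) (b := 1)
    (fun τ : ℝ => scIntegrand a b c r (τ * (z / (‖z‖ : ℂ))) * (z / (‖z‖ : ℂ))) ‖z‖
  rw [zero_mul, one_mul] at this
  rw [scMap, ← this, ← intervalIntegral.integral_smul]
  congr 1
  refine intervalIntegral.integral_congr fun s _ => ?_
  simp only [Complex.ofReal_mul, Complex.real_smul]
  field_simp

theorem scMap_zero (a b c r : ℝ) : scMap a b c r 0 = 0 := by simp [scMap]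

/-! ### Holomorphy and continuity up to the boundary -/

/-- After rescaling, the segment `[0, z]` is parametrized by the modulus, and all the integrands
have a common integrable majorant. So the integral up to the fixed modulus `|z₀|` is continuous at
`z₀` by dominated convergence, and the rest of the path, from `|z₀|` to `|z|`, contributes
little. -/
theorem SCParams.continuousOn_scMap {a b c r : ℝ} (h : SCParams a b c r) :
    ContinuousOn (scMap a b c r) closedUpperHalfPlane := by
  obtain ⟨M, hM, hle⟩ := h.exists_norm_ray_le
  have hr := h.hr
  have hmaj := fun x y => (h.intervalIntegrable_majorant x y).const_mul M
  have hbd : ∀ {x y : ℝ}, 0 ≤ x → 0 ≤ y → ∀ ω : ℂ, ‖ω‖ = 1 →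
      ∀ᵐ τ : ℝ, τ ∈ Set.uIoc x y →
        ‖scIntegrand a b c r (τ * ω) * ω‖ ≤ M * scMajorant a b c r τ := by
    intro x y hx hy ω hω
    filter_upwards [ae_ne_singular r] with τ hτ hmem
    exact hle τ ((le_min hx hy).trans hmem.1.le) hτ ω hω
  have htail : ∀ z₀ : ℂ, Tendsto (fun z : ℂ => ∫ τ in ‖z₀‖..‖z‖,
      scIntegrand a b c r (τ * (z / (‖z‖ : ℂ))) * (z / (‖z‖ : ℂ))) (𝓝 z₀) (𝓝 0) := by
    intro z₀
    have hc : Continuous fun u : ℝ => ∫ τ in ‖z₀‖..u, M * scMajorant a b c r τ :=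
      intervalIntegral.continuous_primitive hmaj _
    have hc' : Tendsto (fun z : ℂ => |∫ τ in ‖z₀‖..‖z‖, M * scMajorant a b c r τ|)
        (𝓝 z₀) (𝓝 0) := by
      have := ((hc.comp continuous_norm).abs).tendsto z₀
      simpa using this
    refine squeeze_zero_norm (fun z => ?_) hc'
    rcases eq_or_ne z 0 with rfl | hz
    · simp only [div_zero, mul_zero, Complex.ofReal_zero, norm_zero,
        intervalIntegral.integral_zero]
      exact abs_nonneg _
    · exact intervalIntegral.norm_integral_le_abs_of_norm_le
        ((MeasureTheory.ae_restrict_iff' measurableSet_uIoc).2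
          (hbd (norm_nonneg _) (norm_nonneg _) _ (norm_div_norm hz))) (hmaj _ _)
  intro z₀ hz₀
  rcases eq_or_ne z₀ 0 with rfl | hz₀0
  · have h0 := (htail 0).const_mul (scConst b c)
    rw [ContinuousWithinAt, scMap_zero]
    refine Tendsto.mono_left ?_ nhdsWithin_le_nhds
    rw [mul_zero] at h0
    refine h0.congr fun z => ?_
    rcases eq_or_ne z 0 with rfl | hz
    · simp [scMap_zero]
    · rw [scMap_eq_radial _ _ _ _ hz, norm_zero]
  · have hne : ∀ᶠ z in 𝓝[closedUpperHalfPlane] z₀, z ≠ 0 :=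
      nhdsWithin_le_nhds (eventually_ne_nhds hz₀0)
    have hmem : ∀ᶠ z in 𝓝[closedUpperHalfPlane] z₀, z ∈ closedUpperHalfPlane :=
      eventually_mem_nhdsWithin
    have hmain : Tendsto (fun z : ℂ => ∫ τ in (0 : ℝ)..‖z₀‖,
        scIntegrand a b c r (τ * (z / (‖z‖ : ℂ))) * (z / (‖z‖ : ℂ)))
        (𝓝[closedUpperHalfPlane] z₀) (𝓝 (∫ τ in (0 : ℝ)..‖z₀‖,
        scIntegrand a b c r (τ * (z₀ / (‖z₀‖ : ℂ))) * (z₀ / (‖z₀‖ : ℂ)))) := by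
      refine intervalIntegral.tendsto_integral_filter_of_dominated_convergence
        (fun τ => M * scMajorant a b c r τ) ?_ ?_ (hmaj _ _) ?_
      · exact Eventually.of_forall fun z => (((measurable_scIntegrand a b c r).comp
          (by fun_prop)).mul_const _).aestronglyMeasurable
      · filter_upwards [hne] with z hz
        exact hbd le_rfl (norm_nonneg _) _ (norm_div_norm hz)
      · filter_upwards [ae_ne_singular r] with τ hτ hτm
        rw [Set.uIoc_of_le (norm_nonneg _)] at hτm
        have hcont : ContinuousAt (fun z : ℂ => z / (‖z‖ : ℂ)) z₀ :=
          continuousAt_id.div (by fun_prop) (by exact_mod_cast norm_ne_zero_iff.2 hz₀0)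
        have hdir : ∀ z ∈ closedUpperHalfPlane, z ≠ 0 → (τ : ℂ) * (z / (‖z‖ : ℂ)) ∈
            closedUpperHalfPlane \ {0, 1, 1 / (r : ℂ) ^ 2} := by
          intro z hz hz0
          have hnorm : ‖(τ : ℂ) * (z / (‖z‖ : ℂ))‖ = τ := by
            rw [norm_mul, norm_div_norm hz0, Complex.norm_real, Real.norm_of_nonneg hτm.1.le,
              mul_one]
          refine ⟨?_, ?_⟩
          · have e : (τ : ℂ) * (z / (‖z‖ : ℂ)) = ((τ / ‖z‖ : ℝ) : ℂ) * z := by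
              push_cast; ring
            have : 0 ≤ τ / ‖z‖ * z.im := mul_nonneg (div_nonneg hτm.1.le (norm_nonneg _)) hz
            simpa only [closedUpperHalfPlane, Set.mem_ofPred_eq, e, Complex.re_ofReal_mul,
              Complex.im_ofReal_mul] using this
          · simp only [Set.mem_insert_iff, Set.mem_singleton_iff, not_or]
            refine ⟨fun h => hτ.1 ?_, fun h => hτ.2.1 ?_, fun h => hτ.2.2 ?_⟩ <;>
              rw [← hnorm, h] <;> simp
        refine Tendsto.mul ?_ (hcont.tendsto.mono_left nhdsWithin_le_nhds)
        refine (continuousOn_scIntegrand hr _ (hdir z₀ hz₀ hz₀0)).tendsto.comp ?_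
        refine tendsto_nhdsWithin_iff.2 ⟨?_, ?_⟩
        · exact ((continuousAt_const.mul hcont).tendsto).mono_left nhdsWithin_le_nhds
        · filter_upwards [hne, hmem] with z hz hz'
          exact hdir z hz' hz
    have hsum := (hmain.add ((htail z₀).mono_left nhdsWithin_le_nhds)).const_mul (scConst b c)
    rw [add_zero] at hsum
    rw [ContinuousWithinAt, scMap_eq_radial _ _ _ _ hz₀0]
    refine hsum.congr' ?_
    filter_upwards [hne] with z hz
    rw [scMap_eq_radial _ _ _ _ hz, intervalIntegral.integral_add_adjacent_intervals]
    · exact h.intervalIntegrable_ray (norm_div_norm hz) le_rfl (norm_nonneg _)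
    · exact h.intervalIntegrable_ray (norm_div_norm hz) (norm_nonneg _) (norm_nonneg _)

/-- The distance of `1` from the line through `0` and `z` is `|Im z| / |z|`. -/
theorem im_div_norm_le (z : ℂ) (s : ℝ) : z.im / ‖z‖ ≤ ‖1 - (s : ℂ) * z‖ := by
  rcases eq_or_ne z 0 with rfl | hz
  · simp
  rw [div_le_iff₀ (norm_pos_iff.2 hz)]
  calc z.im = -((starRingEnd ℂ z) * (1 - s * z)).im := by simp; ring
    _ ≤ |((starRingEnd ℂ z) * (1 - s * z)).im| := neg_le_abs _
    _ ≤ ‖(starRingEnd ℂ z) * (1 - s * z)‖ := Complex.abs_im_le_norm _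
    _ = ‖1 - (s : ℂ) * z‖ * ‖z‖ := by rw [norm_mul, Complex.norm_conj, mul_comm]

/-- On a compact part of the open half-plane the integrand and its radial derivative are
`O(s ^ (b - 1))` along the segments from `0`. -/
theorem SCParams.exists_ray_deriv_le {a b c r : ℝ} (h : SCParams a b c r) {m R : ℝ} (hm : 0 < m)
    (hR : 0 < R) :
    ∃ K : ℝ, ∀ z : ℂ, m ≤ z.im → ‖z‖ ≤ R → ∀ s : ℝ, 0 < s → s ≤ 1 →
      scDensity a b c r (s * z) ≤ K * s ^ (b - 1) ∧
      ‖scIntegrand a b c r (s * z) * scLogDeriv a b c r (s * z) * (s * z) +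
        scIntegrand a b c r (s * z)‖ ≤ K * s ^ (b - 1) := by
  have := h.hb1; have := h.hcb; have ha := h.ha; have hr := h.hr
  set δ := m / R with hδdef
  have hδ : 0 < δ := by positivity
  set A := m ^ (b - 1) * δ ^ (c - b - 1) * δ ^ (-a) with hA
  have hA0 : 0 < A := by positivity
  set B := |b - 1| + |c - b - 1| * R / δ + r ^ 2 * a * R / δ with hB
  have hB0 : 0 ≤ B := by positivity
  refine ⟨A * (1 + B), fun z h1 h2 s hs hs1 => ?_⟩
  have hzpos : m ≤ ‖z‖ := h1.trans ((le_abs_self _).trans (Complex.abs_im_le_norm z))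
  have hz0 : 0 < ‖z‖ := hm.trans_le hzpos
  have hδle : δ ≤ z.im / ‖z‖ := div_le_div₀ (hm.le.trans h1) h1 hz0 h2
  have n1 : δ ≤ ‖1 - (s : ℂ) * z‖ := hδle.trans (im_div_norm_le z s)
  have n2 : δ ≤ ‖1 - (r : ℂ) ^ 2 * (s * z)‖ := by
    have := hδle.trans (im_div_norm_le z (r ^ 2 * s))
    rwa [Complex.ofReal_mul, Complex.ofReal_pow, mul_assoc] at this
  have e0 : ‖(s : ℂ) * z‖ = s * ‖z‖ := by
    rw [norm_mul, Complex.norm_real, Real.norm_of_nonneg hs.le]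
  have e0R : ‖(s : ℂ) * z‖ ≤ R := by
    rw [e0]; nlinarith
  have e0p : (s : ℂ) * z ≠ 0 := norm_pos_iff.1 (by rw [e0]; positivity)
  have hspow : 0 < s ^ (b - 1) := by positivity
  have dens : scDensity a b c r (s * z) ≤ A * s ^ (b - 1) := by
    rw [scDensity, e0, Real.mul_rpow hs.le hz0.le, hA]
    have t1 : ‖z‖ ^ (b - 1) ≤ m ^ (b - 1) := Real.rpow_le_rpow_of_nonpos hm hzpos (by linarith)
    have t2 : ‖1 - (s : ℂ) * z‖ ^ (c - b - 1) ≤ δ ^ (c - b - 1) :=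
      Real.rpow_le_rpow_of_nonpos hδ n1 (by linarith)
    have t3 : ‖1 - (r : ℂ) ^ 2 * (s * z)‖ ^ (-a) ≤ δ ^ (-a) :=
      Real.rpow_le_rpow_of_nonpos hδ n2 (by linarith)
    calc s ^ (b - 1) * ‖z‖ ^ (b - 1) * ‖1 - (s : ℂ) * z‖ ^ (c - b - 1) *
          ‖1 - (r : ℂ) ^ 2 * (s * z)‖ ^ (-a)
        ≤ s ^ (b - 1) * m ^ (b - 1) * δ ^ (c - b - 1) * δ ^ (-a) := by gcongr
      _ = _ := by ring
  have hAB : 0 ≤ A * B * s ^ (b - 1) := by positivity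
  refine ⟨dens.trans (by nlinarith), ?_⟩
  have logd : ‖scLogDeriv a b c r (s * z) * (s * z)‖ ≤ B := by
    have split : scLogDeriv a b c r (s * z) * (s * z) = ((b - 1 : ℝ) : ℂ) -
        ((c - b - 1 : ℝ) : ℂ) * (s * z) / (1 - s * z) +
        ((r ^ 2 * a : ℝ) : ℂ) * (s * z) / (1 - (r : ℂ) ^ 2 * (s * z)) := by
      rw [scLogDeriv, add_mul, sub_mul, div_mul_cancel₀ _ e0p]
      push_cast
      ring
    rw [split, hB]
    refine (norm_add_le _ _).trans (add_le_add ((norm_sub_le _ _).trans (add_le_add ?_ ?_)) ?_)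
    · rw [Complex.norm_real, Real.norm_eq_abs]
    · rw [norm_div, norm_mul, Complex.norm_real, Real.norm_eq_abs]
      gcongr
    · rw [norm_div, norm_mul, Complex.norm_real, Real.norm_of_nonneg (by positivity)]
      gcongr
  calc ‖scIntegrand a b c r (s * z) * scLogDeriv a b c r (s * z) * (s * z) +
        scIntegrand a b c r (s * z)‖
      = ‖scIntegrand a b c r (s * z) * (1 + scLogDeriv a b c r (s * z) * (s * z))‖ := by
        congr 1; ring
    _ ≤ A * s ^ (b - 1) * (1 + B) := by
        rw [norm_mul, norm_scIntegrand]
        gcongr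
        exact (norm_add_le _ _).trans (by rw [norm_one]; gcongr)
    _ = A * (1 + B) * s ^ (b - 1) := by ring

/-- Differentiation under the integral sign: the `z`-derivative of `g (s z) z` is the `s`-derivative
of `s g (s z)`, whose integral over `[0, 1]` is `g z`. -/
theorem SCParams.hasDerivAt_scMap {a b c r : ℝ} (h : SCParams a b c r) {z : ℂ} (hz : 0 < z.im) :
    HasDerivAt (scMap a b c r) (scConst b c * scIntegrand a b c r z) z := by
  have hb := h.hb
  have hr := h.hr
  obtain ⟨K, hK⟩ := h.exists_ray_deriv_le (m := z.im / 2) (R := ‖z‖ + 1) (by linarith)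
    (by positivity)
  set N : Set ℂ := {w | z.im / 2 < w.im} ∩ {w | ‖w‖ < ‖z‖ + 1} with hN
  have hNo : IsOpen N := (isOpen_lt continuous_const Complex.continuous_im).inter
    (isOpen_lt continuous_norm continuous_const)
  have hzN : z ∈ N := ⟨by simp only [Set.mem_ofPred_eq]; linarith,
    by simp only [Set.mem_ofPred_eq]; linarith⟩
  have hKi : IntervalIntegrable (fun s : ℝ => K * s ^ (b - 1)) MeasureTheory.volume 0 1 :=
    (intervalIntegral.intervalIntegrable_rpow' (by linarith)).const_mul K
  have him : ∀ w : ℂ, 0 < w.im → ∀ s : ℝ, 0 < s → 0 < ((s : ℂ) * w).im := by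
    intro w hw s hs
    rw [Complex.im_ofReal_mul]; positivity
  set F' : ℂ → ℝ → ℂ := fun w s =>
    scIntegrand a b c r (s * w) * scLogDeriv a b c r (s * w) * (s * w) +
      scIntegrand a b c r (s * w) with hF'
  have hgm := measurable_scIntegrand a b c r
  have hlm : Measurable (scLogDeriv a b c r) := by unfold scLogDeriv; fun_prop
  have main := intervalIntegral.hasDerivAt_integral_of_dominated_loc_of_deriv_le (𝕜 := ℂ)
    (μ := MeasureTheory.volume) (a := 0) (b := 1)
    (F := fun w (s : ℝ) => scIntegrand a b c r ((s : ℂ) * w) * w) (F' := F')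
    (bound := fun s => K * s ^ (b - 1)) (hNo.mem_nhds hzN) ?_ (h.intervalIntegrable_segment z) ?_ ?_
    hKi ?_
  · have hcont : ContinuousOn (fun s : ℝ => (s : ℂ) * scIntegrand a b c r (s * z))
        (Set.Icc 0 1) := by
      intro s hs
      rcases hs.1.eq_or_lt with rfl | hs0
      · have hlim : Tendsto (fun s : ℝ => K * s ^ b) (𝓝[Set.Icc 0 1] 0) (𝓝 0) := by
          have := ((Real.continuous_rpow_const hb.le).tendsto 0).const_mul K
          rw [Real.zero_rpow hb.ne', mul_zero] at this
          exact this.mono_left nhdsWithin_le_nhds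
        rw [ContinuousWithinAt, Complex.ofReal_zero, zero_mul]
        refine squeeze_zero_norm' ?_ hlim
        filter_upwards [self_mem_nhdsWithin] with s hs
        rcases hs.1.eq_or_lt with rfl | hs0
        · simp [Real.zero_rpow hb.ne']
        · have := (hK z (by linarith) (by linarith) s hs0 hs.2).1
          rw [norm_mul, norm_scIntegrand, Complex.norm_real, Real.norm_of_nonneg hs0.le]
          calc s * scDensity a b c r (s * z) ≤ s * (K * s ^ (b - 1)) := by gcongr
            _ = K * s ^ b := by
              rw [show b = (b - 1) + 1 by ring, Real.rpow_add_one hs0.ne']; ring_nf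
      · have hd := (hasDerivAt_scIntegrand (a := a) (b := b) (c := c) hr
          (him z hz s hs0)).continuousAt
        exact (Complex.continuous_ofReal.continuousAt.mul (ContinuousAt.comp
          (f := fun s : ℝ => (s : ℂ) * z) hd (by fun_prop))).continuousWithinAt
    have hftc := intervalIntegral.integral_eq_sub_of_hasDerivAt_of_le (a := (0 : ℝ)) (b := 1)
      (f' := F' z) zero_le_one hcont ?_ main.1
    · have := main.2.const_mul (scConst b c)
      rw [hftc] at this
      simp only [Complex.ofReal_one, one_mul, Complex.ofReal_zero, zero_mul, sub_zero] at this
      exact this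
    · intro s hs
      have hd := hasDerivAt_scIntegrand (a := a) (b := b) (c := c) hr (him z hz s hs.1)
      have h1 : HasDerivAt (fun s : ℂ => s * z) z (s : ℂ) := by
        simpa using (hasDerivAt_id (s : ℂ)).mul_const z
      have h2 := ((hasDerivAt_id (s : ℂ)).mul (hd.comp (s : ℂ) h1)).comp_ofReal
      refine h2.congr_deriv ?_
      simp only [hF', id, Function.comp]
      ring
  · exact Eventually.of_forall fun w =>
      ((hgm.comp (by fun_prop)).mul_const _).aestronglyMeasurable
  · refine Measurable.aestronglyMeasurable ?_
    have h1 : Measurable fun s : ℝ => (s : ℂ) * z := by fun_prop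
    exact (((hgm.comp h1).mul (hlm.comp h1)).mul h1).add (hgm.comp h1)
  · refine Eventually.of_forall fun s hs w hw => ?_
    rw [Set.uIoc_of_le zero_le_one] at hs
    exact (hK w (le_of_lt hw.1) (le_of_lt hw.2) s hs.1 hs.2).2
  · refine Eventually.of_forall fun s hs w hw => ?_
    rw [Set.uIoc_of_le zero_le_one] at hs
    have hw' : 0 < w.im := lt_trans (by linarith) hw.1
    have hd := hasDerivAt_scIntegrand (a := a) (b := b) (c := c) hr (him w hw' s hs.1)
    have h1 : HasDerivAt (fun w : ℂ => (s : ℂ) * w) (s : ℂ) w := by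
      simpa using (hasDerivAt_id w).const_mul (s : ℂ)
    refine ((hd.comp w h1).mul (hasDerivAt_id w)).congr_deriv ?_
    simp only [hF', id, Function.comp]
    ring

theorem SCParams.betaIntegral_eq {a b c r : ℝ} (h : SCParams a b c r) :
    Complex.betaIntegral b ((c : ℂ) - b) = (ProbabilityTheory.beta b (c - b) : ℂ) := by
  have hcb : 0 < c - b := by linarith [h.hab, h.ha]
  rw [ProbabilityTheory.beta, Complex.betaIntegral_eq_Gamma_mul_div _ _ (by simpa using h.hb)
    (by simpa using hcb), ← Complex.ofReal_sub, ← Complex.ofReal_add]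
  simp only [Complex.Gamma_ofReal]
  push_cast
  rfl

/-- The normalizing constant as a positive real number. -/
noncomputable def scConstReal (b c : ℝ) : ℝ := 1 / ProbabilityTheory.beta b (c - b)

theorem SCParams.scConstReal_pos {a b c r : ℝ} (h : SCParams a b c r) : 0 < scConstReal b c :=
  one_div_pos.2 (ProbabilityTheory.beta_pos h.hb (by linarith [h.hab, h.ha]))

theorem SCParams.scConst_eq {a b c r : ℝ} (h : SCParams a b c r) :
    scConst b c = (scConstReal b c : ℂ) := by
  rw [scConst, h.betaIntegral_eq, scConstReal]
  push_cast
  rfl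

theorem SCParams.scConst_mul_ne_zero {a b c r : ℝ} (h : SCParams a b c r) {z : ℂ} (hz : 0 < z.im) :
    scConst b c * scIntegrand a b c r z ≠ 0 := by
  obtain ⟨h0, h1, h2⟩ := ne_singular_of_im_pos (r := r) hz
  refine mul_ne_zero ?_ (norm_pos_iff.1 ?_)
  · rw [h.scConst_eq]; exact_mod_cast h.scConstReal_pos.ne'
  · rw [norm_scIntegrand]; exact scDensity_pos h.hr h0 h1 h2

/-! ### Maps of the half-plane with prescribed boundary values -/

theorem closedUpperHalfPlane_cases {z : ℂ} (hz : z ∈ closedUpperHalfPlane) :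
    0 < z.im ∨ z.im = 0 :=
  (lt_or_eq_of_le (α := ℝ) hz).imp_right Eq.symm

theorem isClosed_closedUpperHalfPlane : IsClosed closedUpperHalfPlane :=
  isClosed_le continuous_const Complex.continuous_im

theorem upper_mem_nhds {z : ℂ} (hz : 0 < z.im) : {z : ℂ | 0 < z.im} ∈ 𝓝 z :=
  (isOpen_lt continuous_const Complex.continuous_im).mem_nhds hz

theorem ofReal_mul_mem_upper {s : ℝ} (hs : 0 ≤ s) {z : ℂ} (hz : z ∈ closedUpperHalfPlane) :
    (s : ℂ) * z ∈ closedUpperHalfPlane := by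
  show 0 ≤ ((s : ℂ) * z).im
  rw [Complex.im_ofReal_mul]
  exact mul_nonneg hs hz

theorem tendsto_coe_cocompact_upper :
    Tendsto ((↑) : closedUpperHalfPlane → ℂ) (cocompact closedUpperHalfPlane)
      (cocompact ℂ ⊓ 𝓟 closedUpperHalfPlane) :=
  tendsto_inf.2 ⟨isClosed_closedUpperHalfPlane.isClosedEmbedding_subtypeVal.tendsto_cocompact,
    tendsto_principal.2 (Eventually.of_forall fun z => z.2)⟩

theorem tendsto_coe_atTop_cocompact_upper :
    Tendsto (fun x : ℝ => (x : ℂ)) atTop (cocompact ℂ ⊓ 𝓟 closedUpperHalfPlane) := by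
  refine tendsto_inf.2 ⟨?_, tendsto_principal.2 (Eventually.of_forall fun x => ?_)⟩
  · exact Complex.isometry_ofReal.isClosedEmbedding.tendsto_cocompact.mono_left atTop_le_cocompact
  · simp [closedUpperHalfPlane]

theorem tendsto_coe_atBot_cocompact_upper :
    Tendsto (fun x : ℝ => (x : ℂ)) atBot (cocompact ℂ ⊓ 𝓟 closedUpperHalfPlane) := by
  refine tendsto_inf.2 ⟨?_, tendsto_principal.2 (Eventually.of_forall fun x => ?_)⟩
  · exact Complex.isometry_ofReal.isClosedEmbedding.tendsto_cocompact.mono_left atBot_le_cocompact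
  · simp [closedUpperHalfPlane]

theorem ofReal_re_eq {z : ℂ} (hz : z.im = 0) : z = (z.re : ℂ) :=
  Complex.ext rfl (by simpa using hz)

/-- A map that has a limit at infinity has bounded image, so the image contains no line. -/
theorem exists_notMem_line_of_tendsto {f : ℂ → ℂ} {w : ℂ} (hf : ContinuousOn f closedUpperHalfPlane)
    (hw : Tendsto f (cocompact ℂ ⊓ 𝓟 closedUpperHalfPlane) (𝓝 w)) (p d : ℂ) (hd : d ≠ 0) :
    ∃ t : ℝ, p + t * d ∉ f '' closedUpperHalfPlane ∪ {w} := by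
  obtain ⟨A, hA, B, hB, hAB⟩ := mem_inf_iff_superset.1 (hw (Metric.ball_mem_nhds w one_pos))
  obtain ⟨C, hC, hCA⟩ := mem_cocompact.1 hA
  have hcpt : IsCompact (f '' (closedUpperHalfPlane ∩ C)) :=
    (hC.inter_left isClosed_closedUpperHalfPlane).image_of_continuousOn
      (hf.mono Set.inter_subset_left)
  have hbdd : Bornology.IsBounded (f '' closedUpperHalfPlane ∪ {w}) := by
    refine (hcpt.isBounded.union (Metric.isBounded_ball (x := w) (r := 1))).subset ?_
    rintro _ (⟨z, hz, rfl⟩ | rfl)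
    · by_cases hzC : z ∈ C
      · exact Or.inl ⟨z, ⟨hz, hzC⟩, rfl⟩
      · exact Or.inr (hAB ⟨hCA hzC, hB hz⟩)
    · exact Or.inr (Metric.mem_ball_self one_pos)
  obtain ⟨R, hR⟩ := hbdd.exists_norm_le
  by_contra! hcon
  have hd0 : 0 < ‖d‖ := norm_pos_iff.2 hd
  set t : ℝ := (|R| + ‖p‖ + 1) / ‖d‖ with ht
  have ht0 : 0 ≤ t := by positivity
  have h1 := hR _ (hcon t)
  have h2 : ‖(t : ℂ) * d‖ = |R| + ‖p‖ + 1 := by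
    rw [norm_mul, Complex.norm_real, Real.norm_of_nonneg ht0, ht, div_mul_cancel₀ _ hd0.ne']
  have h3 := norm_sub_le (p + t * d) p
  rw [add_sub_cancel_left, h2] at h3
  linarith [le_abs_self R]

/-- A preconnected set that meets a set and its complement meets the frontier. -/
theorem IsPreconnected.exists_mem_frontier {X : Type*} [TopologicalSpace X] {s t : Set X}
    (ht : IsPreconnected t) (h1 : (t ∩ s).Nonempty) (h2 : (t ∩ sᶜ).Nonempty) :
    (t ∩ frontier s).Nonempty := by
  by_contra hne
  rw [Set.not_nonempty_iff_eq_empty] at hne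
  have hno : ∀ x ∈ t, x ∉ frontier s := fun x hx hxs =>
    (Set.eq_empty_iff_forall_notMem.1 hne x) ⟨hx, hxs⟩
  have key : ∀ x ∈ t, x ∈ closure s → x ∈ interior s := fun x hx hxs => by
    by_contra hxi
    exact hno x hx ⟨hxs, hxi⟩
  obtain ⟨x, hx, hxs⟩ := h1
  obtain ⟨y, hy, hys⟩ := h2
  obtain ⟨z, -, hz1, hz2⟩ := ht (interior s) (closure s)ᶜ isOpen_interior
    isClosed_closure.isOpen_compl
    (fun w hw => (em (w ∈ closure s)).imp (key w hw) id)
    ⟨x, hx, key x hx (subset_closure hxs)⟩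
    ⟨y, hy, fun hyc => hys (interior_subset (key y hy hyc))⟩
  exact hz2 (subset_closure (interior_subset hz1))

/-- A closed plane set without lines whose frontier lies in a closed convex set is contained in that
convex set: otherwise it would contain a half-plane. -/
theorem subset_of_frontier_subset_convex {K Q : Set ℂ} (hfr : frontier K ⊆ Q)
    (hQc : IsClosed Q) (hQ : Convex ℝ Q)
    (hline : ∀ p d : ℂ, d ≠ 0 → ∃ t : ℝ, p + t * d ∉ K) : K ⊆ Q := by
  intro k hk
  by_contra hkQ
  obtain ⟨l, u, hlQ, hlk⟩ := geometric_hahn_banach_closed_point hQ hQc hkQ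
  have hW : Convex ℝ {w : ℂ | u < l w} :=
    convex_halfSpace_gt (LinearMap.isLinear (l : ℂ →ₗ[ℝ] ℝ)) u
  have hWK : {w : ℂ | u < l w} ⊆ K := by
    intro w hw
    by_contra hwK
    obtain ⟨y, hyW, hyK⟩ := hW.isPreconnected.exists_mem_frontier ⟨k, hlk, hk⟩ ⟨w, hw, hwK⟩
    exact lt_asymm (hlQ y (hfr hyK)) hyW
  obtain ⟨d, hd, hld⟩ : ∃ d : ℂ, d ≠ 0 ∧ l d = 0 := by
    by_cases h0 : l 1 = 0
    · exact ⟨1, one_ne_zero, h0⟩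
    · refine ⟨(l Complex.I : ℂ) - (l 1 : ℂ) * Complex.I, fun h => h0 ?_, ?_⟩
      · simpa using congrArg Complex.im h
      · have e : (l Complex.I : ℂ) - (l 1 : ℂ) * Complex.I =
            l Complex.I • (1 : ℂ) - l 1 • Complex.I := by simp
        rw [e, map_sub, map_smul, map_smul, smul_eq_mul, smul_eq_mul]
        ring
  obtain ⟨t, ht⟩ := hline k d hd
  refine ht (hWK ?_)
  have : l (k + t * d) = l k := by
    rw [map_add, ← Complex.real_smul, map_smul, hld, smul_zero, add_zero]
  simpa only [Set.mem_ofPred_eq, this] using hlk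

/-- A map `f` of the closed upper half-plane, locally conformal in the interior, which tends to
the filter `m` at `∞`; the points of `E` are the only possible limit values there, and the
boundary values lie on the frontier of the closed convex set `Q`. With `m = 𝓝 w`, `E = {w}` this
describes a map with value `w` at `∞`, with `m = cocompact ℂ`, `E = ∅` a map that tends to `∞`.
The last field, that the image contains no line, excludes that `f` covers the exterior of `Q`. -/
structure BoundaryMap (f : ℂ → ℂ) (m : Filter ℂ) (E Q : Set ℂ) : Prop where
  continuousOn : ContinuousOn f closedUpperHalfPlane
  strictDeriv : ∀ z : ℂ, 0 < z.im → ∃ f' : ℂ, f' ≠ 0 ∧ HasStrictDerivAt f f' z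
  tendsto : Tendsto f (cocompact ℂ ⊓ 𝓟 closedUpperHalfPlane) m
  disjoint : ∀ p ∉ E, Disjoint m (𝓝 p)
  isClosed_E : IsClosed E
  isClosed_Q : IsClosed Q
  convex : Convex ℝ Q
  interior_nonempty : (interior Q).Nonempty
  real_mem : ∀ z : ℂ, z.im = 0 → f z ∈ frontier Q
  E_subset : E ⊆ frontier Q
  no_line : ∀ p d : ℂ, d ≠ 0 → ∃ t : ℝ, p + t * d ∉ f '' closedUpperHalfPlane ∪ E

namespace BoundaryMap

variable {f : ℂ → ℂ} {m : Filter ℂ} {E Q : Set ℂ}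

/-- Away from the values at `∞`, the map `f` is proper. -/
theorem exists_compact (h : BoundaryMap f m E Q) {p : ℂ} (hp : p ∉ E) :
    ∃ C : Set ℂ, IsCompact C ∧ ∃ V ∈ 𝓝 p, ∀ z ∈ closedUpperHalfPlane, f z ∈ V → z ∈ C := by
  obtain ⟨S, hS, V, hV, hSV⟩ := Filter.disjoint_iff.1 (h.disjoint p hp)
  obtain ⟨A, hA, B, hB, hAB⟩ := mem_inf_iff_superset.1 (h.tendsto hS)
  obtain ⟨C, hC, hCA⟩ := mem_cocompact.1 hA
  refine ⟨C, hC, V, hV, fun z hz hzV => ?_⟩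
  by_contra hzC
  exact Set.disjoint_left.1 hSV (hAB ⟨hCA hzC, hB hz⟩) hzV

theorem isClosed_image (h : BoundaryMap f m E Q) :
    IsClosed (f '' closedUpperHalfPlane ∪ E) := by
  rw [← isOpen_compl_iff, isOpen_iff_mem_nhds]
  intro p hp
  have hpE : p ∉ E := fun hE => hp (Or.inr hE)
  obtain ⟨C, hC, V, hV, hVC⟩ := h.exists_compact hpE
  have hcpt : IsCompact (f '' (closedUpperHalfPlane ∩ C)) :=
    (hC.inter_left isClosed_closedUpperHalfPlane).image_of_continuousOn
      (h.continuousOn.mono Set.inter_subset_left)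
  have hp' : p ∈ (f '' (closedUpperHalfPlane ∩ C))ᶜ := fun hh =>
    hp (Or.inl (Set.image_mono Set.inter_subset_left hh))
  filter_upwards [hV, hcpt.isClosed.isOpen_compl.mem_nhds hp',
    h.isClosed_E.isOpen_compl.mem_nhds hpE] with q h1 h2 h3
  rintro (⟨z, hz, rfl⟩ | hq)
  · exact h2 ⟨z, ⟨hz, hVC z hz h1⟩, rfl⟩
  · exact h3 hq

theorem image_mem_nhds (h : BoundaryMap f m E Q) {z : ℂ} (hz : 0 < z.im) {S : Set ℂ}
    (hS : S ∈ 𝓝 z) : f '' S ∈ 𝓝 (f z) := by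
  obtain ⟨f', hf', hd⟩ := h.strictDeriv z hz
  rw [← hd.map_nhds_eq hf']
  exact image_mem_map hS

/-- By the open mapping property interior points have interior images, so only the boundary values
remain for the frontier of the image. -/
theorem frontier_subset (h : BoundaryMap f m E Q) :
    frontier (f '' closedUpperHalfPlane ∪ E) ⊆ frontier Q := by
  rw [h.isClosed_image.frontier_eq]
  rintro _ ⟨⟨z, hz, rfl⟩ | hE, hint⟩
  · rcases closedUpperHalfPlane_cases hz with hz' | hz'
    · refine absurd (mem_interior_iff_mem_nhds.2 ?_) hint
      filter_upwards [h.image_mem_nhds hz' (upper_mem_nhds hz')]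
      rintro _ ⟨w, hw, rfl⟩
      exact Or.inl ⟨w, le_of_lt (α := ℝ) hw, rfl⟩
    · exact h.real_mem z hz'
  · exact h.E_subset hE

theorem image_subset (h : BoundaryMap f m E Q) : f '' closedUpperHalfPlane ∪ E ⊆ Q :=
  subset_of_frontier_subset_convex
    (h.frontier_subset.trans h.isClosed_Q.frontier_subset) h.isClosed_Q h.convex h.no_line

theorem mem_interior (h : BoundaryMap f m E Q) {z : ℂ} (hz : 0 < z.im) : f z ∈ interior Q := by
  refine mem_interior_iff_mem_nhds.2 ?_
  filter_upwards [h.image_mem_nhds hz (upper_mem_nhds hz)]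
  rintro _ ⟨w, hw, rfl⟩
  exact h.image_subset (Or.inl ⟨w, le_of_lt (α := ℝ) hw, rfl⟩)

/-- The image is closed, and its frontier does not meet the connected open set `interior Q`; so it
contains all of it. -/
theorem image_eq (h : BoundaryMap f m E Q) : f '' closedUpperHalfPlane ∪ E = Q := by
  refine h.image_subset.antisymm ?_
  have hint : interior Q ⊆ f '' closedUpperHalfPlane ∪ E := by
    intro q hq
    by_contra hqK
    have hz : 0 < (Complex.I).im := by simp
    obtain ⟨y, hy, hyK⟩ := h.convex.interior.isPreconnected.exists_mem_frontier
      ⟨f Complex.I, h.mem_interior hz, Or.inl ⟨_, hz.le, rfl⟩⟩ ⟨q, hq, hqK⟩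
    exact (h.frontier_subset hyK).2 hy
  calc Q = closure (interior Q) := by
        rw [h.convex.closure_interior_eq_closure_of_nonempty_interior h.interior_nonempty,
          h.isClosed_Q.closure_eq]
    _ ⊆ _ := closure_minimal hint h.isClosed_image

/-- Let `N` be the set of the interior points whose value is also taken at another interior point.
It is open by the open mapping property, and closed in the open half-plane, because `f` is proper
and locally injective. So `N` is empty or the whole half-plane. The latter is excluded by a
boundary point `x₀` whose value is taken only once on the boundary, and near which `f` is
injective: `x₀` would be a limit of points of `N`, whose partners could accumulate neither at `x₀`
nor elsewhere. -/
theorem injOn_interior (h : BoundaryMap f m E Q) {x₀ : ℂ} (hx₀ : x₀.im = 0)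
    (hE : f x₀ ∉ E) (huniq : ∀ z : ℂ, z.im = 0 → f z = f x₀ → z = x₀)
    (hloc : ∃ V ∈ 𝓝 x₀, Set.InjOn f (V ∩ {z | 0 < z.im})) :
    Set.InjOn f {z | 0 < z.im} := by
  set N : Set ℂ := {z | 0 < z.im ∧ ∃ z' : ℂ, 0 < z'.im ∧ z' ≠ z ∧ f z' = f z} with hN
  have hNo : IsOpen N := by
    rw [isOpen_iff_mem_nhds]
    rintro z ⟨hz, z', hz', hne, heq⟩
    obtain ⟨A', A, hA', hA, hz'A, hzA, hdis⟩ := t2_separation hne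
    have hf : ContinuousAt f z := by
      obtain ⟨f', -, hd⟩ := h.strictDeriv z hz
      exact hd.hasDerivAt.continuousAt
    have himg := h.image_mem_nhds hz' (inter_mem (hA'.mem_nhds hz'A) (upper_mem_nhds hz'))
    rw [heq] at himg
    filter_upwards [hA.mem_nhds hzA, upper_mem_nhds hz, hf himg] with w hw hw' hwi
    obtain ⟨w', ⟨hw'A, hw'U⟩, hww⟩ := hwi
    exact ⟨hw', w', hw'U, fun e => Set.disjoint_left.1 hdis hw'A (e ▸ hw), hww⟩
  have hclosed : ∀ z : ℂ, 0 < z.im ∨ z = x₀ → z ∈ closure N → z ∈ N ∧ 0 < z.im := by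
    intro z hz hzcl
    have hzH : z ∈ closedUpperHalfPlane := by
      rcases hz with hz | hz
      · exact le_of_lt (α := ℝ) hz
      · rw [hz]
        exact hx₀.ge
    have hfE : f z ∉ E := by
      rcases hz with hz | hz
      · exact fun hh => (h.E_subset hh).2 (h.mem_interior hz)
      · rw [hz]
        exact hE
    obtain ⟨V, hV, hinj⟩ : ∃ V ∈ 𝓝 z, Set.InjOn f (V ∩ {z | 0 < z.im}) := by
      rcases hz with hz | hz
      · obtain ⟨f', hf', hd⟩ := h.strictDeriv z hz
        have hev := (hd.hasStrictFDerivAt_equiv hf').eventually_left_inverse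
        refine ⟨_, hev, fun x hx y hy hxy => ?_⟩
        rw [← show _ = x from hx.1, ← show _ = y from hy.1, hxy]
      · rw [hz]
        exact hloc
    -- each `w ∈ N` has a partner `φ w ≠ w` with the same value; by properness the partners of
    -- points tending to `z` have a limit `z'`, which has the same value as `z`
    have : ∀ w : ℂ, ∃ w' : ℂ, w ∈ N → 0 < w'.im ∧ w' ≠ w ∧ f w' = f w := by
      intro w
      by_cases hw : w ∈ N
      · obtain ⟨-, w', hw'⟩ := hw
        exact ⟨w', fun _ => hw'⟩
      · exact ⟨0, fun hh => absurd hh hw⟩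
    choose φ hφ using this
    obtain ⟨F, hFN, hFz⟩ := mem_closure_iff_ultrafilter.1 hzcl
    have hNH : ∀ᶠ w in (F : Filter ℂ), w ∈ N := hFN
    have hlim : Tendsto f F (𝓝 (f z)) :=
      (h.continuousOn z hzH).tendsto.mono_left (le_inf hFz (le_principal_iff.2
        (hNH.mono fun w hw => le_of_lt (α := ℝ) hw.1)))
    have hlim' : Tendsto (f ∘ φ) F (𝓝 (f z)) :=
      hlim.congr' (hNH.mono fun w hw => ((hφ w hw).2.2).symm)
    obtain ⟨C, hC, V', hV', hVC⟩ := h.exists_compact hfE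
    have hmemC : ∀ᶠ w in (F : Filter ℂ), φ w ∈ closedUpperHalfPlane ∩ C := by
      filter_upwards [hNH, hlim' hV'] with w hw hwV
      have hH : φ w ∈ closedUpperHalfPlane := le_of_lt (α := ℝ) (hφ w hw).1
      exact ⟨hH, hVC _ hH hwV⟩
    obtain ⟨z', ⟨hz'H, -⟩, hz'⟩ := (hC.inter_left isClosed_closedUpperHalfPlane).ultrafilter_le_nhds
      (F.map φ) (le_principal_iff.2 hmemC)
    have hφz' : Tendsto φ F (𝓝 z') := hz'
    have heq : f z' = f z := by
      refine tendsto_nhds_unique ?_ hlim'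
      exact (h.continuousOn z' hz'H).tendsto.comp
        (tendsto_nhdsWithin_iff.2 ⟨hφz', hmemC.mono fun w hw => hw.1⟩)
    -- the partners of points near `z` cannot accumulate at `z` itself, by local injectivity
    have hne : z' ≠ z := by
      rintro rfl
      have e1 : ∀ᶠ w in (F : Filter ℂ), w ∈ V := hFz hV
      have e2 : ∀ᶠ w in (F : Filter ℂ), φ w ∈ V := hφz' hV
      obtain ⟨w, hw, hwV, hwV'⟩ := (hNH.and (e1.and e2)).exists
      exact (hφ w hw).2.1 (hinj ⟨hwV', (hφ w hw).1⟩ ⟨hwV, hw.1⟩ (hφ w hw).2.2)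
    rcases hz with hz | hz
    · have hz'U : 0 < z'.im := by
        refine (closedUpperHalfPlane_cases hz'H).resolve_right fun h0 => ?_
        exact (h.real_mem z' h0).2 (heq ▸ h.mem_interior hz)
      exact ⟨⟨hz, z', hz'U, hne, heq⟩, hz⟩
    · rcases closedUpperHalfPlane_cases hz'H with hU | h0
      · refine absurd (h.mem_interior hU) ?_
        rw [heq, hz]
        exact (h.real_mem x₀ hx₀).2
      · rw [hz] at heq hne
        exact absurd (huniq z' h0 heq) hne
  by_contra hnot
  have hNne : ∃ z, z ∈ N := by
    simp only [Set.InjOn, not_forall] at hnot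
    obtain ⟨z, hz, w, hw, heq, hne⟩ := hnot
    exact ⟨z, hz, w, hw, fun e => hne e.symm, heq.symm⟩
  have hUN : {z : ℂ | 0 < z.im} ⊆ N := by
    intro z hz
    by_contra hzN
    obtain ⟨w, hw⟩ := hNne
    obtain ⟨y, hy, hyN⟩ := (convex_halfSpace_im_gt 0).isPreconnected.exists_mem_frontier
      ⟨w, hw.1, hw⟩ ⟨z, hz, hzN⟩
    rw [hNo.frontier_eq] at hyN
    exact hyN.2 (hclosed y (Or.inl hy) hyN.1).1
  have hx₀cl : x₀ ∈ closure N := by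
    refine closure_mono hUN ?_
    rw [Complex.closure_setOfPred_lt_im]
    exact hx₀.ge
  have := (hclosed x₀ (Or.inr rfl) hx₀cl).2
  exact this.ne' hx₀

theorem injOn_closed (h : BoundaryMap f m E Q) (hU : Set.InjOn f {z | 0 < z.im})
    (hR : Set.InjOn f {z | z.im = 0}) : Set.InjOn f closedUpperHalfPlane := by
  intro z hz w hw heq
  rcases closedUpperHalfPlane_cases hz with hz' | hz' <;>
    rcases closedUpperHalfPlane_cases hw with hw' | hw'
  · exact hU hz' hw' heq
  · exact absurd (heq ▸ h.mem_interior hz') (h.real_mem w hw').2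
  · exact absurd (heq ▸ h.mem_interior hw') (h.real_mem z hz').2
  · exact hR hz' hw' heq

end BoundaryMap

theorem BoundaryMap.exists_homeomorph_onePoint {f : ℂ → ℂ} {w : ℂ} {Q : Set ℂ}
    (h : BoundaryMap f (𝓝 w) {w} Q) (hinj : Set.InjOn f closedUpperHalfPlane)
    (hw : ∀ z ∈ closedUpperHalfPlane, f z ≠ w) :
    ∃ Φ : OnePoint closedUpperHalfPlane ≃ₜ Q,
      (∀ z : closedUpperHalfPlane, (Φ (z : OnePoint closedUpperHalfPlane) : ℂ) = f z) ∧
      (Φ OnePoint.infty : ℂ) = w := by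
  set F : OnePoint closedUpperHalfPlane → ℂ := fun x => x.elim w fun z => f z with hF
  have hFc : ∀ z : closedUpperHalfPlane, F z = f z := fun z => rfl
  have hFi : F OnePoint.infty = w := rfl
  have hcont : Continuous F := by
    rw [OnePoint.continuous_iff, coclosedCompact_eq_cocompact]
    exact ⟨h.tendsto.comp tendsto_coe_cocompact_upper,
      continuousOn_iff_continuous_domRestrict.1 h.continuousOn⟩
  have hFinj : Function.Injective F := by
    intro x y hxy
    induction x using OnePoint.rec <;> induction y using OnePoint.rec
    · rfl
    · exact absurd hxy.symm (hw _ (Subtype.coe_prop _))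
    · exact absurd hxy (hw _ (Subtype.coe_prop _))
    · exact congrArg _ (Subtype.ext (hinj (Subtype.coe_prop _) (Subtype.coe_prop _) hxy))
  have hrange : Set.range F = Q := by
    rw [← h.image_eq]
    ext q
    constructor
    · rintro ⟨x, rfl⟩
      induction x using OnePoint.rec with
      | infty => exact Or.inr rfl
      | coe z => exact Or.inl ⟨z, z.2, rfl⟩
    · rintro (⟨z, hz, rfl⟩ | rfl)
      · exact ⟨((⟨z, hz⟩ : closedUpperHalfPlane) : OnePoint closedUpperHalfPlane), rfl⟩
      · exact ⟨OnePoint.infty, rfl⟩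
  have hemb := (hcont.isClosedEmbedding hFinj).isEmbedding
  exact ⟨hemb.toHomeomorph.trans (Homeomorph.setCongr hrange), fun z => rfl, rfl⟩

theorem BoundaryMap.exists_homeomorph {f : ℂ → ℂ} {Q : Set ℂ}
    (h : BoundaryMap f (cocompact ℂ) ∅ Q) (hinj : Set.InjOn f closedUpperHalfPlane) :
    ∃ Φ : closedUpperHalfPlane ≃ₜ Q, ∀ z : closedUpperHalfPlane, (Φ z : ℂ) = f z := by
  set F : closedUpperHalfPlane → ℂ := fun z => f z with hF
  have hcont : Continuous F := continuousOn_iff_continuous_domRestrict.1 h.continuousOn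
  have hproper : IsProperMap F := isProperMap_iff_tendsto_cocompact.2
    ⟨hcont, h.tendsto.comp tendsto_coe_cocompact_upper⟩
  have hFinj : Function.Injective F := fun x y hxy => Subtype.ext (hinj x.2 y.2 hxy)
  have hrange : Set.range F = Q := by
    rw [← h.image_eq, Set.union_empty, Set.image_eq_range]
  have hemb := (IsClosedEmbedding.of_continuous_injective_isClosedMap hcont hFinj
    hproper.isClosedMap).isEmbedding
  exact ⟨hemb.toHomeomorph.trans (Homeomorph.setCongr hrange), fun z => rfl⟩

/-! ### Convex quadrilaterals -/

/-- The cross product of two plane vectors: positive if `v` points to the left of `u`. -/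
def planeCross (u v : ℂ) : ℝ := u.re * v.im - u.im * v.re

/-- Affine coordinates `x`, `y` of the plane with respect to an origin and two vectors. -/
structure IsPlaneCoord (o e₁ e₂ : ℂ) (x y : ℂ → ℝ) : Prop where
  eq : ∀ w : ℂ, w = o + x w * e₁ + y w * e₂
  x_apply : ∀ s t : ℝ, x (o + s * e₁ + t * e₂) = s
  y_apply : ∀ s t : ℝ, y (o + s * e₁ + t * e₂) = t
  x_cont : Continuous x
  y_cont : Continuous y

theorem exists_isPlaneCoord (o : ℂ) {e₁ e₂ : ℂ} (hD : planeCross e₁ e₂ ≠ 0) :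
    IsPlaneCoord o e₁ e₂ (fun w => planeCross (w - o) e₂ / planeCross e₁ e₂)
      (fun w => planeCross e₁ (w - o) / planeCross e₁ e₂) := by
  refine ⟨fun w => ?_, fun s t => ?_, fun s t => ?_, ?_, ?_⟩
  · apply Complex.ext
    · simp only [Complex.add_re, Complex.re_ofReal_mul]
      field_simp
      simp only [planeCross, Complex.sub_re, Complex.sub_im]
      ring
    · simp only [Complex.add_im, Complex.im_ofReal_mul]
      field_simp
      simp only [planeCross, Complex.sub_re, Complex.sub_im]
      ring
  · rw [div_eq_iff hD]
    simp only [planeCross, Complex.sub_re, Complex.sub_im, Complex.add_re, Complex.add_im,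
      Complex.re_ofReal_mul, Complex.im_ofReal_mul]
    ring
  · rw [div_eq_iff hD]
    simp only [planeCross, Complex.sub_re, Complex.sub_im, Complex.add_re, Complex.add_im,
      Complex.re_ofReal_mul, Complex.im_ofReal_mul]
    ring
  · unfold planeCross
    exact Continuous.div_const (by fun_prop) _
  · unfold planeCross
    exact Continuous.div_const (by fun_prop) _

namespace IsPlaneCoord

variable {o e₁ e₂ : ℂ} {x y : ℂ → ℝ}

/-- The coordinates are affine functions. -/
theorem convex_comb (h : IsPlaneCoord o e₁ e₂ x y) (v w : ℂ) {s t : ℝ} (hst : s + t = 1) :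
    x (s • v + t • w) = s * x v + t * x w ∧ y (s • v + t • w) = s * y v + t * y w := by
  have hst' : (s : ℂ) + t = 1 := by exact_mod_cast hst
  have e : s • v + t • w = o + ((s * x v + t * x w : ℝ) : ℂ) * e₁ +
      ((s * y v + t * y w : ℝ) : ℂ) * e₂ := by
    conv_lhs => rw [h.eq v, h.eq w]
    simp only [Complex.real_smul]
    push_cast
    linear_combination o * hst'
  rw [e, h.x_apply, h.y_apply]
  exact ⟨rfl, rfl⟩

theorem x_add (h : IsPlaneCoord o e₁ e₂ x y) (w : ℂ) (s t : ℝ) :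
    x (w + (s * e₁ + t * e₂)) = x w + s ∧ y (w + (s * e₁ + t * e₂)) = y w + t := by
  have e : w + (s * e₁ + t * e₂) = o + ((x w + s : ℝ) : ℂ) * e₁ + ((y w + t : ℝ) : ℂ) * e₂ := by
    conv_lhs => rw [h.eq w]
    push_cast
    ring
  rw [e, h.x_apply, h.y_apply]
  exact ⟨rfl, rfl⟩

theorem convex_halfPlane (h : IsPlaneCoord o e₁ e₂ x y) (p q k : ℝ) :
    Convex ℝ {w | p * x w + q * y w ≤ k} := by
  intro v hv w hw s t hs ht hst
  simp only [Set.mem_ofPred_eq] at *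
  rw [(h.convex_comb v w hst).1, (h.convex_comb v w hst).2]
  have h1 := mul_le_mul_of_nonneg_left hv hs
  have h2 := mul_le_mul_of_nonneg_left hw ht
  have h3 : s * k + t * k = k := by rw [← add_mul, hst, one_mul]
  linarith

/-- On the interior of a set the inequality of a half-plane that contains the set is strict. -/
theorem lt_of_mem_interior (h : IsPlaneCoord o e₁ e₂ x y) {p q k : ℝ} {Q : Set ℂ}
    (hQ : ∀ w ∈ Q, p * x w + q * y w ≤ k) (hpq : 0 < p ^ 2 + q ^ 2) {w : ℂ}
    (hw : w ∈ interior Q) : p * x w + q * y w < k := by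
  have hc : Tendsto (fun ε : ℝ => w + (((ε * p : ℝ) : ℂ) * e₁ + ((ε * q : ℝ) : ℂ) * e₂))
      (𝓝 0) (𝓝 w) := by
    have : Continuous fun ε : ℝ => w + (((ε * p : ℝ) : ℂ) * e₁ + ((ε * q : ℝ) : ℂ) * e₂) := by
      fun_prop
    simpa using this.tendsto 0
  have hev : ∀ᶠ ε : ℝ in 𝓝 0, w + (((ε * p : ℝ) : ℂ) * e₁ + ((ε * q : ℝ) : ℂ) * e₂) ∈ Q :=
    hc (mem_interior_iff_mem_nhds.1 hw)
  obtain ⟨ε, hε, hε0⟩ := ((hev.filter_mono (nhdsWithin_le_nhds (s := Set.Ioi 0))).and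
    self_mem_nhdsWithin).exists
  have := hQ _ hε
  rw [(h.x_add w _ _).1, (h.x_add w _ _).2] at this
  have hε0' : (0 : ℝ) < ε := hε0
  nlinarith [mul_pos hε0' hpq]

theorem ext (h : IsPlaneCoord o e₁ e₂ x y) {v w : ℂ} (hx : x v = x w) (hy : y v = y w) : v = w := by
  rw [h.eq v, h.eq w, hx, hy]

theorem mem_segment (h : IsPlaneCoord o e₁ e₂ x y) {v v' w : ℂ} {t : ℝ} (ht : 0 ≤ t) (ht1 : t ≤ 1)
    (hx : x w = (1 - t) * x v + t * x v') (hy : y w = (1 - t) * y v + t * y v') :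
    w ∈ segment ℝ v v' :=
  ⟨1 - t, t, by linarith, ht, by ring, h.ext
    (by rw [(h.convex_comb v v' (by ring)).1, hx]) (by rw [(h.convex_comb v v' (by ring)).2, hy])⟩

theorem mem_of_mem_segment (h : IsPlaneCoord o e₁ e₂ x y) {v v' w : ℂ} (hw : w ∈ segment ℝ v v') :
    ∃ t : ℝ, 0 ≤ t ∧ t ≤ 1 ∧ x w = (1 - t) * x v + t * x v' ∧ y w = (1 - t) * y v + t * y v' := by
  obtain ⟨s, t, hs, ht, hst, rfl⟩ := hw
  obtain ⟨h1, h2⟩ := h.convex_comb v v' hst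
  obtain rfl : s = 1 - t := by linarith
  exact ⟨t, ht, by linarith, h1, h2⟩

end IsPlaneCoord

theorem Convex.three_mem {C : Set ℂ} (hC : Convex ℝ C) {p q s : ℂ} (hp : p ∈ C) (hq : q ∈ C)
    (hs : s ∈ C) {i j k : ℝ} (hi : 0 ≤ i) (hj : 0 ≤ j) (hk : 0 ≤ k) (hsum : i + j + k = 1) :
    (i : ℂ) * p + j * q + k * s ∈ C := by
  have := hC.sum_mem (t := Finset.univ) (w := ![i, j, k]) (z := ![p, q, s])
    (by intro l _; fin_cases l <;> simpa) (by simpa [Fin.sum_univ_three] using hsum)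
    (by intro l _; fin_cases l <;> simpa)
  simpa [Fin.sum_univ_three, Complex.real_smul] using this

/-- The four inequalities of a quadrilateral with vertices `(1, 0)`, `(α, β)`, `(0, 1)` and
`(0, 0)`. -/
def quadIneq (α β x y : ℝ) : Prop :=
  0 ≤ x ∧ 0 ≤ y ∧ β * x + (1 - α) * y ≤ β ∧ (1 - β) * x + α * y ≤ α

/-- The strict form of `quadIneq`. -/
def quadIneqStrict (α β x y : ℝ) : Prop :=
  0 < x ∧ 0 < y ∧ β * x + (1 - α) * y < β ∧ (1 - β) * x + α * y < α

namespace IsPlaneCoord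

variable {o e₁ e₂ : ℂ} {x y : ℂ → ℝ} {α β : ℝ}

theorem convex_quad (h : IsPlaneCoord o e₁ e₂ x y) (α β : ℝ) :
    Convex ℝ {w | quadIneq α β (x w) (y w)} := by
  have key := (((h.convex_halfPlane (-1) 0 0).inter (h.convex_halfPlane 0 (-1) 0)).inter
    (h.convex_halfPlane β (1 - α) β)).inter (h.convex_halfPlane (1 - β) α α)
  convert key using 1
  ext w
  simp only [Set.mem_inter_iff, Set.mem_ofPred_eq, and_assoc, quadIneq]
  refine and_congr (by constructor <;> intro <;> linarith) (and_congr_left' ?_)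
  constructor <;> intro <;> linarith

theorem isClosed_quad (h : IsPlaneCoord o e₁ e₂ x y) (α β : ℝ) :
    IsClosed {w | quadIneq α β (x w) (y w)} := by
  have hx := h.x_cont
  have hy := h.y_cont
  unfold quadIneq
  simp only [Set.ofPred_and]
  refine (isClosed_le ?_ ?_).inter ((isClosed_le ?_ ?_).inter ((isClosed_le ?_ ?_).inter
    (isClosed_le ?_ ?_))) <;> fun_prop

theorem mem_interior_quad (h : IsPlaneCoord o e₁ e₂ x y) (hα : 0 < α) (hβ : 0 < β) {w : ℂ} :
    w ∈ interior {w | quadIneq α β (x w) (y w)} ↔ quadIneqStrict α β (x w) (y w) := by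
  constructor
  · intro hw
    have i1 := h.lt_of_mem_interior (p := -1) (q := 0) (k := 0)
      (fun w hw => by linarith [hw.1]) (by norm_num) hw
    have i2 := h.lt_of_mem_interior (p := 0) (q := -1) (k := 0)
      (fun w hw => by linarith [hw.2.1]) (by norm_num) hw
    have i3 := h.lt_of_mem_interior (p := β) (q := 1 - α) (k := β)
      (fun w hw => hw.2.2.1) (by positivity) hw
    have i4 := h.lt_of_mem_interior (p := 1 - β) (q := α) (k := α)
      (fun w hw => hw.2.2.2) (by positivity) hw
    exact ⟨by linarith, by linarith, i3, i4⟩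
  · intro hw
    have hx := h.x_cont
    have hy := h.y_cont
    have hopen : IsOpen {w | quadIneqStrict α β (x w) (y w)} := by
      unfold quadIneqStrict
      simp only [Set.ofPred_and]
      refine (isOpen_lt ?_ ?_).inter ((isOpen_lt ?_ ?_).inter ((isOpen_lt ?_ ?_).inter
        (isOpen_lt ?_ ?_))) <;> fun_prop
    exact interior_maximal (fun w hw => show quadIneq α β (x w) (y w) from
      ⟨hw.1.le, hw.2.1.le, hw.2.2.1.le, hw.2.2.2.le⟩) hopen hw

/-- The quadrilateral is cut into two triangles by its diagonal from `(0, 0)` to `(α, β)`. -/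
theorem mem_of_quadIneq (h : IsPlaneCoord o e₁ e₂ x y) (hα : 0 < α) (hβ : 0 < β) {C : Set ℂ}
    (hC : Convex ℝ C) {v : Fin 4 → ℂ} (hv : ∀ k, v k ∈ C) (v0 : v 0 = o + e₁)
    (v1 : v 1 = o + α * e₁ + β * e₂) (v2 : v 2 = o + e₂) (v3 : v 3 = o) {w : ℂ}
    (hw : quadIneq α β (x w) (y w)) : w ∈ C := by
  obtain ⟨p1, p2, p3, p4⟩ := hw
  have hα0 : (α : ℂ) ≠ 0 := by exact_mod_cast hα.ne'
  have hβ0 : (β : ℂ) ≠ 0 := by exact_mod_cast hβ.ne'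
  have hw := h.eq w
  generalize x w = X at *
  generalize y w = Y at *
  rcases le_total (α * Y) (β * X) with hc | hc
  · have key := hC.three_mem (hv 0) (hv 1) (hv 3)
      (i := X - α * Y / β) (j := Y / β) (k := 1 - (X - α * Y / β) - Y / β)
      (by rw [sub_nonneg, div_le_iff₀ hβ]; linarith) (by positivity)
      (by
        have : 1 - (X - α * Y / β) - Y / β = (β - (β * X + (1 - α) * Y)) / β := by
          field_simp; ring
        rw [this]; exact div_nonneg (by linarith) hβ.le) (by ring)
    convert key using 1
    rw [hw, v0, v1, v3]
    push_cast
    field_simp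
    ring
  · have key := hC.three_mem (hv 2) (hv 1) (hv 3)
      (i := Y - β * X / α) (j := X / α) (k := 1 - (Y - β * X / α) - X / α)
      (by rw [sub_nonneg, div_le_iff₀ hα]; linarith) (by positivity)
      (by
        have : 1 - (Y - β * X / α) - X / α = (α - ((1 - β) * X + α * Y)) / α := by
          field_simp; ring
        rw [this]; exact div_nonneg (by linarith) hα.le) (by ring)
    convert key using 1
    rw [hw, v1, v2, v3]
    push_cast
    field_simp
    ring

/-- A point of the quadrilateral at which an inequality is not strict lies on a side. -/
theorem mem_side_of_quadIneq (h : IsPlaneCoord o e₁ e₂ x y) (hα : 0 < α) (hβ : 0 < β)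
    (hsum : 1 ≤ α + β) {v : Fin 4 → ℂ} (hx : x (v 0) = 1 ∧ x (v 1) = α ∧ x (v 2) = 0 ∧ x (v 3) = 0)
    (hy : y (v 0) = 0 ∧ y (v 1) = β ∧ y (v 2) = 1 ∧ y (v 3) = 0) {w : ℂ}
    (hw : quadIneq α β (x w) (y w)) (hns : ¬ quadIneqStrict α β (x w) (y w)) :
    ∃ k : Fin 4, w ∈ segment ℝ (v k) (v (k + 1)) := by
  obtain ⟨x0, x1, x2, x3⟩ := hx
  obtain ⟨y0, y1, y2, y3⟩ := hy
  obtain ⟨p1, p2, p3, p4⟩ := hw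
  have s01 : ∀ t : ℝ, 0 ≤ t → t ≤ 1 → x w = (1 - t) * 1 + t * α → y w = (1 - t) * 0 + t * β →
      ∃ k : Fin 4, w ∈ segment ℝ (v k) (v (k + 1)) := fun t ht ht1 hx hy =>
    ⟨0, h.mem_segment ht ht1 (by rw [hx, x0, zero_add, x1]) (by rw [hy, y0, zero_add, y1])⟩
  have s12 : ∀ t : ℝ, 0 ≤ t → t ≤ 1 → x w = (1 - t) * α + t * 0 → y w = (1 - t) * β + t * 1 →
      ∃ k : Fin 4, w ∈ segment ℝ (v k) (v (k + 1)) := fun t ht ht1 hx hy =>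
    ⟨1, h.mem_segment ht ht1 (by rw [hx, x1, show (1 : Fin 4) + 1 = 2 from rfl, x2])
      (by rw [hy, y1, show (1 : Fin 4) + 1 = 2 from rfl, y2])⟩
  have on1 : β * x w + (1 - α) * y w = β → y w ≤ β →
      ∃ k : Fin 4, w ∈ segment ℝ (v k) (v (k + 1)) := fun e hle => by
    refine s01 (y w / β) (by positivity) ((div_le_one hβ).2 hle) ?_ (by field_simp; ring)
    field_simp
    linarith
  have on2 : (1 - β) * x w + α * y w = α → x w ≤ α →
      ∃ k : Fin 4, w ∈ segment ℝ (v k) (v (k + 1)) := fun e hle => by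
    refine s12 (1 - x w / α) (by rw [sub_nonneg]; exact (div_le_one hα).2 hle)
      (by linarith [div_nonneg p1 hα.le]) (by field_simp; ring) ?_
    field_simp
    linarith
  rcases p1.eq_or_lt with e | q1
  · refine ⟨2, h.mem_segment (t := 1 - y w) ?_ (by linarith) ?_ ?_⟩
    · rw [← e] at p4
      have : y w ≤ 1 := by
        rw [mul_zero, zero_add] at p4
        exact le_of_mul_le_mul_left (by linarith) hα
      linarith
    · rw [x2, show (2 : Fin 4) + 1 = 3 from rfl, x3, ← e]; ring
    · rw [y2, show (2 : Fin 4) + 1 = 3 from rfl, y3]; ring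
  rcases p2.eq_or_lt with e | q2
  · refine ⟨3, h.mem_segment (t := x w) p1 ?_ ?_ ?_⟩
    · rw [← e] at p3
      exact le_of_mul_le_mul_left (by linarith) hβ
    · rw [x3, show (3 : Fin 4) + 1 = 0 from rfl, x0]; ring
    · rw [y3, show (3 : Fin 4) + 1 = 0 from rfl, y0, ← e]; ring
  rcases hsum.eq_or_lt with e | hlt
  · -- the angle at `(α, β)` is straight: the two sides lie on the line `x + y = 1`
    have hline : x w + y w = 1 := by
      by_contra hne
      refine hns ⟨q1, q2, lt_of_le_of_ne p3 fun h3 => hne ?_, lt_of_le_of_ne p4 fun h4 => hne ?_⟩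
      · rw [show (1 : ℝ) - α = β by linarith] at h3
        have : β * (x w + y w) = β * 1 := by linarith
        exact mul_left_cancel₀ hβ.ne' this
      · rw [show (1 : ℝ) - β = α by linarith] at h4
        have : α * (x w + y w) = α * 1 := by linarith
        exact mul_left_cancel₀ hα.ne' this
    rcases le_total (y w) β with hle | hle
    · exact on1 (by nlinarith) hle
    · exact on2 (by nlinarith) (by linarith)
  · have hs : 0 < α + β - 1 := by linarith
    rcases p3.eq_or_lt with e | q3
    · refine on1 e (le_of_mul_le_mul_right ?_ hs)
      nlinarith
    · have e : (1 - β) * x w + α * y w = α := by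
        by_contra hne
        exact hns ⟨q1, q2, q3, lt_of_le_of_ne p4 hne⟩
      refine on2 e (le_of_mul_le_mul_right ?_ hs)
      nlinarith

end IsPlaneCoord

/-- A closed polygon whose consecutive edges never turn right, and turn left at all vertices but
perhaps `v₁`, is a convex quadrilateral. In the affine coordinates with origin `v₃` and unit points
`v₀`, `v₂` the remaining vertex is `(α, β)` with `α, β > 0`, `α + β ≥ 1`, and the quadrilateral is
described by four linear inequalities. -/
theorem isConvexQuadrilateral_of_planeCross {v : Fin 4 → ℂ}
    (h₀ : 0 < planeCross (v 0 - v 3) (v 1 - v 0)) (h₁ : 0 ≤ planeCross (v 1 - v 0) (v 2 - v 1))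
    (h₂ : 0 < planeCross (v 2 - v 1) (v 3 - v 2)) (h₃ : 0 < planeCross (v 3 - v 2) (v 0 - v 3)) :
    IsConvexQuadrilateral (convexHull ℝ (Set.range v)) v := by
  obtain ⟨e₁, he₁⟩ : ∃ e, e = v 0 - v 3 := ⟨_, rfl⟩
  obtain ⟨e₂, he₂⟩ : ∃ e, e = v 2 - v 3 := ⟨_, rfl⟩
  have hD : planeCross e₁ e₂ = planeCross (v 3 - v 2) (v 0 - v 3) := by
    simp only [planeCross, he₁, he₂, Complex.sub_re, Complex.sub_im]; ring
  have hDpos : 0 < planeCross e₁ e₂ := hD ▸ h₃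
  obtain ⟨x, y, h, hα, hβ, hsum⟩ : ∃ x y : ℂ → ℝ, IsPlaneCoord (v 3) e₁ e₂ x y ∧
      0 < x (v 1) ∧ 0 < y (v 1) ∧ 1 ≤ x (v 1) + y (v 1) := by
    have k2 : planeCross (v 1 - v 3) e₂ = planeCross (v 2 - v 1) (v 3 - v 2) := by
      simp only [planeCross, he₂, Complex.sub_re, Complex.sub_im]; ring
    have k0 : planeCross e₁ (v 1 - v 3) = planeCross (v 0 - v 3) (v 1 - v 0) := by
      simp only [planeCross, he₁, Complex.sub_re, Complex.sub_im]; ring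
    have k1 : planeCross (v 1 - v 3) e₂ + planeCross e₁ (v 1 - v 3) - planeCross e₁ e₂ =
        planeCross (v 1 - v 0) (v 2 - v 1) := by
      simp only [planeCross, he₁, he₂, Complex.sub_re, Complex.sub_im]; ring
    refine ⟨_, _, exists_isPlaneCoord (v 3) hDpos.ne', div_pos ?_ hDpos, div_pos ?_ hDpos, ?_⟩
    · rw [k2]; exact h₂
    · rw [k0]; exact h₀
    · rw [← add_div, le_div_iff₀ hDpos, one_mul, ← sub_nonneg, k1]
      exact h₁
  have v1 : v 1 = v 3 + x (v 1) * e₁ + y (v 1) * e₂ := h.eq (v 1)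
  have v0 : v 0 = v 3 + e₁ := by rw [he₁]; ring
  have v2 : v 2 = v 3 + e₂ := by rw [he₂]; ring
  obtain ⟨x3, y3⟩ : x (v 3) = 0 ∧ y (v 3) = 0 := by
    simpa using And.intro (h.x_apply 0 0) (h.y_apply 0 0)
  obtain ⟨x0, y0⟩ : x (v 0) = 1 ∧ y (v 0) = 0 := by
    rw [v0]; simpa using And.intro (h.x_apply 1 0) (h.y_apply 1 0)
  obtain ⟨x2, y2⟩ : x (v 2) = 0 ∧ y (v 2) = 1 := by
    rw [v2]; simpa using And.intro (h.x_apply 0 1) (h.y_apply 0 1)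
  obtain ⟨α, hαe⟩ : ∃ α, x (v 1) = α := ⟨_, rfl⟩
  obtain ⟨β, hβe⟩ : ∃ β, y (v 1) = β := ⟨_, rfl⟩
  rw [hαe, hβe] at v1 hsum
  rw [hαe] at hα
  rw [hβe] at hβ
  have hvP : Set.range v ⊆ {w | quadIneq α β (x w) (y w)} := by
    rintro _ ⟨k, rfl⟩
    simp only [Set.mem_ofPred_eq, quadIneq]
    match k with
    | 0 => rw [x0, y0]; refine ⟨?_, ?_, ?_, ?_⟩ <;> linarith
    | 1 => rw [hαe, hβe]; refine ⟨?_, ?_, ?_, ?_⟩ <;> nlinarith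
    | 2 => rw [x2, y2]; refine ⟨?_, ?_, ?_, ?_⟩ <;> linarith
    | 3 => rw [x3, y3]; refine ⟨?_, ?_, ?_, ?_⟩ <;> linarith
  have hPeq : convexHull ℝ (Set.range v) = {w | quadIneq α β (x w) (y w)} :=
    (convexHull_min hvP (h.convex_quad α β)).antisymm fun w hw =>
      h.mem_of_quadIneq hα hβ (convex_convexHull ℝ _)
        (fun k => subset_convexHull ℝ _ (Set.mem_range_self k)) v0 v1 v2 rfl hw
  refine ⟨?_, rfl, ?_, ?_⟩
  · have n01 : v 0 ≠ v 1 := ne_of_apply_ne y (by rw [y0, hβe]; exact hβ.ne)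
    have n02 : v 0 ≠ v 2 := ne_of_apply_ne y (by rw [y0, y2]; norm_num)
    have n03 : v 0 ≠ v 3 := ne_of_apply_ne x (by rw [x0, x3]; norm_num)
    have n12 : v 1 ≠ v 2 := ne_of_apply_ne x (by rw [x2, hαe]; exact hα.ne')
    have n13 : v 1 ≠ v 3 := ne_of_apply_ne x (by rw [x3, hαe]; exact hα.ne')
    have n23 : v 2 ≠ v 3 := ne_of_apply_ne y (by rw [y2, y3]; norm_num)
    intro i j hij
    fin_cases i <;> fin_cases j <;> first
      | rfl
      | exact absurd hij n01 | exact absurd hij n02 | exact absurd hij n03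
      | exact absurd hij n12 | exact absurd hij n13 | exact absurd hij n23
      | exact absurd hij.symm n01 | exact absurd hij.symm n02 | exact absurd hij.symm n03
      | exact absurd hij.symm n12 | exact absurd hij.symm n13 | exact absurd hij.symm n23
  · refine ⟨v 3 + ((1 + α) / 4 : ℝ) * e₁ + ((1 + β) / 4 : ℝ) * e₂, ?_⟩
    rw [hPeq, h.mem_interior_quad hα hβ, h.x_apply, h.y_apply]
    refine show quadIneqStrict _ _ _ _ from ⟨by positivity, by positivity, ?_, ?_⟩ <;> nlinarith
  · rw [hPeq, (h.isClosed_quad α β).frontier_eq]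
    ext w
    simp only [Set.mem_sdiff, h.mem_interior_quad hα hβ, Set.mem_iUnion]
    constructor
    · rintro ⟨hw, hni⟩
      exact h.mem_side_of_quadIneq hα hβ hsum ⟨x0, hαe, x2, x3⟩ ⟨y0, hβe, y2, y3⟩ hw hni
    · rintro ⟨k, hk⟩
      refine ⟨(h.convex_quad α β).segment_subset (hvP (Set.mem_range_self k))
        (hvP (Set.mem_range_self (k + 1))) hk, fun hi => ?_⟩
      obtain ⟨t, ht, ht1, hx, hy⟩ := h.mem_of_mem_segment hk
      match k with
      | 0 =>
        rw [zero_add, x0, hαe] at hx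
        rw [zero_add, y0, hβe] at hy
        refine hi.2.2.1.ne ?_
        rw [hx, hy]; ring
      | 1 =>
        rw [show (1 : Fin 4) + 1 = 2 from rfl, x2, hαe] at hx
        rw [show (1 : Fin 4) + 1 = 2 from rfl, y2, hβe] at hy
        refine hi.2.2.2.ne ?_
        rw [hx, hy]; ring
      | 2 =>
        rw [show (2 : Fin 4) + 1 = 3 from rfl, x2, x3] at hx
        exact hi.1.ne' (by rw [hx]; ring)
      | 3 =>
        rw [show (3 : Fin 4) + 1 = 0 from rfl, y3, y0] at hy
        exact hi.2.1.ne' (by rw [hy]; ring)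

/-- The four inequalities of an unbounded quadrilateral with vertices `(0, 0)`, `(α, -β)`, `(1, 0)`
and two sides in the direction `(0, 1)`. -/
def stripIneq (α β x y : ℝ) : Prop :=
  0 ≤ x ∧ x ≤ 1 ∧ 0 ≤ α * y + β * x ∧ 0 ≤ (1 - α) * y + β * (1 - x)

/-- The strict form of `stripIneq`. -/
def stripIneqStrict (α β x y : ℝ) : Prop :=
  0 < x ∧ x < 1 ∧ 0 < α * y + β * x ∧ 0 < (1 - α) * y + β * (1 - x)

namespace IsPlaneCoord

variable {o e₁ e₂ : ℂ} {x y : ℂ → ℝ} {α β : ℝ}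

theorem convex_strip (h : IsPlaneCoord o e₁ e₂ x y) (α β : ℝ) :
    Convex ℝ {w | stripIneq α β (x w) (y w)} := by
  have key := (((h.convex_halfPlane (-1) 0 0).inter (h.convex_halfPlane 1 0 1)).inter
    (h.convex_halfPlane (-β) (-α) 0)).inter (h.convex_halfPlane β (-(1 - α)) β)
  convert key using 1
  ext w
  simp only [Set.mem_inter_iff, Set.mem_ofPred_eq, and_assoc, stripIneq]
  refine and_congr ?_ (and_congr ?_ (and_congr ?_ ?_)) <;> constructor <;> intro <;> linarith

theorem isClosed_strip (h : IsPlaneCoord o e₁ e₂ x y) (α β : ℝ) :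
    IsClosed {w | stripIneq α β (x w) (y w)} := by
  have hx := h.x_cont
  have hy := h.y_cont
  unfold stripIneq
  simp only [Set.ofPred_and]
  refine (isClosed_le ?_ ?_).inter ((isClosed_le ?_ ?_).inter ((isClosed_le ?_ ?_).inter
    (isClosed_le ?_ ?_))) <;> fun_prop

theorem mem_interior_strip (h : IsPlaneCoord o e₁ e₂ x y) (hα : 0 < α) (hα1 : α < 1) {w : ℂ} :
    w ∈ interior {w | stripIneq α β (x w) (y w)} ↔ stripIneqStrict α β (x w) (y w) := by
  have hα1' : 0 < 1 - α := by linarith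
  constructor
  · intro hw
    have i1 := h.lt_of_mem_interior (p := -1) (q := 0) (k := 0)
      (fun w hw => by linarith [hw.1]) (by norm_num) hw
    have i2 := h.lt_of_mem_interior (p := 1) (q := 0) (k := 1)
      (fun w hw => by linarith [hw.2.1]) (by norm_num) hw
    have i3 := h.lt_of_mem_interior (p := -β) (q := -α) (k := 0)
      (fun w hw => by linarith [hw.2.2.1]) (by nlinarith [sq_nonneg β]) hw
    have i4 := h.lt_of_mem_interior (p := β) (q := -(1 - α)) (k := β)
      (fun w hw => by linarith [hw.2.2.2]) (by nlinarith [sq_nonneg β]) hw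
    exact ⟨by linarith, by linarith, by linarith, by linarith⟩
  · intro hw
    have hx := h.x_cont
    have hy := h.y_cont
    have hopen : IsOpen {w | stripIneqStrict α β (x w) (y w)} := by
      unfold stripIneqStrict
      simp only [Set.ofPred_and]
      refine (isOpen_lt ?_ ?_).inter ((isOpen_lt ?_ ?_).inter ((isOpen_lt ?_ ?_).inter
        (isOpen_lt ?_ ?_))) <;> fun_prop
    exact interior_maximal (fun w hw => show stripIneq α β (x w) (y w) from
      ⟨hw.1.le, hw.2.1.le, hw.2.2.1.le, hw.2.2.2.le⟩) hopen hw

theorem mem_closedRay (h : IsPlaneCoord o e₁ e₂ x y) {p w : ℂ} :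
    w ∈ closedRay p e₂ ↔ x w = x p ∧ y p ≤ y w := by
  constructor
  · rintro ⟨s, hs, rfl⟩
    have := h.x_add p 0 s
    simp only [Complex.ofReal_zero, zero_mul, zero_add, add_zero] at this
    rw [this.1, this.2]
    exact ⟨rfl, by linarith⟩
  · rintro ⟨hx, hy⟩
    refine ⟨y w - y p, by linarith, h.ext ?_ ?_⟩
    · have := (h.x_add p 0 (y w - y p)).1
      simp only [Complex.ofReal_zero, zero_mul, zero_add, add_zero] at this
      rw [this, hx]
    · have := (h.x_add p 0 (y w - y p)).2
      simp only [Complex.ofReal_zero, zero_mul, zero_add] at this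
      rw [this]; ring

end IsPlaneCoord

/-- An unbounded polygon with two parallel sides in the direction `u` whose consecutive edges
never turn right, and turn left at the vertices but perhaps `v 1`, is a convex quadrilateral with
a vertex at infinity. In the affine coordinates with origin `v 0`, unit point `v 2` and second
axis `u` the vertex `v 1` is `(α, -β)` with `0 < α < 1` and `β ≥ 0`. -/
theorem isConvexQuadrilateralAtInfinity_of_planeCross {v : Fin 3 → ℂ} {u : ℂ}
    (h₀ : 0 < planeCross (v 1 - v 0) u) (h₁ : 0 ≤ planeCross (v 1 - v 0) (v 2 - v 1))
    (h₂ : 0 < planeCross (v 2 - v 1) u) :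
    IsConvexQuadrilateralAtInfinity
      {z | ∃ p ∈ convexHull ℝ (Set.range v), z ∈ closedRay p u} v u := by
  obtain ⟨e₁, he₁⟩ : ∃ e, e = v 2 - v 0 := ⟨_, rfl⟩
  have hD : planeCross e₁ u = planeCross (v 1 - v 0) u + planeCross (v 2 - v 1) u := by
    simp only [planeCross, he₁, Complex.sub_re, Complex.sub_im]; ring
  have hDpos : 0 < planeCross e₁ u := by rw [hD]; positivity
  obtain ⟨x, y, h, hα, hα1, hβ⟩ : ∃ x y : ℂ → ℝ, IsPlaneCoord (v 0) e₁ u x y ∧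
      0 < x (v 1) ∧ x (v 1) < 1 ∧ y (v 1) ≤ 0 := by
    have k1 : planeCross e₁ (v 1 - v 0) = - planeCross (v 1 - v 0) (v 2 - v 1) := by
      simp only [planeCross, he₁, Complex.sub_re, Complex.sub_im]; ring
    refine ⟨_, _, exists_isPlaneCoord (v 0) hDpos.ne', div_pos h₀ hDpos, ?_, ?_⟩
    · rw [div_lt_one hDpos, hD]; linarith
    · rw [k1]; exact div_nonpos_of_nonpos_of_nonneg (by linarith) hDpos.le
  have v2 : v 2 = v 0 + e₁ := by rw [he₁]; ring
  obtain ⟨x0, y0⟩ : x (v 0) = 0 ∧ y (v 0) = 0 := by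
    simpa using And.intro (h.x_apply 0 0) (h.y_apply 0 0)
  obtain ⟨x2, y2⟩ : x (v 2) = 1 ∧ y (v 2) = 0 := by
    rw [v2]; simpa using And.intro (h.x_apply 1 0) (h.y_apply 1 0)
  obtain ⟨α, x1⟩ : ∃ α, x (v 1) = α := ⟨_, rfl⟩
  obtain ⟨β, y1⟩ : ∃ β, y (v 1) = -β := ⟨-y (v 1), by ring⟩
  rw [x1] at hα hα1
  replace hβ : 0 ≤ β := by linarith
  have hα1' : 0 < 1 - α := by linarith
  have hvP : Set.range v ⊆ {w | stripIneq α β (x w) (y w)} := by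
    rintro _ ⟨k, rfl⟩
    simp only [Set.mem_ofPred_eq, stripIneq]
    match k with
    | 0 => rw [x0, y0]; refine ⟨?_, ?_, ?_, ?_⟩ <;> linarith
    | 1 => rw [x1, y1]; refine ⟨?_, ?_, ?_, ?_⟩ <;> nlinarith
    | 2 => rw [x2, y2]; refine ⟨?_, ?_, ?_, ?_⟩ <;> linarith
  have seg01 : ∀ w : ℂ, 0 ≤ x w → x w ≤ α → α * y w + β * x w = 0 → w ∈ segment ℝ (v 0) (v 1) := by
    intro w hw hw1 he
    refine h.mem_segment (t := x w / α) (by positivity) ((div_le_one hα).2 hw1) ?_ ?_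
    · rw [x0, x1]; field_simp; ring
    · rw [y0, y1]; field_simp; linarith
  have seg12 : ∀ w : ℂ, α ≤ x w → x w ≤ 1 → (1 - α) * y w + β * (1 - x w) = 0 →
      w ∈ segment ℝ (v 1) (v 2) := by
    intro w hw hw1 he
    refine h.mem_segment (t := (x w - α) / (1 - α)) (div_nonneg (by linarith) hα1'.le)
      ((div_le_one hα1').2 (by linarith)) ?_ ?_
    · rw [x1, x2]; field_simp; ring
    · rw [y1, y2]; field_simp; linarith
  have hseg : ∀ i j : Fin 3, segment ℝ (v i) (v j) ⊆ convexHull ℝ (Set.range v) := fun i j =>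
    segment_subset_convexHull (Set.mem_range_self i) (Set.mem_range_self j)
  have hPeq : {z | ∃ p ∈ convexHull ℝ (Set.range v), z ∈ closedRay p u} =
      {w | stripIneq α β (x w) (y w)} := by
    ext w
    constructor
    · rintro ⟨p, hp, hw⟩
      obtain ⟨q1, q2, q3, q4⟩ := convexHull_min hvP (h.convex_strip α β) hp
      obtain ⟨hx, hy⟩ := h.mem_closedRay.1 hw
      refine show stripIneq _ _ _ _ from ⟨?_, ?_, ?_, ?_⟩ <;> rw [hx] <;> nlinarith
    · rintro ⟨q1, q2, q3, q4⟩
      -- go down from `w` in the direction `-u` to one of the two lower sides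
      rcases le_total (x w) α with hle | hle
      · have e := And.intro (h.x_apply (x w) (-(β * x w) / α)) (h.y_apply (x w) (-(β * x w) / α))
        refine ⟨_, hseg 0 1 (seg01 _ (by rw [e.1]; exact q1) (by rw [e.1]; exact hle) ?_),
          h.mem_closedRay.2 ⟨e.1.symm, ?_⟩⟩
        · rw [e.1, e.2]; field_simp; ring
        · rw [e.2, div_le_iff₀ hα]; linarith
      · have e := And.intro (h.x_apply (x w) (-(β * (1 - x w)) / (1 - α)))
          (h.y_apply (x w) (-(β * (1 - x w)) / (1 - α)))
        refine ⟨_, hseg 1 2 (seg12 _ (by rw [e.1]; exact hle) (by rw [e.1]; exact q2) ?_),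
          h.mem_closedRay.2 ⟨e.1.symm, ?_⟩⟩
        · rw [e.1, e.2]; field_simp; ring
        · rw [e.2, div_le_iff₀ hα1']; linarith
  refine ⟨?_, ?_, rfl, ?_, ?_⟩
  · have n01 : v 0 ≠ v 1 := ne_of_apply_ne x (by rw [x0, x1]; exact hα.ne)
    have n02 : v 0 ≠ v 2 := ne_of_apply_ne x (by rw [x0, x2]; norm_num)
    have n12 : v 1 ≠ v 2 := ne_of_apply_ne x (by rw [x2, x1]; exact hα1.ne)
    intro i j hij
    fin_cases i <;> fin_cases j <;> first
      | rfl
      | exact absurd hij n01 | exact absurd hij n02 | exact absurd hij n12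
      | exact absurd hij.symm n01 | exact absurd hij.symm n02 | exact absurd hij.symm n12
  · rintro rfl
    simp [planeCross] at h₀
  · refine ⟨v 0 + ((1 / 2 : ℝ) : ℂ) * e₁ + ((1 : ℝ) : ℂ) * u, ?_⟩
    rw [hPeq, h.mem_interior_strip hα hα1, h.x_apply, h.y_apply]
    refine show stripIneqStrict _ _ _ _ from ⟨by norm_num, by norm_num, ?_, ?_⟩ <;> linarith
  · rw [hPeq, (h.isClosed_strip α β).frontier_eq]
    ext w
    simp only [Set.mem_sdiff, h.mem_interior_strip hα hα1, Set.mem_union]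
    constructor
    · rintro ⟨⟨q1, q2, q3, q4⟩, hni⟩
      rcases q1.eq_or_lt with e | p1
      · refine Or.inl (Or.inl (Or.inl (h.mem_closedRay.2 ⟨by rw [x0, e], ?_⟩)))
        rw [← e] at q3
        rw [y0]
        exact nonneg_of_mul_nonneg_right (by linarith) hα
      rcases q2.eq_or_lt with e | p2
      · refine Or.inr (h.mem_closedRay.2 ⟨by rw [x2, e], ?_⟩)
        rw [e] at q4
        rw [y2]
        exact nonneg_of_mul_nonneg_right (by linarith) hα1'
      rcases q3.eq_or_lt with e | p3
      · rcases hβ.eq_or_lt with rfl | hβ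
        · have hy0 : y w = 0 := by
            have : α * y w = 0 := by linarith
            exact (mul_eq_zero.1 this).resolve_left hα.ne'
          rcases le_total (x w) α with hle | hle
          · exact Or.inl (Or.inl (Or.inr (seg01 w q1 hle e.symm)))
          · exact Or.inl (Or.inr (seg12 w hle q2 (by rw [hy0]; ring)))
        · refine Or.inl (Or.inl (Or.inr (seg01 w q1 ?_ e.symm)))
          have : 0 ≤ β * (α - x w) := by nlinarith
          linarith [nonneg_of_mul_nonneg_right this hβ]
      · have e : (1 - α) * y w + β * (1 - x w) = 0 := by
          by_contra hne
          exact hni ⟨p1, p2, p3, lt_of_le_of_ne q4 (Ne.symm hne)⟩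
        rcases hβ.eq_or_lt with rfl | hβ
        · exfalso
          have hy0 : y w = 0 := by
            have : (1 - α) * y w = 0 := by linarith
            exact (mul_eq_zero.1 this).resolve_left hα1'.ne'
          rw [hy0] at p3
          linarith
        · refine Or.inl (Or.inr (seg12 w ?_ q2 e))
          have : 0 ≤ β * (x w - α) := by nlinarith
          linarith [nonneg_of_mul_nonneg_right this hβ]
    · have hsub : segment ℝ (v 0) (v 1) ∪ segment ℝ (v 1) (v 2) ⊆
          {w | stripIneq α β (x w) (y w)} := Set.union_subset
        ((h.convex_strip α β).segment_subset (hvP (Set.mem_range_self 0))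
          (hvP (Set.mem_range_self 1)))
        ((h.convex_strip α β).segment_subset (hvP (Set.mem_range_self 1))
          (hvP (Set.mem_range_self 2)))
      rintro (((hw | hw) | hw) | hw)
      · obtain ⟨hx, hy⟩ := h.mem_closedRay.1 hw
        rw [x0] at hx
        rw [y0] at hy
        refine ⟨show stripIneq _ _ _ _ from ?_, fun hi => hi.1.ne' hx⟩
        rw [hx]
        refine ⟨le_rfl, zero_le_one, ?_, ?_⟩ <;> nlinarith
      · refine ⟨hsub (Or.inl hw), fun hi => hi.2.2.1.ne' ?_⟩
        obtain ⟨t, ht, ht1, hx, hy⟩ := h.mem_of_mem_segment hw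
        rw [hx, hy, x0, x1, y0, y1]; ring
      · refine ⟨hsub (Or.inr hw), fun hi => hi.2.2.2.ne' ?_⟩
        obtain ⟨t, ht, ht1, hx, hy⟩ := h.mem_of_mem_segment hw
        rw [hx, hy, x2, x1, y2, y1]; ring
      · obtain ⟨hx, hy⟩ := h.mem_closedRay.1 hw
        rw [x2] at hx
        rw [y2] at hy
        refine ⟨show stripIneq _ _ _ _ from ?_, fun hi => hi.2.1.ne hx⟩
        rw [hx]
        refine ⟨zero_le_one, le_rfl, ?_, ?_⟩ <;> nlinarith

theorem IsConvexQuadrilateral.isClosed_and_convex {Q : Set ℂ} {v : Fin 4 → ℂ}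
    (h : IsConvexQuadrilateral Q v) : IsClosed Q ∧ Convex ℝ Q := by
  rw [h.eq_convexHull]
  exact ⟨((Set.finite_range v).isCompact_convexHull (𝕜 := ℝ)).isClosed, convex_convexHull ℝ _⟩

theorem IsConvexQuadrilateralAtInfinity.isClosed_and_convex {Q : Set ℂ} {v : Fin 3 → ℂ} {u : ℂ}
    (h : IsConvexQuadrilateralAtInfinity Q v u) : IsClosed Q ∧ Convex ℝ Q := by
  have hsub : ∀ p ∈ convexHull ℝ (Set.range v), closedRay p u ⊆ Q := fun p hp z hz => by
    rw [h.eq_hull]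
    exact ⟨p, hp, hz⟩
  have hseg : convexHull ℝ (Set.range v) ⊆ Q := fun p hp =>
    hsub p hp ⟨0, le_rfl, by simp⟩
  have hv : ∀ k, v k ∈ convexHull ℝ (Set.range v) := fun k =>
    subset_convexHull ℝ _ (Set.mem_range_self k)
  constructor
  · refine isClosed_of_closure_subset ?_
    rw [closure_eq_self_union_frontier, h.frontier_eq]
    refine Set.union_subset subset_rfl (Set.union_subset (Set.union_subset (Set.union_subset
      (hsub _ (hv 0)) ?_) ?_) (hsub _ (hv 2)))
    · exact ((convex_convexHull ℝ _).segment_subset (hv 0) (hv 1)).trans hseg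
    · exact ((convex_convexHull ℝ _).segment_subset (hv 1) (hv 2)).trans hseg
  · rw [h.eq_hull]
    rintro x ⟨p, hp, s, hs, rfl⟩ y ⟨q, hq, t, ht, rfl⟩ α β hα hβ hαβ
    refine ⟨α • p + β • q, convex_convexHull ℝ _ hp hq hα hβ hαβ, α * s + β * t, by positivity, ?_⟩
    simp only [Complex.real_smul]
    push_cast
    ring

/-! ### Unit vectors, directions and angles -/

/-- The unit vector in the direction `θ`. -/
noncomputable def unitDir (θ : ℝ) : ℂ := Complex.exp (θ * Complex.I)

theorem unitDir_re (θ : ℝ) : (unitDir θ).re = Real.cos θ := Complex.exp_ofReal_mul_I_re θ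

theorem unitDir_im (θ : ℝ) : (unitDir θ).im = Real.sin θ := Complex.exp_ofReal_mul_I_im θ

theorem unitDir_ne_zero (θ : ℝ) : unitDir θ ≠ 0 := Complex.exp_ne_zero _

theorem unitDir_zero : unitDir 0 = 1 := by simp [unitDir]

theorem unitDir_mul (α β : ℝ) : unitDir α * unitDir β = unitDir (α + β) := by
  rw [unitDir, unitDir, unitDir, ← Complex.exp_add]
  congr 1
  push_cast
  ring

theorem unitDir_sub_pi (θ : ℝ) : unitDir (θ - Real.pi) = -unitDir θ := by
  rw [unitDir, unitDir, Complex.ofReal_sub, sub_mul, Complex.exp_sub, Complex.exp_pi_mul_I, div_neg,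
    div_one]

theorem unitDir_mul_neg (θ : ℝ) : unitDir (-θ) * unitDir θ = 1 := by
  rw [unitDir_mul, neg_add_cancel, unitDir_zero]

theorem unitDir_upper {θ : ℝ} (h0 : 0 < θ) (h1 : θ < Real.pi) {ρ : ℝ} (hρ : 0 < ρ) :
    0 < ((ρ : ℂ) * unitDir θ).im := by
  rw [Complex.im_ofReal_mul, unitDir_im]
  exact mul_pos hρ (Real.sin_pos_of_pos_of_lt_pi h0 h1)

theorem add_mul_unitDir_ne {p : ℂ} {l φ : ℝ} (hl : 0 < l) : p + l * unitDir φ ≠ p := by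
  intro h
  have : (l : ℂ) * unitDir φ = 0 := by linear_combination h
  rcases mul_eq_zero.1 this with h | h
  · exact hl.ne' (by exact_mod_cast h)
  · exact unitDir_ne_zero φ h

/-- For a point `q` the number `Im (unitDir (-α) * q)` is the signed distance of `q` from the line
through `0` in the direction `α`, positive on its left. -/
theorem im_unitDir_neg_mul (l α φ : ℝ) :
    (unitDir (-α) * (l * unitDir φ)).im = l * Real.sin (φ - α) := by
  rw [mul_left_comm, unitDir_mul, Complex.im_ofReal_mul, unitDir_im]
  ring_nf

theorem unitDir_add_pi (θ : ℝ) : unitDir (θ + Real.pi) = -unitDir θ := by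
  rw [← unitDir_mul, unitDir, unitDir, Complex.exp_pi_mul_I, mul_neg_one]

theorem norm_unitDir (θ : ℝ) : ‖unitDir θ‖ = 1 := by
  rw [unitDir, Complex.norm_exp_ofReal_mul_I]

theorem planeCross_unitDir (l m α β : ℝ) :
    planeCross (l * unitDir α) (m * unitDir β) = l * m * Real.sin (β - α) := by
  simp only [planeCross, Complex.re_ofReal_mul, Complex.im_ofReal_mul, unitDir_re, unitDir_im,
    Real.sin_sub]
  ring

theorem angle_unitDir {p q s : ℂ} {l m α β : ℝ} (hl : 0 < l) (hm : 0 < m)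
    (hp : p - q = l * unitDir α) (hs : s - q = m * unitDir β) (h0 : β ≤ α)
    (h1 : α - β ≤ Real.pi) : EuclideanGeometry.angle p q s = α - β := by
  rw [EuclideanGeometry.angle, vsub_eq_sub, vsub_eq_sub, hp, hs, ← Complex.real_smul,
    ← Complex.real_smul, InnerProductGeometry.angle_smul_left_of_pos _ _ hl,
    InnerProductGeometry.angle_smul_right_of_pos _ _ hm, InnerProductGeometry.angle, norm_unitDir,
    norm_unitDir, mul_one, div_one, Complex.inner]
  have : (unitDir β * (starRingEnd ℂ) (unitDir α)).re = Real.cos (α - β) := by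
    simp only [Complex.mul_re, Complex.conj_re, Complex.conj_im, unitDir_re, unitDir_im,
      Real.cos_sub]
    ring
  rw [this]
  exact Real.arccos_cos (by linarith) h1

theorem sin_mul_pi_nonneg {q : ℝ} (h0 : 0 ≤ q) (h1 : q ≤ 1) : 0 ≤ Real.sin (q * Real.pi) :=
  Real.sin_nonneg_of_nonneg_of_le_pi (by positivity) (by nlinarith [Real.pi_pos])

theorem sin_mul_pi_pos {q : ℝ} (h0 : 0 < q) (h1 : q < 1) : 0 < Real.sin (q * Real.pi) :=
  Real.sin_pos_of_pos_of_lt_pi (by positivity) (by nlinarith [Real.pi_pos])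

theorem mem_segment_of_add {p q s d : ℂ} {l m : ℝ} (hl : 0 ≤ l) (hm : 0 ≤ m) (hq : q = p + l * d)
    (hs : s = q + m * d) : q ∈ segment ℝ p s := by
  rcases hl.eq_or_lt with rfl | hl
  · rw [hq, Complex.ofReal_zero, zero_mul, add_zero]
    exact left_mem_segment ℝ p s
  have hne : ((l + m : ℝ) : ℂ) ≠ 0 := Complex.ofReal_ne_zero.2 (by positivity)
  rw [segment_eq_image']
  refine ⟨l / (l + m), ⟨by positivity, (div_le_one (by positivity)).2 (by linarith)⟩, ?_⟩
  simp only [Complex.real_smul]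
  rw [hs, hq]
  push_cast at hne ⊢
  field_simp
  ring

/-- A limit of points on a ray lies on the ray. -/
theorem eq_add_of_tendsto_ray {f : ℝ → ℂ} {l : Filter ℝ} [l.NeBot] {L : ℝ → ℝ} {p w : ℂ} {φ m : ℝ}
    (hf : Tendsto f l (𝓝 w)) (hL : ∀ᶠ s in l, f s = p + L s * unitDir φ) (hm : ∀ᶠ s in l, m ≤ L s) :
    ∃ Λ : ℝ, m ≤ Λ ∧ w = p + Λ * unitDir φ := by
  have hunit := unitDir_mul_neg φ
  have hLf : ∀ᶠ s in l, unitDir (-φ) * (f s - p) = (L s : ℂ) := by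
    filter_upwards [hL] with s hs
    rw [hs]
    linear_combination (L s : ℂ) * hunit
  have hlim : Tendsto (fun s => unitDir (-φ) * (f s - p)) l (𝓝 (unitDir (-φ) * (w - p))) :=
    (hf.sub_const p).const_mul _
  have hre : Tendsto L l (𝓝 (unitDir (-φ) * (w - p)).re) := by
    refine ((Complex.continuous_re.tendsto _).comp hlim).congr' ?_
    filter_upwards [hLf] with s hs
    simp only [Function.comp, hs, Complex.ofReal_re]
  have heq : unitDir (-φ) * (w - p) = ((unitDir (-φ) * (w - p)).re : ℂ) := by
    refine tendsto_nhds_unique hlim ?_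
    refine ((Complex.continuous_ofReal.tendsto _).comp hre).congr' ?_
    filter_upwards [hLf] with s hs
    simp only [Function.comp, hs]
  refine ⟨_, ge_of_tendsto hre hm, ?_⟩
  rw [← heq]
  linear_combination -(w - p) * hunit

/-! ### The images of the real intervals -/

/-- The length of the image of the real interval `[x, y]`. -/
noncomputable def scLength (a b c r x y : ℝ) : ℝ :=
  scConstReal b c * ∫ t in x..y, scDensity a b c r t

/-- At real points the defining integral is an integral over a real interval. -/
theorem scMap_ofReal (a b c r x : ℝ) :
    scMap a b c r x = scConst b c * ∫ t in (0 : ℝ)..x, scIntegrand a b c r t := by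
  have := intervalIntegral.smul_integral_comp_mul_right (a := 0) (b := 1)
    (fun t : ℝ => scIntegrand a b c r t) x
  rw [zero_mul, one_mul] at this
  rw [scMap, ← this, intervalIntegral.integral_mul_const, Complex.real_smul, mul_comm (x : ℂ)]
  simp only [Complex.ofReal_mul]

theorem coe_inv (r : ℝ) : ((1 / r ^ 2 : ℝ) : ℂ) = 1 / (r : ℂ) ^ 2 := by push_cast; rfl

theorem arg_ofReal_sub_one_of_lt {t : ℝ} (ht : t < 1) : ((t : ℂ) - 1).arg = Real.pi := by
  rw [← Complex.ofReal_one, ← Complex.ofReal_sub, Complex.arg_ofReal_of_neg (by linarith)]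

theorem arg_ofReal_sub_one_of_gt {t : ℝ} (ht : 1 < t) : ((t : ℂ) - 1).arg = 0 := by
  rw [← Complex.ofReal_one, ← Complex.ofReal_sub, Complex.arg_ofReal_of_nonneg (by linarith)]

namespace SCParams

variable {a b c r : ℝ}

theorem intervalIntegrable_real (h : SCParams a b c r) (x y : ℝ) :
    IntervalIntegrable (fun t : ℝ => scIntegrand a b c r t) MeasureTheory.volume x y := by
  have key : ∀ x : ℝ, IntervalIntegrable (fun t : ℝ => scIntegrand a b c r t)
      MeasureTheory.volume 0 x := by
    intro x
    rcases le_total 0 x with hx | hx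
    · simpa using h.intervalIntegrable_ray (ω := 1) (by simp) le_rfl hx
    · rw [IntervalIntegrable.iff_comp_neg]
      have := (h.intervalIntegrable_ray (ω := -1) (by simp) le_rfl
        (show 0 ≤ -x by linarith)).neg
      simpa [Pi.neg_def] using this
  exact (key x).symm.trans (key y)

theorem intervalIntegrable_density (h : SCParams a b c r) (x y : ℝ) :
    IntervalIntegrable (fun t : ℝ => scDensity a b c r t) MeasureTheory.volume x y := by
  simpa only [norm_scIntegrand] using (h.intervalIntegrable_real x y).norm

theorem scMap_sub (h : SCParams a b c r) (x y : ℝ) :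
    scMap a b c r y - scMap a b c r x = scConst b c * ∫ t in x..y, scIntegrand a b c r t := by
  rw [scMap_ofReal, scMap_ofReal, ← mul_sub, intervalIntegral.integral_interval_sub_left
    (h.intervalIntegrable_real _ _) (h.intervalIntegrable_real _ _)]

/-- On an interval on which the argument of the integrand is constant, `f` moves on a line. -/
theorem scMap_sub_eq_length (h : SCParams a b c r) {x y φ : ℝ} (hxy : x ≤ y)
    (hφ : ∀ t ∈ Set.Ioo x y, scArg a b c r t = φ) :
    scMap a b c r y - scMap a b c r x = scLength a b c r x y * unitDir φ := by
  have : ∫ t in x..y, scIntegrand a b c r t =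
      (∫ t in x..y, (scDensity a b c r t : ℂ)) * unitDir φ := by
    rw [← intervalIntegral.integral_mul_const]
    refine intervalIntegral.integral_congr_ae ?_
    have hne : ∀ᵐ t : ℝ, t ≠ y := by
      have := (Set.countable_singleton y).ae_notMem MeasureTheory.volume
      simpa using this
    filter_upwards [hne] with t ht hmem
    rw [Set.uIoc_of_le hxy] at hmem
    rw [scIntegrand_eq, hφ t ⟨hmem.1, lt_of_le_of_ne hmem.2 ht⟩, unitDir]
  rw [h.scMap_sub, this, intervalIntegral.integral_ofReal, h.scConst_eq, scLength]
  push_cast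
  ring

theorem scLength_add (h : SCParams a b c r) (x y z : ℝ) :
    scLength a b c r x y + scLength a b c r y z = scLength a b c r x z := by
  rw [scLength, scLength, scLength, ← mul_add, intervalIntegral.integral_add_adjacent_intervals
    (h.intervalIntegrable_density _ _) (h.intervalIntegrable_density _ _)]

theorem scLength_nonneg (h : SCParams a b c r) {x y : ℝ} (hxy : x ≤ y) :
    0 ≤ scLength a b c r x y :=
  mul_nonneg h.scConstReal_pos.le
    (intervalIntegral.integral_nonneg hxy fun _ _ => scDensity_nonneg ..)

theorem scLength_pos (h : SCParams a b c r) {x y : ℝ} (hxy : x < y) :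
    0 < scLength a b c r x y := by
  refine mul_pos h.scConstReal_pos ?_
  have hpos : ∀ᵐ t : ℝ, 0 < scDensity a b c r t := by
    filter_upwards [ae_ne_singular r] with t ht
    exact scDensity_pos h.hr (by exact_mod_cast ht.1) (by exact_mod_cast ht.2.1)
      (by exact_mod_cast ht.2.2)
  rw [intervalIntegral.integral_pos_iff_support_of_nonneg_ae
    (Eventually.of_forall fun t => scDensity_nonneg ..) (h.intervalIntegrable_density _ _)]
  refine ⟨hxy, ?_⟩
  have : Set.Ioc x y ≤ᵐ[MeasureTheory.volume]
      (Function.support (fun t : ℝ => scDensity a b c r t) ∩ Set.Ioc x y : Set ℝ) := by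
    filter_upwards [hpos] with t ht hmem
    exact ⟨ht.ne', hmem⟩
  refine lt_of_lt_of_le ?_ (MeasureTheory.measure_mono_ae this)
  rw [Real.volume_Ioc]
  exact ENNReal.ofReal_pos.2 (by linarith)

theorem sq_mul_lt_one (h : SCParams a b c r) {t : ℝ} : r ^ 2 * t < 1 ↔ t < 1 / r ^ 2 := by
  have := h.hr
  rw [lt_div_iff₀ (by positivity), mul_comm]

theorem one_lt_sq_mul (h : SCParams a b c r) {t : ℝ} : 1 < r ^ 2 * t ↔ 1 / r ^ 2 < t := by
  have := h.hr
  rw [div_lt_iff₀ (by positivity), mul_comm]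

theorem arg_sq_mul_of_lt (h : SCParams a b c r) {t : ℝ} (ht : t < 1 / r ^ 2) :
    ((r : ℂ) ^ 2 * t - 1).arg = Real.pi := by
  have := arg_ofReal_sub_one_of_lt (h.sq_mul_lt_one.2 ht)
  push_cast at this
  exact this

theorem arg_sq_mul_of_gt (h : SCParams a b c r) {t : ℝ} (ht : 1 / r ^ 2 < t) :
    ((r : ℂ) ^ 2 * t - 1).arg = 0 := by
  have := arg_ofReal_sub_one_of_gt (h.one_lt_sq_mul.2 ht)
  push_cast at this
  exact this

/-- The image of `[x, y]` for `y ≤ 0`. The direction is that of the backward motion: from `f y` to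
`f x` it is `b * π`. -/
theorem side_neg (h : SCParams a b c r) {x y : ℝ} (hxy : x ≤ y) (hy : y ≤ 0) :
    scMap a b c r x = scMap a b c r y + scLength a b c r x y * unitDir (b * Real.pi) := by
  have hp := h.one_lt
  have := h.scMap_sub_eq_length (φ := b * Real.pi - Real.pi) hxy fun t ht => by
    have ht0 : t < 0 := ht.2.trans_le hy
    rw [scArg, Complex.arg_ofReal_of_neg ht0, arg_ofReal_sub_one_of_lt (by linarith),
      h.arg_sq_mul_of_lt (by linarith)]
    ring
  rw [unitDir_sub_pi] at this
  linear_combination -this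

/-- The image of `[x, y] ⊆ [0, 1]`. -/
theorem side_zero_one (h : SCParams a b c r) {x y : ℝ} (hx : 0 ≤ x) (hxy : x ≤ y) (hy : y ≤ 1) :
    scMap a b c r y = scMap a b c r x + scLength a b c r x y * unitDir 0 := by
  have hp := h.one_lt
  have := h.scMap_sub_eq_length (φ := 0) hxy fun t ht => by
    have h0 : 0 < t := hx.trans_lt ht.1
    have h1 : t < 1 := ht.2.trans_le hy
    rw [scArg, Complex.arg_ofReal_of_nonneg h0.le, arg_ofReal_sub_one_of_lt (by linarith),
      h.arg_sq_mul_of_lt (by linarith)]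
    ring
  linear_combination this

/-- The image of `[x, y] ⊆ [1, 1 / r ^ 2]`. -/
theorem side_one_inv (h : SCParams a b c r) {x y : ℝ} (hx : 1 ≤ x) (hxy : x ≤ y)
    (hy : y ≤ 1 / r ^ 2) : scMap a b c r y =
      scMap a b c r x + scLength a b c r x y * unitDir ((b + 1 - c) * Real.pi) := by
  have := h.scMap_sub_eq_length (φ := (b + 1 - c) * Real.pi) hxy fun t ht => by
    have h0 : 1 < t := hx.trans_lt ht.1
    have h1 : t < 1 / r ^ 2 := ht.2.trans_le hy
    rw [scArg, Complex.arg_ofReal_of_nonneg (by linarith), arg_ofReal_sub_one_of_gt h0,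
      h.arg_sq_mul_of_lt h1]
    ring
  linear_combination this

/-- The image of `[x, y]` for `x ≥ 1 / r ^ 2`. -/
theorem side_inv (h : SCParams a b c r) {x y : ℝ} (hx : 1 / r ^ 2 ≤ x) (hxy : x ≤ y) :
    scMap a b c r y =
      scMap a b c r x + scLength a b c r x y * unitDir ((a + b + 1 - c) * Real.pi) := by
  have hp := h.one_lt
  have := h.scMap_sub_eq_length (φ := (a + b + 1 - c) * Real.pi) hxy fun t ht => by
    have h0 : 1 / r ^ 2 < t := hx.trans_lt ht.1
    rw [scArg, Complex.arg_ofReal_of_nonneg (by linarith), arg_ofReal_sub_one_of_gt (by linarith),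
      h.arg_sq_mul_of_gt h0]
    ring
  linear_combination this

/-! ### Injectivity on the real axis -/

/-- The images of the points of `(0, 1 / r ^ 2]` lie strictly to the right of the ray that contains
the image of the negative axis. -/
theorem tilt_neg (h : SCParams a b c r) {y : ℝ} (hy0 : 0 < y) (hyp : y ≤ 1 / r ^ 2) :
    (unitDir (-(b * Real.pi)) * scMap a b c r y).im < 0 := by
  have hs := sin_mul_pi_pos h.hb h.hb1
  have key : ∀ y : ℝ, 0 < y → y ≤ 1 → (unitDir (-(b * Real.pi)) * scMap a b c r y).im < 0 := by
    intro y hy0 hy1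
    have e := h.side_zero_one le_rfl hy0.le hy1
    rw [Complex.ofReal_zero, scMap_zero, zero_add] at e
    rw [e, im_unitDir_neg_mul, zero_sub, Real.sin_neg]
    nlinarith [h.scLength_pos hy0]
  rcases le_total y 1 with hy1 | hy1
  · exact key y hy0 hy1
  · rw [h.side_one_inv le_rfl hy1 hyp, mul_add, Complex.add_im, im_unitDir_neg_mul]
    have h1 := key 1 one_pos le_rfl
    have h2 := sin_mul_pi_nonneg (q := c - 1) (by linarith [h.hc1]) (by linarith [h.hcb, h.hb1])
    have e : (b + 1 - c) * Real.pi - b * Real.pi = -((c - 1) * Real.pi) := by ring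
    rw [e, Real.sin_neg]
    nlinarith [h.scLength_nonneg hy1]

theorem tilt_nonpos_axis (h : SCParams a b c r) {x : ℝ} (hx : x ≤ 0) :
    (unitDir (-(b * Real.pi)) * scMap a b c r x).im = 0 := by
  have e := h.side_neg hx le_rfl
  rw [Complex.ofReal_zero, scMap_zero, zero_add] at e
  rw [e, im_unitDir_neg_mul, sub_self, Real.sin_zero, mul_zero]

/-- From `f x` to `f y` the boundary curve consists of at most one piece in each of the directions
`0`, `(b + 1 - c) * π` and `(a + b + 1 - c) * π`, which all lie in `[0, π]`. Unless it has only
one piece, it cannot be closed: for `c < 1 + b` the second piece rises strictly, and for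
`c = 1 + b` the third. -/
theorem ne_of_nonneg_lt (h : SCParams a b c r) {x y : ℝ} (hx : 0 ≤ x) (hxy : x < y) :
    scMap a b c r y ≠ scMap a b c r x := by
  have hp := h.one_lt
  have hL := h.scLength_pos hxy
  by_cases hy1 : y ≤ 1
  · rw [h.side_zero_one hx hxy.le hy1]; exact add_mul_unitDir_ne hL
  by_cases hxp : 1 / r ^ 2 ≤ x
  · rw [h.side_inv hxp hxy.le]; exact add_mul_unitDir_ne hL
  push Not at hy1 hxp
  -- the part of the path in `[1, 1 / r ^ 2]` goes from `x₁` to `y₁`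
  obtain ⟨x₁, A₀, hA₀, e₀, hx₁, hxx₁⟩ : ∃ x₁ A₀ : ℝ, 0 ≤ A₀ ∧
      scMap a b c r x₁ = scMap a b c r x + A₀ * unitDir 0 ∧ 1 ≤ x₁ ∧ (x₁ = 1 ∨ x₁ = x) := by
    rcases le_total x 1 with h1 | h1
    · exact ⟨1, _, h.scLength_nonneg h1, by simpa using h.side_zero_one hx h1 le_rfl, le_rfl,
        Or.inl rfl⟩
    · exact ⟨x, 0, le_rfl, by simp, h1, Or.inr rfl⟩
  obtain ⟨y₁, A₂, hA₂, e₂, hy₁, hyy₁⟩ : ∃ y₁ A₂ : ℝ, 0 ≤ A₂ ∧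
      scMap a b c r y = scMap a b c r y₁ + A₂ * unitDir ((a + b + 1 - c) * Real.pi) ∧
        y₁ ≤ 1 / r ^ 2 ∧ (y₁ = 1 / r ^ 2 ∨ y₁ = y) := by
    rcases le_total y (1 / r ^ 2) with h1 | h1
    · exact ⟨y, 0, le_rfl, by simp, h1, Or.inr rfl⟩
    · exact ⟨1 / r ^ 2, _, h.scLength_nonneg h1, h.side_inv le_rfl h1, le_rfl, Or.inl rfl⟩
  have hlt : x₁ < y₁ := by
    rcases hxx₁ with rfl | rfl <;> rcases hyy₁ with h2 | rfl <;> linarith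
  have hA₁ := h.scLength_pos hlt
  have e₁ := h.side_one_inv hx₁ hlt.le hy₁
  intro heq
  have e : (A₀ : ℂ) * unitDir 0 + scLength a b c r x₁ y₁ * unitDir ((b + 1 - c) * Real.pi) +
      A₂ * unitDir ((a + b + 1 - c) * Real.pi) = 0 := by
    linear_combination heq - e₀ - e₁ - e₂
  have him := congrArg Complex.im e
  have hre := congrArg Complex.re e
  simp only [Complex.add_im, Complex.im_ofReal_mul, unitDir_im, Real.sin_zero, mul_zero, zero_add,
    Complex.zero_im] at him
  simp only [Complex.add_re, Complex.re_ofReal_mul, unitDir_re, Real.cos_zero, mul_one,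
    Complex.zero_re] at hre
  have := h.hab; have := h.hc1; have := h.ha; have := h.hb; have := h.hb1; have := h.ha1
  rcases h.hcb.eq_or_lt with hc | hc
  · have hs := sin_mul_pi_pos h.ha h.ha1
    rw [show b + 1 - c = 0 by linarith, show a + b + 1 - c = a by linarith] at him hre
    rw [zero_mul, Real.sin_zero, mul_zero, zero_add] at him
    have hA₂0 : A₂ = 0 := (mul_eq_zero.1 him).resolve_right hs.ne'
    rw [hA₂0, zero_mul, Real.cos_zero] at hre
    linarith
  · have hs := sin_mul_pi_pos (q := b + 1 - c) (by linarith) (by linarith)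
    have hs2 := sin_mul_pi_nonneg (q := a + b + 1 - c) (by linarith) (by linarith)
    have := mul_pos hA₁ hs
    have := mul_nonneg hA₂ hs2
    linarith

/-- `f` is injective on the real axis, provided the images of the points beyond `1 / r ^ 2` do not
reach the ray that contains the image of the negative axis. -/
theorem injOn_real (h : SCParams a b c r)
    (hst : ∀ y : ℝ, 1 / r ^ 2 < y → (unitDir (-(b * Real.pi)) * scMap a b c r y).im < 0) :
    Set.InjOn (scMap a b c r) {z | z.im = 0} := by
  have key : ∀ x y : ℝ, x < y → scMap a b c r y ≠ scMap a b c r x := by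
    intro x y hxy
    rcases le_or_gt 0 x with hx | hx
    · exact h.ne_of_nonneg_lt hx hxy
    · rcases le_or_gt y 0 with hy | hy
      · rw [h.side_neg hxy.le hy]
        exact (add_mul_unitDir_ne (h.scLength_pos hxy)).symm
      · intro e
        have h1 := h.tilt_nonpos_axis hx.le
        rw [← e] at h1
        rcases le_or_gt y (1 / r ^ 2) with hyp | hyp
        · exact (h.tilt_neg hy hyp).ne h1
        · exact (hst y hyp).ne h1
  intro z hz w hw hzw
  have ez : z = (z.re : ℂ) := Complex.ext rfl (by simpa using hz)
  have ew : w = (w.re : ℂ) := Complex.ext rfl (by simpa using hw)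
  rw [ez, ew] at hzw ⊢
  rcases lt_trichotomy z.re w.re with hlt | heq | hlt
  · exact absurd hzw.symm (key _ _ hlt)
  · rw [heq]
  · exact absurd hzw (key _ _ hlt)

/-! ### The limit at infinity for `c < 1 + a` -/

/-- The integrand decays like `|t| ^ (c - a - 2)` at infinity. -/
theorem exists_scDensity_le_rpow (h : SCParams a b c r) :
    ∃ K : ℝ, 0 ≤ K ∧ ∀ t : ℂ, 2 / r ^ 2 ≤ ‖t‖ → scDensity a b c r t ≤ K * ‖t‖ ^ (c - a - 2) := by
  have hr := h.hr
  have hp := h.one_lt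
  have hr2 : 0 < r ^ 2 := by positivity
  have := h.hcb; have := h.ha
  refine ⟨(1 / 2) ^ (c - b - 1) * (r ^ 2 / 2) ^ (-a), by positivity, fun t ht => ?_⟩
  have ht2 : 2 ≤ ‖t‖ := by
    have : 2 / r ^ 2 = 2 * (1 / r ^ 2) := by ring
    linarith
  have ht0 : 0 < ‖t‖ := by linarith
  have ht' : 2 ≤ r ^ 2 * ‖t‖ := by rwa [div_le_iff₀ hr2, mul_comm] at ht
  have n1 : 1 / 2 * ‖t‖ ≤ ‖1 - t‖ := by
    have := norm_sub_norm_le t 1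
    rw [norm_one, norm_sub_rev] at this
    linarith
  have n2 : r ^ 2 / 2 * ‖t‖ ≤ ‖1 - (r : ℂ) ^ 2 * t‖ := by
    have := norm_sub_norm_le ((r : ℂ) ^ 2 * t) 1
    rw [norm_one, norm_sub_rev, norm_mul, norm_pow, Complex.norm_real, Real.norm_of_nonneg hr.le]
      at this
    linarith
  have b1 := Real.rpow_le_rpow_of_nonpos (by positivity) n1 (show c - b - 1 ≤ 0 by linarith)
  have b2 := Real.rpow_le_rpow_of_nonpos (by positivity) n2 (show -a ≤ 0 by linarith)
  calc scDensity a b c r t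
      ≤ ‖t‖ ^ (b - 1) * (1 / 2 * ‖t‖) ^ (c - b - 1) * (r ^ 2 / 2 * ‖t‖) ^ (-a) := by
        unfold scDensity; gcongr
    _ = (1 / 2) ^ (c - b - 1) * (r ^ 2 / 2) ^ (-a) *
        (‖t‖ ^ (b - 1) * ‖t‖ ^ (c - b - 1) * ‖t‖ ^ (-a)) := by
        rw [Real.mul_rpow (by positivity) ht0.le, Real.mul_rpow (by positivity) ht0.le]; ring
    _ = _ := by
        rw [← Real.rpow_add ht0, ← Real.rpow_add ht0]
        congr 2
        ring

theorem integrableOn_Ioi (h : SCParams a b c r) (hc : c < 1 + a) (x : ℝ) :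
    MeasureTheory.IntegrableOn (fun t : ℝ => scIntegrand a b c r t) (Set.Ioi x) := by
  obtain ⟨K, hK, hle⟩ := h.exists_scDensity_le_rpow
  have hr := h.hr
  set R := max x (2 / r ^ 2) with hR
  have hR0 : 0 < R := lt_of_lt_of_le (by positivity) (le_max_right _ _)
  rw [← Set.Ioc_union_Ioi_eq_Ioi (le_max_left x (2 / r ^ 2))]
  refine ((intervalIntegrable_iff_integrableOn_Ioc_of_le (le_max_left _ _)).1
    (h.intervalIntegrable_real _ _)).union ?_
  refine MeasureTheory.Integrable.mono' (g := fun t : ℝ => K * t ^ (c - a - 2))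
    ((integrableOn_Ioi_rpow_of_lt (by linarith) hR0).const_mul K) ?_ ?_
  · exact ((measurable_scIntegrand a b c r).comp Complex.measurable_ofReal).aestronglyMeasurable
  · refine (MeasureTheory.ae_restrict_iff' measurableSet_Ioi).2
      (Eventually.of_forall fun t ht => ?_)
    have ht' : R < t := ht
    have e : ‖(t : ℂ)‖ = t := by
      rw [Complex.norm_real, Real.norm_of_nonneg (by linarith)]
    have := hle t (by rw [e]; exact (le_max_right _ _).trans ht'.le)
    rwa [e, ← norm_scIntegrand] at this

/-- The value of `f` at infinity in the case `c < 1 + a`. -/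
theorem tendsto_scMap_atTop (h : SCParams a b c r) (hc : c < 1 + a) :
    Tendsto (fun x : ℝ => scMap a b c r x) atTop (𝓝 (scMap a b c r (1 / (r : ℂ) ^ 2) +
      scConst b c * ∫ t in Set.Ioi (1 / r ^ 2), scIntegrand a b c r (t : ℝ))) := by
  have := (MeasureTheory.intervalIntegral_tendsto_integral_Ioi (1 / r ^ 2)
    (h.integrableOn_Ioi hc _) tendsto_id).const_mul (scConst b c)
  have := this.const_add (scMap a b c r ((1 / r ^ 2 : ℝ) : ℂ))
  have e : ((1 / r ^ 2 : ℝ) : ℂ) = 1 / (r : ℂ) ^ 2 := by push_cast; rfl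
  rw [← e]
  refine this.congr fun x => ?_
  simp only [id]
  rw [← h.scMap_sub]
  ring

/-- Comparison of the value at `z` with the value at `|z|` along a circular arc. The derivative
along the arc is available only in its interior; the Lipschitz bound passes to the endpoints by
continuity. -/
theorem norm_scMap_sub_norm_le (h : SCParams a b c r) {K ρ : ℝ} (hK : 0 ≤ K) (hρ : 0 < ρ)
    (hbd : ∀ t : ℂ, ‖t‖ = ρ → scDensity a b c r t ≤ K) {z : ℂ} (hz : z ∈ closedUpperHalfPlane)
    (hzρ : ‖z‖ = ρ) :
    ‖scMap a b c r z - scMap a b c r ρ‖ ≤ scConstReal b c * K * ρ * Real.pi := by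
  have hC := h.scConstReal_pos
  have hnorm : ∀ θ : ℝ, ‖(ρ : ℂ) * unitDir θ‖ = ρ := fun θ => by
    rw [norm_mul, unitDir, Complex.norm_exp_ofReal_mul_I, mul_one, Complex.norm_real,
      Real.norm_of_nonneg hρ.le]
  have hcurve : ∀ θ : ℝ, HasDerivAt (fun θ : ℝ => (ρ : ℂ) * unitDir θ)
      (ρ * unitDir θ * Complex.I) θ := fun θ => by
    have h1 : HasDerivAt (fun θ : ℝ => (θ : ℂ) * Complex.I) Complex.I θ := by
      simpa using (Complex.ofRealCLM.hasDerivAt (x := θ)).mul_const Complex.I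
    exact (h1.cexp.const_mul (ρ : ℂ)).congr_deriv (by rw [unitDir]; ring)
  have hcl : closure (Set.Ioo 0 Real.pi) = Set.Icc 0 Real.pi := closure_Ioo Real.pi_pos.ne
  have hmaps : ∀ θ ∈ Set.Icc 0 Real.pi, (ρ : ℂ) * unitDir θ ∈ closedUpperHalfPlane := by
    intro θ hθ
    have : 0 ≤ ρ * Real.sin θ := mul_nonneg hρ.le (Real.sin_nonneg_of_nonneg_of_le_pi hθ.1 hθ.2)
    rw [← unitDir_im, ← Complex.im_ofReal_mul] at this
    exact this
  have hcont : ContinuousOn (fun θ : ℝ => scMap a b c r (ρ * unitDir θ)) (Set.Icc 0 Real.pi) :=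
    h.continuousOn_scMap.comp (fun θ _ => (hcurve θ).continuousAt.continuousWithinAt) hmaps
  have hlip : LipschitzOnWith (Real.toNNReal (scConstReal b c * K * ρ))
      (fun θ : ℝ => scMap a b c r (ρ * unitDir θ)) (Set.Icc 0 Real.pi) := by
    rw [← hcl] at hcont ⊢
    refine LipschitzOnWith.closure hcont ?_
    refine (convex_Ioo 0 Real.pi).lipschitzOnWith_of_nnnorm_hasDerivWithin_le
      (f' := fun θ => scConst b c * scIntegrand a b c r (ρ * unitDir θ) *
        (ρ * unitDir θ * Complex.I)) ?_ ?_
    · intro θ hθ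
      exact ((h.hasDerivAt_scMap (unitDir_upper hθ.1 hθ.2 hρ)).comp_of_eq θ (hcurve θ)
        rfl).hasDerivWithinAt
    · intro θ hθ
      rw [← NNReal.coe_le_coe, coe_nnnorm, Real.coe_toNNReal _ (by positivity), norm_mul, norm_mul,
        norm_mul, hnorm, Complex.norm_I, mul_one, norm_scIntegrand, h.scConst_eq, Complex.norm_real,
        Real.norm_of_nonneg hC.le]
      gcongr
      exact hbd _ (hnorm θ)
  have hz' : z = ρ * unitDir z.arg := by
    rw [unitDir, ← hzρ, Complex.norm_mul_exp_arg_mul_I]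
  have harg : z.arg ∈ Set.Icc 0 Real.pi := ⟨Complex.arg_nonneg_iff.2 hz, Complex.arg_le_pi z⟩
  have := hlip.dist_le_mul z.arg harg 0 ⟨le_rfl, Real.pi_pos.le⟩
  rw [← hz', unitDir_zero, mul_one, dist_eq_norm, Real.coe_toNNReal _ (by positivity),
    dist_eq_norm, sub_zero, Real.norm_of_nonneg harg.1] at this
  refine this.trans ?_
  gcongr
  exact harg.2

/-- The difference of the values at `z` and at `|z|` is bounded by the length `π * |z|` of the arc
times the bound `O(|z| ^ (c - a - 2))` for the integrand, hence tends to `0`. -/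
theorem tendsto_scMap_cocompact (h : SCParams a b c r) (hc : c < 1 + a) {w : ℂ}
    (hw : Tendsto (fun x : ℝ => scMap a b c r x) atTop (𝓝 w)) :
    Tendsto (scMap a b c r) (cocompact ℂ ⊓ 𝓟 closedUpperHalfPlane) (𝓝 w) := by
  obtain ⟨K, hK, hle⟩ := h.exists_scDensity_le_rpow
  have hC := h.scConstReal_pos
  have hr := h.hr
  have hnorm : Tendsto (fun z : ℂ => ‖z‖) (cocompact ℂ ⊓ 𝓟 closedUpperHalfPlane) atTop :=
    tendsto_norm_cocompact_atTop.mono_left inf_le_left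
  have h1 : Tendsto (fun z : ℂ => scMap a b c r (‖z‖ : ℝ))
      (cocompact ℂ ⊓ 𝓟 closedUpperHalfPlane) (𝓝 w) := hw.comp hnorm
  have hpow : Tendsto (fun ρ : ℝ => scConstReal b c * K * Real.pi * ρ ^ (-(1 + a - c))) atTop
      (𝓝 0) := by
    have := (tendsto_rpow_neg_atTop (y := 1 + a - c) (by linarith)).const_mul
      (scConstReal b c * K * Real.pi)
    rwa [mul_zero] at this
  have h2 : Tendsto (fun z : ℂ => scMap a b c r z - scMap a b c r (‖z‖ : ℝ))
      (cocompact ℂ ⊓ 𝓟 closedUpperHalfPlane) (𝓝 0) := by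
    refine squeeze_zero_norm' ?_ (hpow.comp hnorm)
    filter_upwards [hnorm.eventually_ge_atTop (2 / r ^ 2),
      (eventually_principal.2 fun _ hz => hz : ∀ᶠ z in 𝓟 closedUpperHalfPlane,
        z ∈ closedUpperHalfPlane).filter_mono inf_le_right] with z hzR hzH
    have hρ : 0 < ‖z‖ := lt_of_lt_of_le (by positivity) hzR
    refine (h.norm_scMap_sub_norm_le (K := K * ‖z‖ ^ (c - a - 2)) (by positivity) hρ
      (fun t ht => ?_) hzH rfl).trans (le_of_eq ?_)
    · have := hle t (ht ▸ hzR)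
      rwa [ht] at this
    · simp only [Function.comp]
      rw [show -(1 + a - c) = (c - a - 2) + 1 by ring, Real.rpow_add_one hρ.ne']
      ring
  simpa using h2.add h1

/-- The image of `[x, ∞]` for `x ≥ 1 / r ^ 2`. -/
theorem side_inv_infty (h : SCParams a b c r) {w : ℂ}
    (hw : Tendsto (scMap a b c r) (cocompact ℂ ⊓ 𝓟 closedUpperHalfPlane) (𝓝 w)) {x : ℝ}
    (hx : 1 / r ^ 2 ≤ x) :
    ∃ Λ : ℝ, 0 < Λ ∧ w = scMap a b c r x + Λ * unitDir ((a + b + 1 - c) * Real.pi) := by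
  obtain ⟨Λ, hΛ, e⟩ := eq_add_of_tendsto_ray (L := fun s => scLength a b c r x s)
    (m := scLength a b c r x (x + 1))
    (p := scMap a b c r x) (φ := (a + b + 1 - c) * Real.pi)
    (hw.comp tendsto_coe_atTop_cocompact_upper)
    ((eventually_ge_atTop x).mono fun s hs => h.side_inv hx hs)
    ((eventually_ge_atTop (x + 1)).mono fun s hs => by
      rw [← h.scLength_add x (x + 1) s]
      linarith [h.scLength_nonneg hs])
  exact ⟨Λ, (h.scLength_pos (by linarith)).trans_le hΛ, e⟩

/-- The image of `[-∞, x]` for `x ≤ 0`. -/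
theorem side_neg_infty (h : SCParams a b c r) {w : ℂ}
    (hw : Tendsto (scMap a b c r) (cocompact ℂ ⊓ 𝓟 closedUpperHalfPlane) (𝓝 w)) {x : ℝ}
    (hx : x ≤ 0) :
    ∃ Λ : ℝ, 0 < Λ ∧ w = scMap a b c r x + Λ * unitDir (b * Real.pi) := by
  obtain ⟨Λ, hΛ, e⟩ := eq_add_of_tendsto_ray (L := fun s => scLength a b c r s x)
    (m := scLength a b c r (x - 1) x)
    (p := scMap a b c r x) (φ := b * Real.pi)
    (hw.comp tendsto_coe_atBot_cocompact_upper)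
    ((eventually_le_atBot x).mono fun s hs => h.side_neg hs hx)
    ((eventually_le_atBot (x - 1)).mono fun s hs => by
      rw [← h.scLength_add s (x - 1) x]
      linarith [h.scLength_nonneg hs])
  exact ⟨Λ, (h.scLength_pos (by linarith)).trans_le hΛ, e⟩

end SCParams

/-! ### Growth at infinity for `c = 1 + a` -/

theorem eq_zero_of_forall_nonneg_add_mul {A B : ℝ} (h : ∀ t : ℝ, 0 ≤ A + t * B) : B = 0 := by
  by_contra hB
  have := h (-(A + 1) / B)
  rw [div_mul_cancel₀ _ hB] at this
  linarith

/-- Seen from a point further to the right, a point of the upper half-plane has a larger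
argument. -/
theorem Complex.arg_le_arg_sub_ofReal {w : ℂ} (hw : 0 ≤ w.im) {x : ℝ} (hx : 0 ≤ x) :
    w.arg ≤ (w - x).arg := by
  have hβ0 : 0 ≤ (w - x).arg := Complex.arg_nonneg_iff.2 (by simpa using hw)
  rcases hw.eq_or_lt with him | him
  · have hwre : w = (w.re : ℂ) := Complex.ext rfl (by simpa using him.symm)
    rcases le_or_gt 0 w.re with h0 | h0
    · have : w.arg = 0 := by rw [hwre]; exact Complex.arg_ofReal_of_nonneg h0
      rwa [this]
    · have : (w - x).arg = Real.pi := by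
        rw [hwre, ← Complex.ofReal_sub]
        exact Complex.arg_ofReal_of_neg (by linarith)
      rw [this]
      exact Complex.arg_le_pi w
  rcases hx.eq_or_lt with rfl | hx
  · simp
  by_contra! hlt
  have hαπ := Complex.arg_le_pi w
  have hs := Real.sin_nonneg_of_nonneg_of_le_pi (x := w.arg - (w - x).arg) (by linarith)
    (by linarith)
  rw [Real.sin_sub] at hs
  have e1 := Complex.norm_mul_cos_arg w
  have e2 := Complex.norm_mul_sin_arg w
  have e3 := Complex.norm_mul_cos_arg (w - x)
  have e4 := Complex.norm_mul_sin_arg (w - x)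
  have key : ‖w‖ * ‖w - x‖ * (Real.sin w.arg * Real.cos (w - x).arg -
      Real.cos w.arg * Real.sin (w - x).arg) = -(x * w.im) := by
    calc _ = (‖w‖ * Real.sin w.arg) * (‖w - x‖ * Real.cos (w - x).arg) -
          (‖w‖ * Real.cos w.arg) * (‖w - x‖ * Real.sin (w - x).arg) := by ring
      _ = _ := by
        rw [e1, e2, e3, e4]
        simp only [Complex.sub_re, Complex.sub_im, Complex.ofReal_re, Complex.ofReal_im]
        ring
  have h1 : 0 ≤ ‖w‖ * ‖w - x‖ * (Real.sin w.arg * Real.cos (w - x).arg -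
      Real.cos w.arg * Real.sin (w - x).arg) := by positivity
  nlinarith [mul_pos hx him]

namespace SCParams

variable {a b c r : ℝ}

/-- Along a ray from `0` the curve `f` moves in directions between `0` and `b * π`: the direction is
`b * arg t + (b - a) * (π - arg (t - 1)) + a * (π - arg (r ^ 2 * t - 1))`, where all the terms are
nonnegative, and `arg (t - 1)` and `arg (r ^ 2 * t - 1)` are at least `arg t`. -/
theorem scArg_add_arg_mem (h : SCParams a b c r) (hc : c = 1 + a) {t : ℂ}
    (ht : t ∈ closedUpperHalfPlane) :
    scArg a b c r t + t.arg ∈ Set.Icc 0 (b * Real.pi) := by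
  have hr := h.hr
  have hr2 : 0 < r ^ 2 := by positivity
  have h1 := Complex.arg_le_arg_sub_ofReal ht zero_le_one
  have h2 : t.arg ≤ ((r : ℂ) ^ 2 * t - 1).arg := by
    have him : 0 ≤ (((r ^ 2 : ℝ) : ℂ) * t).im := by
      rw [Complex.im_ofReal_mul]
      exact mul_nonneg hr2.le ht
    have := Complex.arg_le_arg_sub_ofReal him zero_le_one
    rw [Complex.arg_real_mul _ hr2] at this
    simpa using this
  rw [Complex.ofReal_one] at h1
  have h0 : 0 ≤ t.arg := Complex.arg_nonneg_iff.2 ht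
  have h3 := Complex.arg_le_pi (t - 1)
  have h4 := Complex.arg_le_pi ((r : ℂ) ^ 2 * t - 1)
  have hab : 0 ≤ b - a := by linarith [h.hcb]
  have ha := h.ha
  have hb := h.hb
  subst hc
  rw [scArg]
  constructor
  · nlinarith [mul_nonneg hab (sub_nonneg.2 h3), mul_nonneg ha.le (sub_nonneg.2 h4),
      mul_nonneg hb.le h0]
  · nlinarith [mul_nonneg hab (sub_nonneg.2 h1), mul_nonneg ha.le (sub_nonneg.2 h2)]

/-- The component of `f z` in the direction `α` is an integral of real numbers. -/
theorem re_unitDir_mul_scMap (h : SCParams a b c r) (α : ℝ) (z : ℂ) :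
    (unitDir (-α) * scMap a b c r z).re = scConstReal b c *
      ∫ s in (0 : ℝ)..1, (unitDir (-α) * (scIntegrand a b c r ((s : ℂ) * z) * z)).re := by
  have hint := (h.intervalIntegrable_segment z).const_mul (unitDir (-α))
  have := Complex.reCLM.intervalIntegral_comp_comm hint
  simp only [Complex.reCLM_apply] at this
  rw [this, intervalIntegral.integral_const_mul, scMap, h.scConst_eq, mul_left_comm,
    Complex.re_ofReal_mul]

theorem re_unitDir_mul_integrand {α s : ℝ} (hs : 0 < s) (z : ℂ) :
    (unitDir (-α) * (scIntegrand a b c r ((s : ℂ) * z) * z)).re =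
      scDensity a b c r ((s : ℂ) * z) * ‖z‖ *
        Real.cos (scArg a b c r ((s : ℂ) * z) + ((s : ℂ) * z).arg - α) := by
  have e : unitDir (-α) * (scIntegrand a b c r ((s : ℂ) * z) * z) =
      (scDensity a b c r ((s : ℂ) * z) * ‖z‖ : ℝ) *
        unitDir (scArg a b c r ((s : ℂ) * z) + ((s : ℂ) * z).arg - α) := by
    rw [Complex.arg_real_mul _ hs, scIntegrand_eq,
      show scArg a b c r ((s : ℂ) * z) + z.arg - α = -α + (scArg a b c r ((s : ℂ) * z) + z.arg)
        by ring, ← unitDir_mul, ← unitDir_mul]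
    have hz := Complex.norm_mul_exp_arg_mul_I z
    simp only [unitDir]
    push_cast
    rw [← Complex.ofReal_neg]
    linear_combination -(Complex.exp (((-α : ℝ) : ℂ) * Complex.I) *
      (scDensity a b c r ((s : ℂ) * z) *
        Complex.exp (scArg a b c r ((s : ℂ) * z) * Complex.I))) * hz
  rw [e, Complex.re_ofReal_mul, unitDir_re]

/-- The image of `f` lies in the angle between the directions `0` and `b * π`. -/
theorem re_unitDir_mul_scMap_nonneg (h : SCParams a b c r) (hc : c = 1 + a) {α : ℝ}
    (h0 : α ≤ Real.pi / 2) (h1 : b * Real.pi ≤ α + Real.pi / 2) {z : ℂ}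
    (hz : z ∈ closedUpperHalfPlane) : 0 ≤ (unitDir (-α) * scMap a b c r z).re := by
  rw [h.re_unitDir_mul_scMap α z]
  refine mul_nonneg h.scConstReal_pos.le
    (intervalIntegral.integral_nonneg_of_ae_restrict zero_le_one ?_)
  have hne : ∀ᵐ s : ℝ, s ≠ 0 := by
    have := (Set.countable_singleton (0 : ℝ)).ae_notMem MeasureTheory.volume
    simpa using this
  refine (MeasureTheory.ae_restrict_iff' measurableSet_Icc).2 ?_
  filter_upwards [hne] with s hs hmem
  have hs0 : 0 < s := lt_of_le_of_ne hmem.1 hs.symm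
  rw [re_unitDir_mul_integrand hs0]
  have hm := h.scArg_add_arg_mem hc (ofReal_mul_mem_upper hs0.le hz)
  exact mul_nonneg (mul_nonneg (scDensity_nonneg ..) (norm_nonneg z))
    (Real.cos_nonneg_of_neg_pi_div_two_le_of_le (by linarith [hm.1]) (by linarith [hm.2]))

/-- The image of `f` contains no line, as it lies in the angle between the directions `0` and
`b * π`: a line in the image has to be parallel to both sides of the angle. -/
theorem exists_notMem_image_line (h : SCParams a b c r) (hc : c = 1 + a) (p d : ℂ) (hd : d ≠ 0) :
    ∃ t : ℝ, p + t * d ∉ scMap a b c r '' closedUpperHalfPlane := by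
  by_contra! hcon
  have hπ := Real.pi_pos
  have hb := h.hb
  have hb1 := h.hb1
  have key : ∀ α : ℝ, α ≤ Real.pi / 2 → b * Real.pi ≤ α + Real.pi / 2 →
      (unitDir (-α) * d).re = 0 := by
    intro α h0 h1
    refine eq_zero_of_forall_nonneg_add_mul (A := (unitDir (-α) * p).re) fun t => ?_
    obtain ⟨z, hz, e⟩ := hcon t
    have := h.re_unitDir_mul_scMap_nonneg hc h0 h1 hz
    rw [e, mul_add, mul_left_comm, Complex.add_re, Complex.re_ofReal_mul] at this
    exact this
  have k1 := key (Real.pi / 2) le_rfl (by nlinarith)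
  have k2 := key (b * Real.pi - Real.pi / 2) (by nlinarith) (by linarith)
  rw [Complex.mul_re, unitDir_re, unitDir_im, Real.cos_neg, Real.cos_pi_div_two, Real.sin_neg,
    Real.sin_pi_div_two] at k1
  have him : d.im = 0 := by linarith
  rw [Complex.mul_re, unitDir_re, unitDir_im, him, mul_zero, sub_zero, Real.cos_neg,
    Real.cos_sub_pi_div_two] at k2
  have hre : d.re = 0 := (mul_eq_zero.1 k2).resolve_left (sin_mul_pi_pos hb hb1).ne'
  exact hd (Complex.ext hre him)

/-- For `c = 1 + a` the integrand is not smaller than a multiple of `1 / |t|` at infinity. -/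
theorem le_scDensity (h : SCParams a b c r) (hc : c = 1 + a) {t : ℂ} (ht : 1 ≤ ‖t‖)
    (h1 : t ≠ 1) (h2 : t ≠ 1 / (r : ℂ) ^ 2) : 2 ^ (-b) * ‖t‖⁻¹ ≤ scDensity a b c r t := by
  have hr := h.hr
  have hr1 := h.hr1
  have ht0 : 0 < ‖t‖ := by linarith
  have n1 : ‖1 - t‖ ≤ 2 * ‖t‖ := by
    have := norm_sub_le (1 : ℂ) t
    rw [norm_one] at this
    linarith
  have n2 : ‖1 - (r : ℂ) ^ 2 * t‖ ≤ 2 * ‖t‖ := by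
    have := norm_sub_le (1 : ℂ) ((r : ℂ) ^ 2 * t)
    rw [norm_one, norm_mul, norm_pow, Complex.norm_real, Real.norm_of_nonneg hr.le] at this
    have : r ^ 2 * ‖t‖ ≤ 1 * ‖t‖ := by gcongr; nlinarith
    linarith
  have p1 : 0 < ‖1 - t‖ := norm_pos_iff.2 (sub_ne_zero.2 h1.symm)
  have p2 : 0 < ‖1 - (r : ℂ) ^ 2 * t‖ := norm_pos_iff.2 (one_sub_sq_mul_ne_zero hr h2)
  have b1 := Real.rpow_le_rpow_of_nonpos p1 n1 (show c - b - 1 ≤ 0 by linarith [h.hcb])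
  have b2 := Real.rpow_le_rpow_of_nonpos p2 n2 (show -a ≤ 0 by linarith [h.ha])
  calc 2 ^ (-b) * ‖t‖⁻¹ = ‖t‖ ^ (b - 1) * (2 * ‖t‖) ^ (c - b - 1) * (2 * ‖t‖) ^ (-a) := by
        rw [Real.mul_rpow zero_le_two ht0.le, Real.mul_rpow zero_le_two ht0.le,
          show -b = (c - b - 1) + -a by linarith, Real.rpow_add two_pos,
          ← Real.rpow_neg_one ‖t‖, show (-1 : ℝ) = (b - 1) + (c - b - 1) + -a by linarith,
          Real.rpow_add ht0, Real.rpow_add ht0]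
        ring
    _ ≤ _ := by unfold scDensity; gcongr

/-- The component of `f z` in the direction `b * π / 2` grows at least like `log |z|`: the
directions of motion along the ray differ from it by at most `b * π / 2 < π / 2`, and the speed
with respect to `s = |t| / |z|` is at least a multiple of `1 / s` for `s ≥ 1 / |z|`. -/
theorem log_norm_le_norm_scMap (h : SCParams a b c r) (hc : c = 1 + a) {z : ℂ}
    (hz : z ∈ closedUpperHalfPlane) (hz1 : 1 ≤ ‖z‖) :
    scConstReal b c * (2 ^ (-b) * Real.cos (b * Real.pi / 2)) * Real.log ‖z‖ ≤
      ‖scMap a b c r z‖ := by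
  have hz0 : 0 < ‖z‖ := by linarith
  have hr := h.hr
  have hπ := Real.pi_pos
  have hb := h.hb
  have hb1 := h.hb1
  have hκ : 0 ≤ Real.cos (b * Real.pi / 2) :=
    Real.cos_nonneg_of_neg_pi_div_two_le_of_le (by nlinarith) (by nlinarith)
  set α := b * Real.pi / 2 with hα
  set F : ℝ → ℝ := fun s => (unitDir (-α) * (scIntegrand a b c r ((s : ℂ) * z) * z)).re with hF
  have hFint : IntervalIntegrable F MeasureTheory.volume 0 1 := by
    have hint := (h.intervalIntegrable_segment z).const_mul (unitDir (-α))
    exact ⟨hint.1.re, hint.2.re⟩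
  have hcos : ∀ s : ℝ, 0 < s → Real.cos α ≤
      Real.cos (scArg a b c r ((s : ℂ) * z) + ((s : ℂ) * z).arg - α) := by
    intro s hs
    have hm := h.scArg_add_arg_mem hc (ofReal_mul_mem_upper hs.le hz)
    rw [← Real.cos_abs (_ - α)]
    refine Real.cos_le_cos_of_nonneg_of_le_pi (abs_nonneg _) (by nlinarith) (abs_le.2 ?_)
    constructor <;> linarith [hm.1, hm.2]
  have hm0 : 0 ≤ ‖z‖⁻¹ := by positivity
  have hm1 : ‖z‖⁻¹ ≤ 1 := inv_le_one_of_one_le₀ hz1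
  have hsub : ∀ x ∈ Set.Icc (0 : ℝ) 1, ∀ y ∈ Set.Icc (0 : ℝ) 1,
      IntervalIntegrable F MeasureTheory.volume x y := fun x hx y hy =>
    hFint.mono_set (by rw [Set.uIcc_of_le zero_le_one]; exact Set.uIcc_subset_Icc hx hy)
  have i1 := hsub 0 ⟨le_rfl, zero_le_one⟩ ‖z‖⁻¹ ⟨hm0, hm1⟩
  have i2 := hsub ‖z‖⁻¹ ⟨hm0, hm1⟩ 1 ⟨zero_le_one, le_rfl⟩
  have hne : ∀ x : ℝ, ∀ᵐ s : ℝ, s ≠ x := fun x => by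
    have := (Set.countable_singleton x).ae_notMem MeasureTheory.volume
    simpa using this
  have hpart1 : 0 ≤ ∫ s in (0 : ℝ)..‖z‖⁻¹, F s := by
    refine intervalIntegral.integral_nonneg_of_ae_restrict hm0 ?_
    refine (MeasureTheory.ae_restrict_iff' measurableSet_Icc).2 ?_
    filter_upwards [hne 0] with s hs hmem
    have hs0 : 0 < s := lt_of_le_of_ne hmem.1 hs.symm
    show 0 ≤ F s
    rw [hF]
    simp only
    rw [re_unitDir_mul_integrand hs0]
    exact mul_nonneg (mul_nonneg (scDensity_nonneg ..) hz0.le) (hκ.trans (hcos s hs0))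
  have hpart2 : 2 ^ (-b) * Real.cos α * Real.log ‖z‖ ≤ ∫ s in ‖z‖⁻¹..1, F s := by
    have e : 2 ^ (-b) * Real.cos α * Real.log ‖z‖ =
        ∫ s in ‖z‖⁻¹..1, 2 ^ (-b) * Real.cos α * (1 / s) := by
      rw [intervalIntegral.integral_const_mul, integral_one_div_of_pos (by positivity) one_pos,
        one_div, inv_inv]
    rw [e]
    refine intervalIntegral.integral_mono_ae_restrict hm1 ?_ i2 ?_
    · refine (intervalIntegral.intervalIntegrable_one_div (fun s hs => ?_)
        continuousOn_id).const_mul _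
      rw [Set.uIcc_of_le hm1] at hs
      exact (lt_of_lt_of_le (by positivity) hs.1).ne'
    · refine (MeasureTheory.ae_restrict_iff' measurableSet_Icc).2 ?_
      filter_upwards [hne ‖z‖⁻¹, hne (1 / r ^ 2 * ‖z‖⁻¹)] with s hs1 hs2 hmem
      have hs0 : 0 < s := lt_of_lt_of_le (by positivity) hmem.1
      have hsz : ‖(s : ℂ) * z‖ = s * ‖z‖ := by
        rw [norm_mul, Complex.norm_real, Real.norm_of_nonneg hs0.le]
      have hden := h.le_scDensity hc (t := (s : ℂ) * z)
        (by rw [hsz, ← inv_mul_cancel₀ hz0.ne']; gcongr; exact hmem.1)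
        (fun hh => hs1 (by
          have := congrArg norm hh
          rw [hsz, norm_one] at this
          field_simp
          exact this))
        (fun hh => hs2 (by
          have := congrArg norm hh
          rw [hsz, norm_div, norm_one, norm_pow, Complex.norm_real, Real.norm_of_nonneg hr.le]
            at this
          rw [← this, mul_assoc, mul_inv_cancel₀ hz0.ne', mul_one]))
      show _ ≤ F s
      rw [hF]
      simp only
      rw [re_unitDir_mul_integrand hs0]
      calc 2 ^ (-b) * Real.cos α * (1 / s)
          = 2 ^ (-b) * ‖(s : ℂ) * z‖⁻¹ * ‖z‖ * Real.cos α := by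
            rw [hsz]
            field_simp
        _ ≤ _ := mul_le_mul (mul_le_mul_of_nonneg_right hden hz0.le) (hcos s hs0) hκ
            (mul_nonneg (scDensity_nonneg ..) hz0.le)
  have hre := h.re_unitDir_mul_scMap α z
  have hsum := intervalIntegral.integral_add_adjacent_intervals i1 i2
  have hC := h.scConstReal_pos
  calc _ = scConstReal b c * (2 ^ (-b) * Real.cos α * Real.log ‖z‖) := by ring
    _ ≤ scConstReal b c * ∫ s in (0 : ℝ)..1, F s := by
        gcongr
        rw [← hsum]
        linarith
    _ = (unitDir (-α) * scMap a b c r z).re := hre.symm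
    _ ≤ ‖unitDir (-α) * scMap a b c r z‖ := Complex.re_le_norm _
    _ = ‖scMap a b c r z‖ := by
        rw [norm_mul, unitDir, Complex.norm_exp_ofReal_mul_I, one_mul]

theorem tendsto_scMap_cocompact_cocompact (h : SCParams a b c r) (hc : c = 1 + a) :
    Tendsto (scMap a b c r) (cocompact ℂ ⊓ 𝓟 closedUpperHalfPlane) (cocompact ℂ) := by
  have hnorm : Tendsto (fun z : ℂ => ‖z‖) (cocompact ℂ ⊓ 𝓟 closedUpperHalfPlane) atTop :=
    tendsto_norm_cocompact_atTop.mono_left inf_le_left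
  have hπ := Real.pi_pos
  have hκ : 0 < scConstReal b c * (2 ^ (-b) * Real.cos (b * Real.pi / 2)) := by
    refine mul_pos h.scConstReal_pos (mul_pos (by positivity) ?_)
    have := h.hb
    have := h.hb1
    exact Real.cos_pos_of_mem_Ioo ⟨by nlinarith, by nlinarith⟩
  rw [← Metric.cobounded_eq_cocompact, ← tendsto_norm_atTop_iff_cobounded,
    Metric.cobounded_eq_cocompact]
  refine tendsto_atTop_mono' _ ?_ ((Real.tendsto_log_atTop.comp hnorm).const_mul_atTop hκ)
  filter_upwards [hnorm.eventually_ge_atTop 1,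
      (eventually_principal.2 fun _ hz => hz : ∀ᶠ z in 𝓟 closedUpperHalfPlane,
        z ∈ closedUpperHalfPlane).filter_mono inf_le_right] with z hz1 hz
  exact h.log_norm_le_norm_scMap hc hz hz1

/-! ### The side issuing from `f (1 / r ^ 2)` -/

/-- For `c = 1 + a` the side beyond `1 / r ^ 2` is parallel to the image of the negative axis. -/
theorem tilt_inv_neg (h : SCParams a b c r) (hc : c = 1 + a) {y : ℝ} (hy : 1 / r ^ 2 ≤ y) :
    (unitDir (-(b * Real.pi)) * scMap a b c r y).im < 0 := by
  have hp := h.one_lt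
  rw [h.side_inv le_rfl hy, mul_add, Complex.add_im, im_unitDir_neg_mul,
    show (a + b + 1 - c) * Real.pi - b * Real.pi = 0 by rw [hc]; ring, Real.sin_zero, mul_zero,
    add_zero]
  exact h.tilt_neg (by linarith) le_rfl

/-- For `c < 1 + a` the side beyond `1 / r ^ 2` reaches the line that contains the image of the
negative axis only at its end `w`. -/
theorem tilt_inv_neg_of_tendsto (h : SCParams a b c r) (hc : c < 1 + a) {w : ℂ}
    (hw : Tendsto (scMap a b c r) (cocompact ℂ ⊓ 𝓟 closedUpperHalfPlane) (𝓝 w)) {y : ℝ}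
    (hy : 1 / r ^ 2 ≤ y) :
    (unitDir (-(b * Real.pi)) * scMap a b c r y).im < 0 := by
  obtain ⟨Λ, hΛ, e⟩ := h.side_inv_infty hw hy
  obtain ⟨Λ', -, e'⟩ := h.side_neg_infty hw le_rfl
  rw [Complex.ofReal_zero, scMap_zero, zero_add] at e'
  have t1 := im_unitDir_neg_mul Λ' (b * Real.pi) (b * Real.pi)
  rw [← e', sub_self, Real.sin_zero, mul_zero, e, mul_add, Complex.add_im, im_unitDir_neg_mul,
    show (a + b + 1 - c) * Real.pi - b * Real.pi = (a + 1 - c) * Real.pi by ring] at t1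
  have := mul_pos hΛ (sin_mul_pi_pos (q := a + 1 - c) (by linarith)
    (by linarith [h.ha1, h.hc1]))
  linarith

end SCParams

/-! ### The values at the vertices -/

/-- Euler's integral for real parameters. -/
theorem euler_integral_ofReal {A B D : ℝ} (hB : 0 < B) (hD : 0 < D) {x : ℝ} (hx0 : 0 ≤ x)
    (hx1 : x < 1) :
    ((∫ t in Set.Ioo (0 : ℝ) 1, t ^ (B - 1) * (1 - t) ^ (D - 1) * (1 - x * t) ^ (-A) : ℝ) : ℂ) =
      Complex.betaIntegral B D * ₂F₁ (A : ℂ) (B : ℂ) ((B : ℂ) + D) (x : ℂ) := by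
  rw [← euler_integral (A := A) (B := B) (D := D) (by simpa using hB) (by simpa using hD) hx0 hx1,
    intervalIntegral.integral_of_le zero_le_one, MeasureTheory.integral_Ioc_eq_integral_Ioo,
    ← integral_complex_ofReal]
  refine MeasureTheory.setIntegral_congr_fun measurableSet_Ioo fun t ht => ?_
  have h1 : 0 ≤ 1 - t := by linarith [ht.2]
  have h2 : 0 ≤ 1 - x * t := by nlinarith [ht.1, ht.2]
  simp only [Complex.ofReal_mul, Complex.ofReal_cpow ht.1.le, Complex.ofReal_cpow h1,
    Complex.ofReal_cpow h2]
  push_cast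
  rfl

/-- The integrand on `[1, 1 / r ^ 2]` after the substitution `t = 1 / q`, `q = 1 - κ * s`, with
`κ = 1 - r ^ 2` and `m = 1 - s`. -/
theorem rpow_identity_one_inv {a b c κ s m q : ℝ} (hκ : 0 < κ) (hs : 0 < s) (hm : 0 < m)
    (hq : 0 < q) :
    κ / q ^ 2 * ((1 / q) ^ (b - 1) * (κ * s / q) ^ (c - b - 1) * (κ * m / q) ^ (-a)) =
      κ ^ (c - a - b) * (s ^ (c - b - 1) * m ^ (1 - a - 1) * q ^ (-(c - a))) := by
  obtain ⟨κ, rfl⟩ : ∃ k, κ = Real.exp k := ⟨_, (Real.exp_log hκ).symm⟩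
  obtain ⟨s, rfl⟩ : ∃ k, s = Real.exp k := ⟨_, (Real.exp_log hs).symm⟩
  obtain ⟨m, rfl⟩ : ∃ k, m = Real.exp k := ⟨_, (Real.exp_log hm).symm⟩
  obtain ⟨q, rfl⟩ : ∃ k, q = Real.exp k := ⟨_, (Real.exp_log hq).symm⟩
  rw [sq, one_div, ← Real.exp_neg]
  simp only [← Real.exp_add, ← Real.exp_sub, ← Real.exp_mul]
  congr 1
  ring

/-- The integrand on `[1 / r ^ 2, ∞)` after the substitution `t = q / (ρ * m)`,
`q = 1 - r ^ 2 * s`, with `κ = 1 - r ^ 2`, `m = 1 - s` and `ρ = r ^ 2`. -/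
theorem rpow_identity_inv_infty {a b c κ s m q ρ : ℝ} (hκ : 0 < κ) (hs : 0 < s) (hm : 0 < m)
    (hq : 0 < q) (hρ : 0 < ρ) :
    κ / (ρ * m ^ 2) *
        ((q / (ρ * m)) ^ (b - 1) * (κ / (ρ * m)) ^ (c - b - 1) * (κ * s / m) ^ (-a)) =
      ρ ^ (1 - c) * κ ^ (c - a - b) *
        (s ^ (1 - a - 1) * m ^ (a + 1 - c - 1) * q ^ (-(1 - b))) := by
  obtain ⟨κ, rfl⟩ : ∃ k, κ = Real.exp k := ⟨_, (Real.exp_log hκ).symm⟩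
  obtain ⟨s, rfl⟩ : ∃ k, s = Real.exp k := ⟨_, (Real.exp_log hs).symm⟩
  obtain ⟨m, rfl⟩ : ∃ k, m = Real.exp k := ⟨_, (Real.exp_log hm).symm⟩
  obtain ⟨q, rfl⟩ : ∃ k, q = Real.exp k := ⟨_, (Real.exp_log hq).symm⟩
  obtain ⟨ρ, rfl⟩ : ∃ k, ρ = Real.exp k := ⟨_, (Real.exp_log hρ).symm⟩
  rw [sq]
  simp only [← Real.exp_add, ← Real.exp_sub, ← Real.exp_mul]
  congr 1
  ring

theorem scDensity_ofReal (a b c r t : ℝ) :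
    scDensity a b c r t = |t| ^ (b - 1) * |1 - t| ^ (c - b - 1) * |1 - r ^ 2 * t| ^ (-a) := by
  have e1 : (1 : ℂ) - t = ((1 - t : ℝ) : ℂ) := by push_cast; rfl
  have e2 : (1 : ℂ) - (r : ℂ) ^ 2 * t = ((1 - r ^ 2 * t : ℝ) : ℂ) := by push_cast; rfl
  rw [scDensity, e1, e2, Complex.norm_real, Complex.norm_real, Complex.norm_real,
    Real.norm_eq_abs, Real.norm_eq_abs, Real.norm_eq_abs]

namespace SCParams

variable {a b c r : ℝ}

theorem integral_density_zero_one (r : ℝ) :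
    ∫ t in (0 : ℝ)..1, scDensity a b c r t = ∫ t in Set.Ioo (0 : ℝ) 1,
      t ^ (b - 1) * (1 - t) ^ (c - b - 1) * |1 - r ^ 2 * t| ^ (-a) := by
  rw [intervalIntegral.integral_of_le zero_le_one, MeasureTheory.integral_Ioc_eq_integral_Ioo]
  refine MeasureTheory.setIntegral_congr_fun measurableSet_Ioo fun t ht => ?_
  rw [scDensity_ofReal, abs_of_pos ht.1, abs_of_pos (by linarith [ht.2] : 0 < 1 - t)]

/-- The substitution `t = 1 / (1 - (1 - r ^ 2) * s)`. -/
theorem integral_density_one_inv (h : SCParams a b c r) :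
    ∫ t in (1 : ℝ)..(1 / r ^ 2), scDensity a b c r t =
      (1 - r ^ 2) ^ (c - a - b) * ∫ s in Set.Ioo (0 : ℝ) 1,
        s ^ (c - b - 1) * (1 - s) ^ (1 - a - 1) * (1 - (1 - r ^ 2) * s) ^ (-(c - a)) := by
  have hr := h.hr
  have hr2 : 0 < r ^ 2 := by positivity
  have hκ : 0 < 1 - r ^ 2 := by nlinarith [h.hr1]
  have hp := h.one_lt
  have hq : ∀ s ∈ Set.Ioo (0 : ℝ) 1, 0 < 1 - (1 - r ^ 2) * s := fun s hs => by
    nlinarith [hs.1, hs.2]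
  have himg : (fun s : ℝ => 1 / (1 - (1 - r ^ 2) * s)) '' Set.Ioo 0 1 = Set.Ioo 1 (1 / r ^ 2) := by
    ext t
    constructor
    · rintro ⟨s, hs, rfl⟩
      have := hq s hs
      refine ⟨?_, ?_⟩
      · simp only
        rw [lt_div_iff₀ this]
        nlinarith [hs.1]
      · exact one_div_lt_one_div_of_lt hr2 (by nlinarith [hs.2])
    · rintro ⟨h1, h2⟩
      have ht : 0 < t := by linarith
      have h2' := h.sq_mul_lt_one.2 h2
      refine ⟨(1 - 1 / t) / (1 - r ^ 2), ⟨?_, ?_⟩, ?_⟩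
      · have : 1 / t < 1 := by rw [div_lt_one ht]; exact h1
        exact div_pos (by linarith) hκ
      · rw [div_lt_one hκ]
        have : r ^ 2 < 1 / t := by rwa [lt_div_iff₀ ht]
        linarith
      · simp only
        rw [mul_div_cancel₀ _ hκ.ne', sub_sub_cancel, one_div_one_div]
  rw [intervalIntegral.integral_of_le hp.le, MeasureTheory.integral_Ioc_eq_integral_Ioo, ← himg,
    MeasureTheory.integral_image_eq_integral_abs_deriv_smul measurableSet_Ioo
      (f' := fun s => (1 - r ^ 2) / (1 - (1 - r ^ 2) * s) ^ 2), ← MeasureTheory.integral_const_mul]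
  · refine MeasureTheory.setIntegral_congr_fun measurableSet_Ioo fun s hs => ?_
    have hqs := hq s hs
    have hm : 0 < 1 - s := by linarith [hs.2]
    rw [← rpow_identity_one_inv hκ hs.1 hm hqs, scDensity_ofReal, smul_eq_mul,
      abs_of_pos (by positivity), abs_of_pos (by positivity : 0 < 1 / (1 - (1 - r ^ 2) * s)),
      show 1 - 1 / (1 - (1 - r ^ 2) * s) = -((1 - r ^ 2) * s / (1 - (1 - r ^ 2) * s)) by
        field_simp; ring,
      show 1 - r ^ 2 * (1 / (1 - (1 - r ^ 2) * s)) =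
        (1 - r ^ 2) * (1 - s) / (1 - (1 - r ^ 2) * s) by field_simp; ring,
      abs_neg, abs_of_pos (div_pos (mul_pos hκ hs.1) hqs),
      abs_of_pos (div_pos (mul_pos hκ hm) hqs)]
  · intro s hs
    have hd : HasDerivAt (fun s : ℝ => 1 - (1 - r ^ 2) * s) (-(1 - r ^ 2)) s := by
      simpa only [mul_one, id] using ((hasDerivAt_id s).const_mul (1 - r ^ 2)).const_sub 1
    simpa only [one_div, neg_neg] using (hd.fun_inv (hq s hs).ne').hasDerivWithinAt
  · intro x hx y hy hxy
    have : 1 - (1 - r ^ 2) * x = 1 - (1 - r ^ 2) * y := by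
      simpa using hxy
    exact mul_left_cancel₀ hκ.ne' (by linarith)

/-- The substitution `t = (1 - r ^ 2 * s) / (r ^ 2 * (1 - s))`. -/
theorem integral_density_inv_infty (h : SCParams a b c r) :
    ∫ t in Set.Ioi (1 / r ^ 2 : ℝ), scDensity a b c r t =
      (r ^ 2) ^ (1 - c) * (1 - r ^ 2) ^ (c - a - b) * ∫ s in Set.Ioo (0 : ℝ) 1,
        s ^ (1 - a - 1) * (1 - s) ^ (a + 1 - c - 1) * (1 - r ^ 2 * s) ^ (-(1 - b)) := by
  have hr := h.hr
  have hr2 : 0 < r ^ 2 := by positivity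
  have hκ : 0 < 1 - r ^ 2 := by nlinarith [h.hr1]
  have hp := h.one_lt
  have hq : ∀ s ∈ Set.Ioo (0 : ℝ) 1, 0 < 1 - r ^ 2 * s := fun s hs => by
    nlinarith [hs.1, hs.2]
  have himg : (fun s : ℝ => (1 - r ^ 2 * s) / (r ^ 2 * (1 - s))) '' Set.Ioo 0 1 =
      Set.Ioi (1 / r ^ 2) := by
    ext t
    constructor
    · rintro ⟨s, hs, rfl⟩
      have hm : 0 < 1 - s := by linarith [hs.2]
      show 1 / r ^ 2 < _
      rw [div_lt_div_iff₀ hr2 (by positivity)]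
      nlinarith [hs.1, mul_pos hr2 (mul_pos hκ hs.1)]
    · intro ht
      have h1 := h.one_lt_sq_mul.2 ht
      have ht1 : 0 < t - 1 := by
        have : 1 / r ^ 2 < t := ht
        linarith
      refine ⟨(r ^ 2 * t - 1) / (r ^ 2 * (t - 1)), ⟨div_pos (by linarith) (by positivity), ?_⟩, ?_⟩
      · rw [div_lt_one (by positivity)]
        linarith
      · have e1 : 1 - (r ^ 2 * t - 1) / (r ^ 2 * (t - 1)) = (1 - r ^ 2) / (r ^ 2 * (t - 1)) := by
          field_simp
          ring
        simp only
        rw [e1, div_eq_iff (by positivity)]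
        field_simp
        ring
  rw [← himg, MeasureTheory.integral_image_eq_integral_abs_deriv_smul measurableSet_Ioo
      (f' := fun s => (1 - r ^ 2) / (r ^ 2 * (1 - s) ^ 2)), ← MeasureTheory.integral_const_mul]
  · refine MeasureTheory.setIntegral_congr_fun measurableSet_Ioo fun s hs => ?_
    have hqs := hq s hs
    have hm : 0 < 1 - s := by linarith [hs.2]
    rw [← rpow_identity_inv_infty hκ hs.1 hm hqs hr2, scDensity_ofReal, smul_eq_mul,
      abs_of_pos (by positivity),
      abs_of_pos (by positivity : 0 < (1 - r ^ 2 * s) / (r ^ 2 * (1 - s))),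
      show 1 - (1 - r ^ 2 * s) / (r ^ 2 * (1 - s)) = -((1 - r ^ 2) / (r ^ 2 * (1 - s))) by
        field_simp; ring,
      show 1 - r ^ 2 * ((1 - r ^ 2 * s) / (r ^ 2 * (1 - s))) =
        -((1 - r ^ 2) * s / (1 - s)) by field_simp; ring,
      abs_neg, abs_neg, abs_of_pos (by positivity), abs_of_pos (div_pos (mul_pos hκ hs.1) hm)]
  · intro s hs
    have hm : 0 < 1 - s := by linarith [hs.2]
    have h1 : HasDerivAt (fun s : ℝ => 1 - r ^ 2 * s) (-r ^ 2) s := by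
      simpa using ((hasDerivAt_id s).const_mul (r ^ 2)).const_sub 1
    have h2 : HasDerivAt (fun s : ℝ => r ^ 2 * (1 - s)) (-r ^ 2) s := by
      simpa using ((hasDerivAt_id s).const_sub 1).const_mul (r ^ 2)
    refine (h1.div h2 (by positivity)).hasDerivWithinAt.congr_deriv ?_
    field_simp
    ring
  · intro x hx y hy hxy
    have hx1 : 0 < 1 - x := by linarith [hx.2]
    have hy1 : 0 < 1 - y := by linarith [hy.2]
    simp only at hxy
    rw [div_eq_div_iff (by positivity) (by positivity)] at hxy
    have : r ^ 2 * (1 - r ^ 2) * (x - y) = 0 := by linear_combination hxy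
    have := (mul_eq_zero.1 this).resolve_left (by positivity)
    linarith

theorem scMap_one (h : SCParams a b c r) :
    scMap a b c r 1 = ₂F₁ (a : ℂ) (b : ℂ) (c : ℂ) ((r : ℂ) ^ 2) := by
  have hr := h.hr
  have hr1 : r ^ 2 < 1 := by nlinarith [h.hr1]
  have hcb : 0 < c - b := by linarith [h.hc1, h.hb1]
  have e := h.side_zero_one le_rfl zero_le_one le_rfl
  rw [Complex.ofReal_zero, scMap_zero, zero_add, unitDir_zero, mul_one, Complex.ofReal_one,
    scLength, integral_density_zero_one] at e
  have eu := euler_integral_ofReal (A := a) h.hb hcb (sq_nonneg r) hr1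
  have e2 : (∫ t in Set.Ioo (0 : ℝ) 1, t ^ (b - 1) * (1 - t) ^ (c - b - 1) *
      |1 - r ^ 2 * t| ^ (-a)) = ∫ t in Set.Ioo (0 : ℝ) 1, t ^ (b - 1) * (1 - t) ^ (c - b - 1) *
      (1 - r ^ 2 * t) ^ (-a) := by
    refine MeasureTheory.setIntegral_congr_fun measurableSet_Ioo fun t ht => ?_
    rw [abs_of_pos (by nlinarith [ht.1, ht.2] : 0 < 1 - r ^ 2 * t)]
  have hne := Complex.ofReal_ne_zero.2 h.scConstReal_pos.ne'
  rw [← h.scConst_eq, scConst] at hne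
  rw [e, Complex.ofReal_mul, e2, eu, ← h.scConst_eq, scConst]
  push_cast
  rw [← mul_assoc, one_div_mul_cancel (by simpa using hne), one_mul]
  congr 1
  ring

theorem scMap_inv (h : SCParams a b c r) {r' : ℝ} (hr' : r' = Real.sqrt (1 - r ^ 2)) :
    scMap a b c r (1 / (r : ℂ) ^ 2) = scMap a b c r 1 +
      Complex.betaIntegral ((c : ℂ) - b) (1 - (a : ℂ)) / Complex.betaIntegral b ((c : ℂ) - b) *
        Complex.exp (((b : ℂ) + 1 - c) * Complex.I * Real.pi) *
        ((r' ^ (2 * (c - a - b)) : ℝ) : ℂ) *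
        ₂F₁ ((c : ℂ) - a) ((c : ℂ) - b) ((c : ℂ) + 1 - a - b) ((r' : ℂ) ^ 2) := by
  have hr := h.hr
  have hr2 : 0 < r ^ 2 := by positivity
  have hκ : 0 < 1 - r ^ 2 := by nlinarith [h.hr1]
  have hcb : 0 < c - b := by linarith [h.hc1, h.hb1]
  have ha1 : 0 < 1 - a := by linarith [h.ha1]
  have hsq : r' ^ 2 = 1 - r ^ 2 := by rw [hr', Real.sq_sqrt hκ.le]
  have hr'0 : 0 ≤ r' := hr' ▸ Real.sqrt_nonneg _
  have e := h.side_one_inv le_rfl h.one_lt.le le_rfl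
  have eu := euler_integral_ofReal (A := c - a) hcb ha1 hκ.le (by linarith : 1 - r ^ 2 < 1)
  have ecast : ((1 / r ^ 2 : ℝ) : ℂ) = 1 / (r : ℂ) ^ 2 := by push_cast; rfl
  rw [ecast, Complex.ofReal_one, scLength, integral_density_one_inv h, Complex.ofReal_mul,
    Complex.ofReal_mul, eu, ← h.scConst_eq, scConst, unitDir, ← hsq, ← Real.rpow_natCast r',
    ← Real.rpow_mul hr'0] at e
  rw [e]
  push_cast
  rw [show (b + 1 - c : ℂ) * Real.pi * Complex.I = (b + 1 - c) * Complex.I * Real.pi by ring,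
    show (c : ℂ) - b + (1 - a) = c + 1 - a - b by ring]
  norm_cast
  ring

/-- The difference of the last two vertices. -/
theorem vertex_infty (h : SCParams a b c r) (hc : c < 1 + a) {r' : ℝ}
    (hr' : r' = Real.sqrt (1 - r ^ 2)) :
    scConst b c * ∫ t in Set.Ioi (1 / r ^ 2), scIntegrand a b c r (t : ℝ) =
      Complex.betaIntegral (1 - (a : ℂ)) ((a : ℂ) + 1 - c) /
          Complex.betaIntegral b ((c : ℂ) - b) *
        Complex.exp (((a : ℂ) + b + 1 - c) * Complex.I * Real.pi) *
        ((r ^ (2 * (1 - c)) : ℝ) : ℂ) * ((r' ^ (2 * (c - a - b)) : ℝ) : ℂ) *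
        ₂F₁ (1 - (b : ℂ)) (1 - (a : ℂ)) (2 - (c : ℂ)) ((r : ℂ) ^ 2) := by
  have hr := h.hr
  have hr2 : 0 < r ^ 2 := by positivity
  have hr1 : r ^ 2 < 1 := by nlinarith [h.hr1]
  have hκ : 0 < 1 - r ^ 2 := by linarith
  have ha1 : 0 < 1 - a := by linarith [h.ha1]
  have hsq : r' ^ 2 = 1 - r ^ 2 := by rw [hr', Real.sq_sqrt hκ.le]
  have hr'0 : 0 ≤ r' := hr' ▸ Real.sqrt_nonneg _
  have hp := h.one_lt
  have e1 : ∫ t in Set.Ioi (1 / r ^ 2), scIntegrand a b c r (t : ℝ) =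
      ((∫ t in Set.Ioi (1 / r ^ 2), scDensity a b c r (t : ℝ) : ℝ) : ℂ) *
        unitDir ((a + b + 1 - c) * Real.pi) := by
    rw [← integral_complex_ofReal, ← MeasureTheory.integral_mul_const]
    refine MeasureTheory.setIntegral_congr_fun measurableSet_Ioi fun t ht => ?_
    have ht' : 1 / r ^ 2 < t := ht
    rw [scIntegrand_eq, unitDir, scArg, Complex.arg_ofReal_of_nonneg (by linarith),
      arg_ofReal_sub_one_of_gt (by linarith), h.arg_sq_mul_of_gt ht']
    congr 4
    ring
  have eu := euler_integral_ofReal (A := 1 - b) ha1 (by linarith : 0 < a + 1 - c) hr2.le hr1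
  rw [e1, integral_density_inv_infty h, Complex.ofReal_mul, Complex.ofReal_mul, eu, scConst,
    unitDir, ← hsq, ← Real.rpow_natCast r', ← Real.rpow_mul hr'0, ← Real.rpow_natCast r,
    ← Real.rpow_mul hr.le]
  push_cast
  rw [show (a + b + 1 - c : ℂ) * Real.pi * Complex.I = (a + b + 1 - c) * Complex.I * Real.pi by
    ring, show (1 : ℂ) - a + (a + 1 - c) = 2 - c by ring, Real.rpow_two, Complex.ofReal_pow]
  ring

/-! ### Local injectivity -/

theorem hasStrictDerivAt_scMap (h : SCParams a b c r) {z : ℂ} (hz : 0 < z.im) :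
    HasStrictDerivAt (scMap a b c r) (scConst b c * scIntegrand a b c r z) z := by
  have hd : DifferentiableOn ℂ (scMap a b c r) {z | 0 < z.im} := fun w hw =>
    (h.hasDerivAt_scMap hw).differentiableAt.differentiableWithinAt
  have := (hd.analyticAt (upper_mem_nhds hz)).hasStrictDerivAt
  rwa [(h.hasDerivAt_scMap hz).deriv] at this

/-- The derivative of `f` has a nonzero limit `d` at the boundary point `1 / 2`. So near this point
`f z - d * z` is Lipschitz with a constant less than `|d|`, and `f` is injective. -/
theorem injOn_near_half (h : SCParams a b c r) :
    ∃ V ∈ 𝓝 ((1 / 2 : ℝ) : ℂ), Set.InjOn (scMap a b c r) (V ∩ {z | 0 < z.im}) := by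
  have hp := h.one_lt
  have hr := h.hr
  set x₀ : ℂ := ((1 / 2 : ℝ) : ℂ) with hx₀
  have e0 : x₀ ≠ 0 := by rw [hx₀]; norm_num
  have e1 : x₀ ≠ 1 := by rw [hx₀]; norm_num
  have e2 : x₀ ≠ 1 / (r : ℂ) ^ 2 := by
    rw [hx₀]
    have : (1 / 2 : ℝ) ≠ 1 / r ^ 2 := by linarith
    exact_mod_cast this
  set d := scConst b c * scIntegrand a b c r x₀ with hd
  have hd0 : 0 < ‖d‖ := by
    rw [hd, norm_mul, norm_scIntegrand, h.scConst_eq, Complex.norm_real]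
    exact mul_pos (norm_pos_iff.2 h.scConstReal_pos.ne') (scDensity_pos hr e0 e1 e2)
  have hcont : ContinuousWithinAt (fun z => scConst b c * scIntegrand a b c r z)
      (closedUpperHalfPlane \ {0, 1, 1 / (r : ℂ) ^ 2}) x₀ := by
    refine (continuousOn_scIntegrand hr x₀ ⟨?_, ?_⟩).const_mul _
    · simp [closedUpperHalfPlane, hx₀]
    · simp only [Set.mem_insert_iff, Set.mem_singleton_iff, not_or]
      exact ⟨e0, e1, e2⟩
  obtain ⟨ε, hε, hball⟩ := Metric.continuousWithinAt_iff.1 hcont (‖d‖ / 2) (by positivity)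
  refine ⟨Metric.ball x₀ ε, Metric.ball_mem_nhds _ hε, fun z hz w hw hzw => ?_⟩
  have hconv : Convex ℝ (Metric.ball x₀ ε ∩ {z | 0 < z.im}) :=
    (convex_ball _ _).inter (convex_halfSpace_im_gt 0)
  have := hconv.norm_image_sub_le_of_norm_hasDerivWithin_le (𝕜 := ℂ) (C := ‖d‖ / 2)
    (f := fun z => scMap a b c r z - d * z)
    (f' := fun z => scConst b c * scIntegrand a b c r z - d) (fun x hx => by
      have := (h.hasDerivAt_scMap hx.2).sub ((hasDerivAt_id x).const_mul d)
      simp only [mul_one] at this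
      exact this.hasDerivWithinAt) (fun x hx => by
      obtain ⟨n0, n1, n2⟩ := ne_singular_of_im_pos (r := r) hx.2
      have := hball (x := x) ⟨le_of_lt (α := ℝ) hx.2, by
        simp only [Set.mem_insert_iff, Set.mem_singleton_iff, not_or]
        exact ⟨n0, n1, n2⟩⟩ hx.1
      rw [dist_eq_norm] at this
      exact this.le) hz hw
  rw [hzw, show scMap a b c r w - d * w - (scMap a b c r w - d * z) = d * (z - w) by ring, norm_mul,
    norm_sub_rev w z] at this
  by_contra hne
  have hpos : 0 < ‖z - w‖ := norm_pos_iff.2 (sub_ne_zero.2 hne)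
  nlinarith [mul_pos hd0 hpos]

/-! ### The bounded quadrilateral -/

section Bounded

variable {w : ℂ}

/-- The value at infinity is not taken on the real axis. -/
theorem ne_of_tendsto_real (h : SCParams a b c r) (hc : c < 1 + a)
    (hw : Tendsto (scMap a b c r) (cocompact ℂ ⊓ 𝓟 closedUpperHalfPlane) (𝓝 w)) (x : ℝ) :
    scMap a b c r x ≠ w := by
  intro e
  rcases le_or_gt x 0 with hx | hx
  · obtain ⟨Λ, hΛ, e'⟩ := h.side_neg_infty hw hx
    exact add_mul_unitDir_ne hΛ (e'.symm.trans e.symm)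
  · obtain ⟨Λ, -, e'⟩ := h.side_neg_infty hw le_rfl
    rw [Complex.ofReal_zero, scMap_zero, zero_add] at e'
    have t := im_unitDir_neg_mul Λ (b * Real.pi) (b * Real.pi)
    rw [← e', sub_self, Real.sin_zero, mul_zero, ← e] at t
    rcases le_total x (1 / r ^ 2) with hxp | hxp
    · exact (h.tilt_neg hx hxp).ne t
    · exact (h.tilt_inv_neg_of_tendsto hc hw hxp).ne t

/-- The image of the real axis together with the point at infinity is the boundary of a convex
quadrilateral. -/
theorem isConvexQuadrilateral (h : SCParams a b c r) (hc : c < 1 + a)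
    (hw : Tendsto (scMap a b c r) (cocompact ℂ ⊓ 𝓟 closedUpperHalfPlane) (𝓝 w)) :
    IsConvexQuadrilateral (convexHull ℝ (Set.range
        ![scMap a b c r 0, scMap a b c r 1, scMap a b c r (1 / (r : ℂ) ^ 2), w]))
      ![scMap a b c r 0, scMap a b c r 1, scMap a b c r (1 / (r : ℂ) ^ 2), w] ∧
    EuclideanGeometry.angle w (scMap a b c r 0) (scMap a b c r 1) = b * Real.pi ∧
    EuclideanGeometry.angle (scMap a b c r 1) (scMap a b c r (1 / (r : ℂ) ^ 2)) w =
      (1 - a) * Real.pi ∧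
    EuclideanGeometry.angle (scMap a b c r (1 / (r : ℂ) ^ 2)) w (scMap a b c r 0) =
      (a + 1 - c) * Real.pi := by
  have hp := h.one_lt
  have hπ := Real.pi_pos
  have := h.ha; have := h.ha1; have := h.hb; have := h.hb1; have := h.hab; have := h.hc1
  have := h.hcb
  have s0 := h.side_zero_one le_rfl zero_le_one le_rfl
  have s1 := h.side_one_inv le_rfl hp.le le_rfl
  obtain ⟨A₂, hA₂, s2⟩ := h.side_inv_infty hw le_rfl
  obtain ⟨A₃, hA₃, s3⟩ := h.side_neg_infty hw le_rfl
  have hA₀ := h.scLength_pos zero_lt_one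
  have hA₁ := h.scLength_pos hp
  rw [coe_inv] at s1 s2
  rw [Complex.ofReal_zero] at s0 s3
  rw [Complex.ofReal_one] at s0 s1
  set A₀ := scLength a b c r 0 1
  set A₁ := scLength a b c r 1 (1 / r ^ 2)
  have d0 : scMap a b c r 1 - scMap a b c r 0 = A₀ * unitDir 0 := by rw [s0]; ring
  have d1 : scMap a b c r (1 / (r : ℂ) ^ 2) - scMap a b c r 1 =
    A₁ * unitDir ((b + 1 - c) * Real.pi) := by rw [s1]; ring
  have d1' : scMap a b c r 1 - scMap a b c r (1 / (r : ℂ) ^ 2) =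
    A₁ * unitDir ((b + 1 - c) * Real.pi + Real.pi) := by rw [s1, unitDir_add_pi]; ring
  have d2 : w - scMap a b c r (1 / (r : ℂ) ^ 2) =
    A₂ * unitDir ((a + b + 1 - c) * Real.pi) := by rw [s2]; ring
  have d2' : scMap a b c r (1 / (r : ℂ) ^ 2) - w =
    A₂ * unitDir ((a + b + 1 - c) * Real.pi + Real.pi) := by rw [s2, unitDir_add_pi]; ring
  have d3 : w - scMap a b c r 0 = A₃ * unitDir (b * Real.pi) := by rw [s3]; ring
  have d3' : scMap a b c r 0 - w = A₃ * unitDir (b * Real.pi + Real.pi) := by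
    rw [s3, unitDir_add_pi]; ring
  refine ⟨isConvexQuadrilateral_of_planeCross ?_ ?_ ?_ ?_, ?_, ?_, ?_⟩
  · show 0 < planeCross (scMap a b c r 0 - w) (scMap a b c r 1 - scMap a b c r 0)
    rw [d3', d0, planeCross_unitDir, zero_sub, Real.sin_neg, Real.sin_add_pi, neg_neg]
    exact mul_pos (mul_pos hA₃ hA₀) (sin_mul_pi_pos h.hb h.hb1)
  · show 0 ≤ planeCross (scMap a b c r 1 - scMap a b c r 0)
      (scMap a b c r (1 / (r : ℂ) ^ 2) - scMap a b c r 1)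
    rw [d0, d1, planeCross_unitDir, sub_zero]
    exact mul_nonneg (mul_pos hA₀ hA₁).le (sin_mul_pi_nonneg (by linarith) (by linarith))
  · show 0 < planeCross (scMap a b c r (1 / (r : ℂ) ^ 2) - scMap a b c r 1)
      (w - scMap a b c r (1 / (r : ℂ) ^ 2))
    rw [d1, d2, planeCross_unitDir, ← sub_mul]
    exact mul_pos (mul_pos hA₁ hA₂) (sin_mul_pi_pos (by linarith) (by linarith))
  · show 0 < planeCross (w - scMap a b c r (1 / (r : ℂ) ^ 2)) (scMap a b c r 0 - w)
    rw [d2, d3', planeCross_unitDir, show b * Real.pi + Real.pi - (a + b + 1 - c) * Real.pi =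
      (c - a) * Real.pi by ring]
    exact mul_pos (mul_pos hA₂ hA₃) (sin_mul_pi_pos (by linarith) (by linarith))
  · rw [angle_unitDir hA₃ hA₀ d3 d0 (by positivity) (by nlinarith), sub_zero]
  · rw [angle_unitDir hA₁ hA₂ d1' d2 (by nlinarith) (by nlinarith)]
    ring
  · rw [angle_unitDir hA₂ hA₃ d2' d3' (by nlinarith) (by nlinarith)]
    ring

theorem boundaryMap_bounded (h : SCParams a b c r) (hc : c < 1 + a)
    (hw : Tendsto (scMap a b c r) (cocompact ℂ ⊓ 𝓟 closedUpperHalfPlane) (𝓝 w)) :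
    BoundaryMap (scMap a b c r) (𝓝 w) {w} (convexHull ℝ (Set.range
        ![scMap a b c r 0, scMap a b c r 1, scMap a b c r (1 / (r : ℂ) ^ 2), w])) := by
  have hQ := (h.isConvexQuadrilateral hc hw).1
  have hside : ∀ k : Fin 4, ∀ p ∈ segment ℝ
      (![scMap a b c r 0, scMap a b c r 1, scMap a b c r (1 / (r : ℂ) ^ 2), w] k)
      (![scMap a b c r 0, scMap a b c r 1, scMap a b c r (1 / (r : ℂ) ^ 2), w] (k + 1)),
      p ∈ frontier (convexHull ℝ (Set.range
        ![scMap a b c r 0, scMap a b c r 1, scMap a b c r (1 / (r : ℂ) ^ 2), w])) := by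
    intro k p hp
    rw [hQ.frontier_eq]
    exact Set.mem_iUnion.2 ⟨k, hp⟩
  have hp := h.one_lt
  refine ⟨h.continuousOn_scMap, fun z hz => ⟨_, h.scConst_mul_ne_zero hz,
    h.hasStrictDerivAt_scMap hz⟩, hw, fun p hpw => disjoint_nhds_nhds.2 fun e => hpw e.symm,
    isClosed_singleton, hQ.isClosed_and_convex.1, hQ.isClosed_and_convex.2, hQ.interior_nonempty,
    fun z hz => ?_, ?_, fun p d hd => exists_notMem_line_of_tendsto h.continuousOn_scMap hw p d hd⟩
  · rw [ofReal_re_eq hz]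
    set x := z.re
    rcases le_total x 0 with h0 | h0
    · obtain ⟨Λ, hΛ, e⟩ := h.side_neg_infty hw h0
      have e' := h.side_neg h0 le_rfl
      rw [Complex.ofReal_zero] at e'
      refine hside 3 _ ?_
      rw [segment_symm]
      exact mem_segment_of_add (h.scLength_nonneg h0) hΛ.le e' e
    rcases le_total x 1 with h1 | h1
    · have e := h.side_zero_one le_rfl h0 h1
      have e' := h.side_zero_one h0 h1 le_rfl
      rw [Complex.ofReal_zero] at e
      rw [Complex.ofReal_one] at e'
      exact hside 0 _ (mem_segment_of_add (h.scLength_nonneg h0) (h.scLength_nonneg h1) e e')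
    rcases le_total x (1 / r ^ 2) with h2 | h2
    · have e := h.side_one_inv le_rfl h1 h2
      have e' := h.side_one_inv h1 h2 le_rfl
      rw [Complex.ofReal_one] at e
      rw [coe_inv] at e'
      exact hside 1 _ (mem_segment_of_add (h.scLength_nonneg h1) (h.scLength_nonneg h2) e e')
    · obtain ⟨Λ, hΛ, e'⟩ := h.side_inv_infty hw h2
      have e := h.side_inv le_rfl h2
      rw [coe_inv] at e
      exact hside 2 _ (mem_segment_of_add (h.scLength_nonneg h2) hΛ.le e e')
  · rintro _ rfl
    exact hside 3 _ (left_mem_segment ℝ _ _)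

theorem injOn_bounded (h : SCParams a b c r) (hc : c < 1 + a)
    (hw : Tendsto (scMap a b c r) (cocompact ℂ ⊓ 𝓟 closedUpperHalfPlane) (𝓝 w)) :
    Set.InjOn (scMap a b c r) closedUpperHalfPlane := by
  have hB := h.boundaryMap_bounded hc hw
  have hR := h.injOn_real fun y hy => h.tilt_inv_neg_of_tendsto hc hw hy.le
  exact hB.injOn_closed (hB.injOn_interior (Complex.ofReal_im (1 / 2))
    (h.ne_of_tendsto_real hc hw (1 / 2))
    (fun z hz e => hR hz (Complex.ofReal_im (1 / 2)) e) h.injOn_near_half) hR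

theorem ne_of_tendsto (h : SCParams a b c r) (hc : c < 1 + a)
    (hw : Tendsto (scMap a b c r) (cocompact ℂ ⊓ 𝓟 closedUpperHalfPlane) (𝓝 w)) {z : ℂ}
    (hz : z ∈ closedUpperHalfPlane) : scMap a b c r z ≠ w := by
  have hB := h.boundaryMap_bounded hc hw
  rcases closedUpperHalfPlane_cases hz with hz | hz
  · intro e
    exact (hB.E_subset (Set.mem_singleton w)).2 (e ▸ hB.mem_interior hz)
  · rw [ofReal_re_eq hz]
    exact h.ne_of_tendsto_real hc hw _

end Bounded

/-- The angle at `f 1`. -/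
theorem angle_one (h : SCParams a b c r) :
    EuclideanGeometry.angle (scMap a b c r 0) (scMap a b c r 1) (scMap a b c r (1 / (r : ℂ) ^ 2)) =
      (c - b) * Real.pi := by
  have hp := h.one_lt
  have hπ := Real.pi_pos
  have := h.hb; have := h.hb1; have := h.hc1; have := h.hcb
  have s0 := h.side_zero_one le_rfl zero_le_one le_rfl
  have s1 := h.side_one_inv le_rfl hp.le le_rfl
  rw [coe_inv] at s1
  rw [Complex.ofReal_zero] at s0
  rw [Complex.ofReal_one] at s0 s1
  rw [angle_unitDir (h.scLength_pos zero_lt_one) (h.scLength_pos hp) (α := 0 + Real.pi)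
    (β := (b + 1 - c) * Real.pi) (by rw [s0, unitDir_add_pi]; ring) (by rw [s1]; ring)
    (by nlinarith) (by nlinarith)]
  ring

/-! ### The unbounded quadrilateral -/

theorem isConvexQuadrilateralAtInfinity (h : SCParams a b c r) (hc : c = 1 + a) :
    IsConvexQuadrilateralAtInfinity {z | ∃ p ∈ convexHull ℝ (Set.range
        ![scMap a b c r 0, scMap a b c r 1, scMap a b c r (1 / (r : ℂ) ^ 2)]),
        z ∈ closedRay p (unitDir (b * Real.pi))}
      ![scMap a b c r 0, scMap a b c r 1, scMap a b c r (1 / (r : ℂ) ^ 2)]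
      (unitDir (b * Real.pi)) ∧
    EuclideanGeometry.angle (scMap a b c r 0 + unitDir (b * Real.pi)) (scMap a b c r 0)
      (scMap a b c r 1) = b * Real.pi ∧
    EuclideanGeometry.angle (scMap a b c r 1) (scMap a b c r (1 / (r : ℂ) ^ 2))
      (scMap a b c r (1 / (r : ℂ) ^ 2) + unitDir (b * Real.pi)) = (1 - a) * Real.pi := by
  have hp := h.one_lt
  have hπ := Real.pi_pos
  have := h.ha; have := h.ha1; have := h.hb; have := h.hb1; have := h.hab; have := h.hc1
  have := h.hcb
  have s0 := h.side_zero_one le_rfl zero_le_one le_rfl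
  have s1 := h.side_one_inv le_rfl hp.le le_rfl
  have hA₀ := h.scLength_pos zero_lt_one
  have hA₁ := h.scLength_pos hp
  rw [coe_inv] at s1
  rw [Complex.ofReal_zero] at s0
  rw [Complex.ofReal_one] at s0 s1
  set A₀ := scLength a b c r 0 1
  set A₁ := scLength a b c r 1 (1 / r ^ 2)
  have d0 : scMap a b c r 1 - scMap a b c r 0 = A₀ * unitDir 0 := by rw [s0]; ring
  have d1 : scMap a b c r (1 / (r : ℂ) ^ 2) - scMap a b c r 1 =
    A₁ * unitDir ((b + 1 - c) * Real.pi) := by rw [s1]; ring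
  have d1' : scMap a b c r 1 - scMap a b c r (1 / (r : ℂ) ^ 2) =
    A₁ * unitDir ((b + 1 - c) * Real.pi + Real.pi) := by rw [s1, unitDir_add_pi]; ring
  have du : unitDir (b * Real.pi) = (1 : ℝ) * unitDir (b * Real.pi) := by simp
  refine ⟨isConvexQuadrilateralAtInfinity_of_planeCross ?_ ?_ ?_, ?_, ?_⟩
  · show 0 < planeCross (scMap a b c r 1 - scMap a b c r 0) (unitDir (b * Real.pi))
    rw [d0, du, planeCross_unitDir, sub_zero]
    exact mul_pos (mul_pos hA₀ one_pos) (sin_mul_pi_pos h.hb h.hb1)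
  · show 0 ≤ planeCross (scMap a b c r 1 - scMap a b c r 0)
      (scMap a b c r (1 / (r : ℂ) ^ 2) - scMap a b c r 1)
    rw [d0, d1, planeCross_unitDir, sub_zero]
    exact mul_nonneg (mul_pos hA₀ hA₁).le (sin_mul_pi_nonneg (by linarith) (by linarith))
  · show 0 < planeCross (scMap a b c r (1 / (r : ℂ) ^ 2) - scMap a b c r 1)
      (unitDir (b * Real.pi))
    rw [d1, du, planeCross_unitDir, ← sub_mul]
    exact mul_pos (mul_pos hA₁ one_pos) (sin_mul_pi_pos (by linarith) (by linarith))
  · rw [angle_unitDir one_pos hA₀ (α := b * Real.pi) (by rw [← du]; ring) d0 (by positivity)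
      (by nlinarith), sub_zero]
  · rw [angle_unitDir hA₁ one_pos d1' (β := b * Real.pi) (by rw [← du]; ring) (by nlinarith)
      (by nlinarith), hc]
    ring

theorem boundaryMap_unbounded (h : SCParams a b c r) (hc : c = 1 + a) :
    BoundaryMap (scMap a b c r) (cocompact ℂ) ∅ {z | ∃ p ∈ convexHull ℝ (Set.range
        ![scMap a b c r 0, scMap a b c r 1, scMap a b c r (1 / (r : ℂ) ^ 2)]),
        z ∈ closedRay p (unitDir (b * Real.pi))} := by
  have hQ := (h.isConvexQuadrilateralAtInfinity hc).1
  refine ⟨h.continuousOn_scMap, fun z hz => ⟨_, h.scConst_mul_ne_zero hz,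
    h.hasStrictDerivAt_scMap hz⟩, h.tendsto_scMap_cocompact_cocompact hc,
    fun p _ => (disjoint_nhds_cocompact p).symm, isClosed_empty, hQ.isClosed_and_convex.1,
    hQ.isClosed_and_convex.2, hQ.interior_nonempty, fun z hz => ?_, Set.empty_subset _,
    fun p d hd => ?_⟩
  · rw [ofReal_re_eq hz, hQ.frontier_eq]
    set x := z.re
    rcases le_total x 0 with h0 | h0
    · have e' := h.side_neg h0 le_rfl
      rw [Complex.ofReal_zero] at e'
      exact Or.inl (Or.inl (Or.inl ⟨_, h.scLength_nonneg h0, e'⟩))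
    rcases le_total x 1 with h1 | h1
    · have e := h.side_zero_one le_rfl h0 h1
      have e' := h.side_zero_one h0 h1 le_rfl
      rw [Complex.ofReal_zero] at e
      rw [Complex.ofReal_one] at e'
      exact Or.inl (Or.inl (Or.inr
        (mem_segment_of_add (h.scLength_nonneg h0) (h.scLength_nonneg h1) e e')))
    rcases le_total x (1 / r ^ 2) with h2 | h2
    · have e := h.side_one_inv le_rfl h1 h2
      have e' := h.side_one_inv h1 h2 le_rfl
      rw [Complex.ofReal_one] at e
      rw [coe_inv] at e'
      exact Or.inl (Or.inr
        (mem_segment_of_add (h.scLength_nonneg h1) (h.scLength_nonneg h2) e e'))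
    · have e := h.side_inv le_rfl h2
      rw [coe_inv, show a + b + 1 - c = b by rw [hc]; ring] at e
      exact Or.inr ⟨_, h.scLength_nonneg h2, e⟩
  · rw [Set.union_empty]
    exact h.exists_notMem_image_line hc p d hd

theorem injOn_unbounded (h : SCParams a b c r) (hc : c = 1 + a) :
    Set.InjOn (scMap a b c r) closedUpperHalfPlane := by
  have hB := h.boundaryMap_unbounded hc
  have hR := h.injOn_real fun y hy => h.tilt_inv_neg hc hy.le
  exact hB.injOn_closed (hB.injOn_interior (Complex.ofReal_im (1 / 2)) (Set.notMem_empty _)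
    (fun z hz e => hR hz (Complex.ofReal_im (1 / 2)) e) h.injOn_near_half) hR

end SCParams

theorem mainTheorem6 (a b c r : ℝ) (ha : 0 < a) (ha1 : a < 1) (hb : 0 < b) (hb1 : b < 1)
    (hc : max (a + b) 1 ≤ c) (hc' : c ≤ 1 + min a b) (hr : 0 < r) (hr1 : r < 1)
    (f : ℂ → ℂ) (hf : f = scMap a b c r)
    (r' : ℝ) (hr' : r' = Real.sqrt (1 - r ^ 2)) :
    -- the integral defining `f z` converges absolutely
    (∀ z ∈ closedUpperHalfPlane, IntervalIntegrable
      (fun s : ℝ => scIntegrand a b c r ((s : ℂ) * z) * z) MeasureTheory.volume 0 1) ∧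
    -- `f` is conformal in the interior of the half-plane
    (∀ z : ℂ, 0 < z.im →
      HasDerivAt f (scConst b c * scIntegrand a b c r z) z ∧ deriv f z ≠ 0) ∧
    -- the three vertices that are images of finite points
    f 0 = 0 ∧
    f 1 = ₂F₁ (a : ℂ) (b : ℂ) (c : ℂ) ((r : ℂ) ^ 2) ∧
    f (1 / (r : ℂ) ^ 2) = f 1 +
      Complex.betaIntegral ((c : ℂ) - b) (1 - (a : ℂ)) / Complex.betaIntegral b ((c : ℂ) - b) *
        Complex.exp (((b : ℂ) + 1 - c) * Complex.I * Real.pi) *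
        ((r' ^ (2 * (c - a - b)) : ℝ) : ℂ) *
        ₂F₁ ((c : ℂ) - a) ((c : ℂ) - b) ((c : ℂ) + 1 - a - b) ((r' : ℂ) ^ 2) ∧
    -- `c < 1 + a`: a bounded quadrilateral
    (c < 1 + a → ∃ (Q : Set ℂ) (w : ℂ),
      w = f (1 / (r : ℂ) ^ 2) +
        Complex.betaIntegral (1 - (a : ℂ)) ((a : ℂ) + 1 - c) /
            Complex.betaIntegral b ((c : ℂ) - b) *
          Complex.exp (((a : ℂ) + b + 1 - c) * Complex.I * Real.pi) *
          ((r ^ (2 * (1 - c)) : ℝ) : ℂ) * ((r' ^ (2 * (c - a - b)) : ℝ) : ℂ) *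
          ₂F₁ (1 - (b : ℂ)) (1 - (a : ℂ)) (2 - (c : ℂ)) ((r : ℂ) ^ 2) ∧
      IsConvexQuadrilateral Q ![f 0, f 1, f (1 / (r : ℂ) ^ 2), w] ∧
      EuclideanGeometry.angle w (f 0) (f 1) = b * Real.pi ∧
      EuclideanGeometry.angle (f 0) (f 1) (f (1 / (r : ℂ) ^ 2)) = (c - b) * Real.pi ∧
      EuclideanGeometry.angle (f 1) (f (1 / (r : ℂ) ^ 2)) w = (1 - a) * Real.pi ∧
      EuclideanGeometry.angle (f (1 / (r : ℂ) ^ 2)) w (f 0) = (a + 1 - c) * Real.pi ∧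
      ∃ Φ : OnePoint closedUpperHalfPlane ≃ₜ Q,
        (∀ z : closedUpperHalfPlane, (Φ (z : OnePoint closedUpperHalfPlane) : ℂ) = f z) ∧
        (Φ OnePoint.infty : ℂ) = w) ∧
    -- `c = 1 + a`: the fourth vertex is the point at infinity, with angle zero
    (c = 1 + a → ∃ (Q : Set ℂ) (u : ℂ),
      IsConvexQuadrilateralAtInfinity Q ![f 0, f 1, f (1 / (r : ℂ) ^ 2)] u ∧
      EuclideanGeometry.angle (f 0 + u) (f 0) (f 1) = b * Real.pi ∧
      EuclideanGeometry.angle (f 0) (f 1) (f (1 / (r : ℂ) ^ 2)) = (c - b) * Real.pi ∧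
      EuclideanGeometry.angle (f 1) (f (1 / (r : ℂ) ^ 2)) (f (1 / (r : ℂ) ^ 2) + u) =
        (1 - a) * Real.pi ∧
      (∃ Φ : closedUpperHalfPlane ≃ₜ Q, ∀ z : closedUpperHalfPlane, (Φ z : ℂ) = f z) ∧
      Filter.Tendsto f (Filter.cocompact ℂ ⊓ Filter.principal closedUpperHalfPlane)
        (Filter.cocompact ℂ)) := by
  subst hf
  have h : SCParams a b c r :=
    ⟨ha, ha1, hb, hb1, (le_max_left _ _).trans hc, (le_max_right _ _).trans hc,
      hc'.trans (by gcongr; exact min_le_left a b), hc'.trans (by gcongr; exact min_le_right a b),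
      hr, hr1⟩
  refine ⟨fun z _ => h.intervalIntegrable_segment z, fun z hz => ⟨h.hasDerivAt_scMap hz, ?_⟩,
    scMap_zero .., h.scMap_one, h.scMap_inv hr', fun hca => ?_, fun hca => ?_⟩
  · rw [(h.hasDerivAt_scMap hz).deriv]
    exact h.scConst_mul_ne_zero hz
  · have hw := h.tendsto_scMap_cocompact hca (h.tendsto_scMap_atTop hca)
    obtain ⟨hQ, angle₀, angle₂, angle₃⟩ := h.isConvexQuadrilateral hca hw
    exact ⟨_, _, by rw [h.vertex_infty hca hr'], hQ, angle₀, h.angle_one, angle₂, angle₃,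
      (h.boundaryMap_bounded hca hw).exists_homeomorph_onePoint (h.injOn_bounded hca hw)
        fun z hz => h.ne_of_tendsto hca hw hz⟩
  · obtain ⟨hQ, angle₀, angle₂⟩ := h.isConvexQuadrilateralAtInfinity hca
    exact ⟨_, _, hQ, angle₀, h.angle_one, angle₂,
      (h.boundaryMap_unbounded hca).exists_homeomorph (h.injOn_unbounded hca),
      h.tendsto_scMap_cocompact_cocompact hca⟩
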